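/- **Setting.** An instance of $P_m||C_{\max}$ consists of $n\ge 1$ jobs with real processing times $p_1,\dots,p_n\ge 0$ and $m\ge 1$ identical machines. A schedule assigns every job to one machine, the load of a machine is the sum of the processing times of its jobs, the makespan is the largest load, and $C_m^*$ is the smallest makespan of a schedule. Sort and renumber the jobs so that $p_1\ge p_2\ge\dots\ge p_n$. For a set $S$ of jobs let $LPT(S)$ be the following procedure: load all jobs of $S$ together on one machine, then assign the remaining jobs one at a time, in the sorted order, each to a machine whose load is smallest so far. $LPT=LPT(\emptyset)$. Ties (in the sorting, and between machines) are broken arbitrarily. In an LPT schedule each machine processes its jobs in the sorted order, and a job is called critical if its completion time equals the makespan. **Algorithm LPT-REV.** 1. Apply $LPT$; let $z_1$ be its makespan, $j'$ a critical job, and $k-1$ the number of jobs that precede $j'$ on its machine. 2. Apply $LPT(\{j'\})$; let $z_2$ be its makespan. 3. Apply $LPT(\{j'-k+1,\dots,j'\})$; let $z_3$ be its makespan. 4. Return $\min\{z_1,z_2,z_3\}$. **Theorem.** (i) Algorithm LPT-REV runs in $O(n\log n)$ time: there are a program and a constant $C$ such that, for all $n,m\ge1$ and all $p_1,\dots,p_n\ge0$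 (given in any order), the program halts with a value that LPT-REV returns under some way of breaking ties, and if $n\ge 2$ it does so after at most $C\,n\log n$ steps; $C$ does not depend on $m$ or on the processing times. Here a program is a finite system of first-order recursive functions on data built from real numbers and the empty list by cons cells, and each elementary operation (accessing a variable, binding a variable, evaluating a constant, creating or inspecting a cons cell, adding, subtracting or comparing two numbers, calling a function) takes one step. (ii) For $m\ge 3$ machines the approximation ratio of LPT-REV is at most $\frac43-\frac1{3(m-1)}$: every value $z$ that LPT-REV can return, however ties are broken and whichever critical job is taken, satisfies $$z\le\left(\frac43-\frac1{3(m-1)}\right)C_m^*.$$ This improves Graham's bound for LPT: $\frac43-\frac1{3(m-1)}<\frac43-\frac1{3m}$ for $m\ge3$. -/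

import Mathlib

namespace LPTRev

open scoped BigOperators

/-! ### Identical parallel machines

An instance consists of `n` jobs with processing times `p : Fin n → ℝ` and `m` identical machines.
A schedule is an assignment `s : Fin n → Fin m` of the jobs to the machines. -/

/-- The load of machine `i` in the schedule `s`. -/
noncomputable def load {n m : ℕ} (p : Fin n → ℝ) (s : Fin n → Fin m) (i : Fin m) : ℝ :=
  ∑ l with s l = i, p l

/-- The makespan of the schedule `s`: the largest load of a machine. -/
noncomputable def makespan {n m : ℕ} (p : Fin n → ℝ) (s : Fin n → Fin m) : ℝ :=
  ⨆ i : Fin m, load p s i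

/-- The optimal makespan on `m` machines: the least makespan of a schedule. -/
noncomputable def optMakespan {n : ℕ} (m : ℕ) (p : Fin n → ℝ) : ℝ :=
  ⨅ s : Fin n → Fin m, makespan p s

/-! ### LPT and its variants

In this part `q : Fin n → ℝ` lists the processing times in non-increasing order, so that the jobs
are numbered by their position in the sorted order. -/

/-- The load of machine `i` at the moment when job `j` is assigned by list scheduling: the jobs in
`S` have been loaded first, and of the others those that precede `j`. -/
noncomputable def loadBefore {n m : ℕ} (S : Finset (Fin n)) (q : Fin n → ℝ) (s : Fin n → Fin m)
    (j : Fin n) (i : Fin m) : ℝ :=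
  ∑ l with (l ∈ S ∨ l < j) ∧ s l = i, q l

/-- `s` is a schedule produced by `LPT(S)`: the jobs in `S` are first loaded all together on one
machine, then the other jobs are assigned one at a time, in the given (sorted) order, each to
a machine whose load is smallest so far. Ties are broken arbitrarily. -/
def IsLPTSchedule {n m : ℕ} (S : Finset (Fin n)) (q : Fin n → ℝ) (s : Fin n → Fin m) : Prop :=
  (∀ j ∈ S, ∀ l ∈ S, s j = s l) ∧
    ∀ j, j ∉ S → ∀ i : Fin m, loadBefore S q s j (s j) ≤ loadBefore S q s j i

/-- The jobs that are on the machine of job `j` and do not come after `j`, including `j`. -/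
def jobsUpTo {n m : ℕ} (s : Fin n → Fin m) (j : Fin n) : Finset (Fin n) :=
  {l | l ≤ j ∧ s l = s j}

/-- Job `j` is critical: its completion time (in a schedule where every machine processes its jobs
in the sorted order) is the makespan. -/
def IsCritical {n m : ℕ} (q : Fin n → ℝ) (s : Fin n → Fin m) (j : Fin n) : Prop :=
  ∑ l ∈ jobsUpTo s j, q l = makespan q s

/-- The critical tuple: the `k` jobs `j - k + 1, …, j`, where `k - 1` is the number of jobs
that precede `j` on its machine. -/
def criticalTuple {n m : ℕ} (s : Fin n → Fin m) (j : Fin n) : Finset (Fin n) :=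
  {l | l ≤ j ∧ (j : ℕ) < (l : ℕ) + (jobsUpTo s j).card}

/-- `z` is a value returned by Algorithm LPT-REV on `m` machines and processing times `p`
(in any order). The permutation `σ` sorts the jobs by non-increasing processing time; LPT yields
`s₁` with critical job `j`; `LPT({j})` yields `s₂`, and LPT with the critical tuple loaded first
yields `s₃`; the smallest of the three makespans is returned. Different ways to break ties may
lead to different values `z`. -/
def IsOutput {n : ℕ} (m : ℕ) (p : Fin n → ℝ) (z : ℝ) : Prop :=
  ∃ σ : Equiv.Perm (Fin n), Antitone (p ∘ σ) ∧
    ∃ (s₁ s₂ s₃ : Fin n → Fin m) (j : Fin n),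
      IsLPTSchedule ∅ (p ∘ σ) s₁ ∧
      IsCritical (p ∘ σ) s₁ j ∧
      IsLPTSchedule {j} (p ∘ σ) s₂ ∧
      IsLPTSchedule (criticalTuple s₁ j) (p ∘ σ) s₃ ∧
      z = min (makespan (p ∘ σ) s₁) (min (makespan (p ∘ σ) s₂) (makespan (p ∘ σ) s₃))

/-! ### The machine model

Programs are systems of first-order recursive functions on cons cells whose atoms are the empty
list and real numbers (pure Lisp). Every elementary operation takes one step: variable access,
creating or inspecting a cons cell, adding, subtracting or comparing two numbers, binding
a variable, calling a function. Each of these takes constant time on a unit-cost random access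
machine, so a time bound in this model is also one for the random access machine. -/

/-- The data: the empty list, a number, or a cons cell. -/
inductive Val : Type
  | nil : Val
  | num (x : ℝ) : Val
  | pair (a b : Val) : Val

/-- Expressions. Variables are de Bruijn indices; functions are referred to by number and take one
argument. -/
inductive Expr : Type
  | var (i : ℕ) : Expr
  | nil : Expr
  | const (c : ℕ) : Expr
  | pair (a b : Expr) : Expr
  | add (a b : Expr) : Expr
  | sub (a b : Expr) : Expr
  /-- Evaluate `a`, bind its value as variable `0` in `b`. -/
  | letIn (a b : Expr) : Expr
  /-- If the number `a` is at most the number `b` then `yes`, else `no`. -/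
  | ifLe (a b yes no : Expr) : Expr
  /-- If `a` is a cons cell then `yes`, with its components bound as the variables `0` and `1`;
  if `a` is the empty list then `no`. -/
  | casePair (a yes no : Expr) : Expr
  /-- Call function number `f` with argument `a`. -/
  | call (f : ℕ) (a : Expr) : Expr

/-- A program is the list of the bodies of its functions; function `0` is the main function. -/
abbrev Program : Type := List Expr

/-- `Eval P env e v t`: with the functions of `P`, in the environment `env`, the expression `e`
evaluates to `v` in exactly `t` steps. Type errors and infinite recursion have no value. -/
inductive Eval (P : Program) : List Val → Expr → Val → ℕ → Prop
  | var {env : List Val} {i : ℕ} {v : Val} (h : env[i]? = some v) : Eval P env (.var i) v 1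
  | nil {env : List Val} : Eval P env .nil .nil 1
  | const {env : List Val} {c : ℕ} : Eval P env (.const c) (.num (c : ℝ)) 1
  | pair {env : List Val} {a b : Expr} {v w : Val} {t u : ℕ}
      (ha : Eval P env a v t) (hb : Eval P env b w u) :
      Eval P env (.pair a b) (.pair v w) (t + u + 1)
  | add {env : List Val} {a b : Expr} {x y : ℝ} {t u : ℕ}
      (ha : Eval P env a (.num x) t) (hb : Eval P env b (.num y) u) :
      Eval P env (.add a b) (.num (x + y)) (t + u + 1)
  | sub {env : List Val} {a b : Expr} {x y : ℝ} {t u : ℕ}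
      (ha : Eval P env a (.num x) t) (hb : Eval P env b (.num y) u) :
      Eval P env (.sub a b) (.num (x - y)) (t + u + 1)
  | letIn {env : List Val} {a b : Expr} {v w : Val} {t u : ℕ}
      (ha : Eval P env a v t) (hb : Eval P (v :: env) b w u) :
      Eval P env (.letIn a b) w (t + u + 1)
  | ifLe_yes {env : List Val} {a b yes no : Expr} {x y : ℝ} {v : Val} {t u r : ℕ}
      (ha : Eval P env a (.num x) t) (hb : Eval P env b (.num y) u) (hxy : x ≤ y)
      (hv : Eval P env yes v r) :
      Eval P env (.ifLe a b yes no) v (t + u + r + 1)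
  | ifLe_no {env : List Val} {a b yes no : Expr} {x y : ℝ} {v : Val} {t u r : ℕ}
      (ha : Eval P env a (.num x) t) (hb : Eval P env b (.num y) u) (hxy : ¬ x ≤ y)
      (hv : Eval P env no v r) :
      Eval P env (.ifLe a b yes no) v (t + u + r + 1)
  | casePair_yes {env : List Val} {a yes no : Expr} {x y v : Val} {t u : ℕ}
      (ha : Eval P env a (.pair x y) t) (hv : Eval P (x :: y :: env) yes v u) :
      Eval P env (.casePair a yes no) v (t + u + 1)
  | casePair_no {env : List Val} {a yes no : Expr} {v : Val} {t u : ℕ}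
      (ha : Eval P env a .nil t) (hv : Eval P env no v u) :
      Eval P env (.casePair a yes no) v (t + u + 1)
  | call {env : List Val} {f : ℕ} {a body : Expr} {v w : Val} {t u : ℕ}
      (ha : Eval P env a v t) (hf : P[f]? = some body) (hb : Eval P [v] body w u) :
      Eval P env (.call f a) w (t + u + 1)

/-- The program `P`, started on `input`, halts after `t` steps with result `v`. -/
def HaltsWith (P : Program) (input v : Val) (t : ℕ) : Prop :=
  Eval P [input] (.call 0 (.var 0)) v t

/-- A list of numbers as a value. -/
def encodeList : List ℝ → Val
  | [] => .nil
  | x :: xs => .pair (.num x) (encodeList xs)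

/-- The input: the number of machines and the (unsorted) list of processing times. -/
def encodeInstance {n : ℕ} (m : ℕ) (p : Fin n → ℝ) : Val :=
  .pair (.num (m : ℝ)) (encodeList (List.ofFn p))

end LPTRev

/-!
# LPT-REV: approximation ratio and running time

**Ratio.** Put `r = 1/3 - 1/(3(m-1))`, scale the optimal makespan to `1`, and suppose that all three
schedules have a makespan above `1 + r`. Let `j` be the critical job of LPT and `p` its length. The
average load shows `(m-1) p > m r`, so an optimal schedule has at most three of the jobs `0, …, j`
on a machine. The same estimate applies to the last job of a machine with maximal load in `LPT(S)`, and
jobs after `j` are too short for it (`BadLPT.mul_le_of_sum_le`); so only the jobs up to `j` matter.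
This situation is `BadLPT` for LPT and `BadPreloaded` for `LPT(S)`.

Jobs longer than `1 - p` are alone on their machine in the optimal schedule. Deleting them together
with their machines, from both schedules, and comparing what is left (`BadLPT.compare`), by the
number of jobs and by total length, yields `p ≤ 1/3` and then that there are no such jobs. So LPT
has at least two jobs on every machine before `j`, whereas the optimum has at most three.

For `m ≥ 4` a machine with three jobs before `j` is impossible: by total length for `m ≥ 5`, by
a pigeonhole argument for `m = 4` (`BadLPT.card_eq_two`). So there are `2m + 1` jobs. The optimal
schedule then has a machine with three jobs, none of them among the first `m`, and
`BadLPT.late_job` shows that a late job of `LPT({j})` would meet a job with which it could not be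
paired in the optimal schedule.

For `m = 3` there are seven, eight or nine jobs. Here a job longer than `p + 1/6` cannot share its
machine in the optimal schedule with another one of this kind and a third job; counting them
excludes eight and nine jobs (`BadLPT.ne_seven`, `BadLPT.ne_eight`, the critical job having the number `7` or
`8`). With seven jobs, either the optimal schedule has the last three jobs on one machine, and
loading this critical tuple first is optimal (`BadLPT.not_badPreloaded_tuple`), or `LPT({j})` is
not bad (`BadLPT.not_badPreloaded_of_three`).

**Time.** All priority queues are Braun trees in heap order. List scheduling only replaces the root
by a larger key, which is done by sifting down in a tree of fixed shape; the same operation, with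
a key larger than all others, extracts the jobs in sorted order. The heap of machines has
`min m n` nodes, which suffices because with `m > n` one of the first `n` machines is always empty
(`isLPTSchedule_castLE`); this makes the time independent of `m`. The program is related to
functions on lists and trees by evaluation lemmas with step counts (`haltsWith_lptRev`), and these
functions to schedules through the multiset of the node labels (`schedule_spec`,
`isOutput_lptRev`).
-/

namespace LPTRev

open Finset

/-! ### The jobs on a machine -/

/-- The jobs among `0, …, k - 1` that the schedule `s` puts on machine `i`. -/
def jobsOn {m : ℕ} (s : ℕ → Fin m) (k : ℕ) (i : Fin m) : Finset ℕ :=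
  {l ∈ range k | s l = i}

section jobsOn

variable {m : ℕ} {s : ℕ → Fin m} {k l : ℕ} {i : Fin m}

@[simp]
theorem mem_jobsOn : l ∈ jobsOn s k i ↔ l < k ∧ s l = i := by simp [jobsOn]

theorem jobsOn_mono {k k' : ℕ} (h : k ≤ k') : jobsOn s k i ⊆ jobsOn s k' i := by
  intro l hl
  rw [mem_jobsOn] at hl ⊢
  exact ⟨by omega, hl.2⟩

theorem sum_card_jobsOn (s : ℕ → Fin m) (k : ℕ) : ∑ i, (jobsOn s k i).card = k := by
  have := Finset.card_eq_sum_card_fiberwise (s := range k) (t := univ) (f := s)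
    (fun _ _ => by simp)
  rw [card_range] at this
  exact this.symm

theorem sum_sum_jobsOn (s : ℕ → Fin m) (k : ℕ) (w : ℕ → ℝ) :
    ∑ i, ∑ l ∈ jobsOn s k i, w l = ∑ l ∈ range k, w l :=
  Finset.sum_fiberwise (range k) s w

/-- If fewer jobs than machines have been assigned, some machine is empty. -/
theorem exists_jobsOn_eq_empty (s : ℕ → Fin m) (h : k < m) : ∃ i, jobsOn s k i = ∅ := by
  by_contra! hne
  have h1 : ∑ _i : Fin m, 1 ≤ ∑ i, (jobsOn s k i).card :=
    sum_le_sum fun i _ => card_pos.2 (hne i)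
  rw [sum_card_jobsOn] at h1
  simp at h1
  omega

/-- The two jobs of a machine with two jobs, in the order of their numbers. -/
theorem exists_lt_of_card_eq_two (h : (jobsOn s k i).card = 2) :
    ∃ x y, x < y ∧ y < k ∧ s x = i ∧ s y = i ∧ jobsOn s k i = {x, y} := by
  obtain ⟨x, y, hxy, he⟩ := card_eq_two.1 h
  have hx : x ∈ jobsOn s k i := by simp [he]
  have hy : y ∈ jobsOn s k i := by simp [he]
  rw [mem_jobsOn] at hx hy
  rcases lt_or_gt_of_ne hxy with h1 | h1
  · exact ⟨x, y, h1, hy.1, hx.2, hy.2, he⟩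
  · exact ⟨y, x, h1, hx.1, hy.2, hx.2, by rw [he, pair_comm]⟩

/-- The three jobs of a machine with three jobs, in the order of their numbers. -/
theorem exists_lt_of_card_eq_three (h : (jobsOn s k i).card = 3) :
    ∃ x y z, x < y ∧ y < z ∧ z < k ∧ s x = i ∧ s y = i ∧ s z = i ∧
      jobsOn s k i = {x, y, z} := by
  have hne : (jobsOn s k i).Nonempty := card_pos.1 (by omega)
  set x := (jobsOn s k i).min' hne with hxdef
  have hx : x ∈ jobsOn s k i := min'_mem _ _
  have h2 : ((jobsOn s k i).erase x).card = 2 := by rw [card_erase_of_mem hx, h]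
  obtain ⟨y, z, hyz, he⟩ := card_eq_two.1 h2
  have hy : y ∈ (jobsOn s k i).erase x := by simp [he]
  have hz : z ∈ (jobsOn s k i).erase x := by simp [he]
  have hset : jobsOn s k i = {x, y, z} := by rw [← insert_erase hx, he]
  have hxy : x < y := lt_of_le_of_ne (min'_le _ _ (mem_of_mem_erase hy))
    (ne_of_mem_erase hy).symm
  have hxz : x < z := lt_of_le_of_ne (min'_le _ _ (mem_of_mem_erase hz))
    (ne_of_mem_erase hz).symm
  have hx' := mem_jobsOn.1 hx
  have hy' := mem_jobsOn.1 (mem_of_mem_erase hy)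
  have hz' := mem_jobsOn.1 (mem_of_mem_erase hz)
  rcases lt_or_gt_of_ne hyz with h1 | h1
  · exact ⟨x, y, z, hxy, h1, hz'.1, hx'.2, hy'.2, hz'.2, hset⟩
  · exact ⟨x, z, y, hxz, h1, hy'.1, hx'.2, hz'.2, hy'.2, by rw [hset, pair_comm y z]⟩

end jobsOn

/-! ### Bad LPT schedules -/

/-- A schedule `s` of the jobs `0, …, j` on `m ≥ 3` machines that follows LPT and in which job `j`
completes later than `1 + r` with `r = 1/3 - 1/(3(m-1))`, although a schedule `o` with makespan at
most `1` exists. -/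
structure BadLPT (m j : ℕ) (q : ℕ → ℝ) (s o : ℕ → Fin m) (r : ℝ) : Prop where
  hm : 3 ≤ m
  hr : 3 * ((m : ℝ) - 1) * r = m - 2
  anti : ∀ i l, i ≤ l → l ≤ j → q l ≤ q i
  nonneg : 0 ≤ q j
  greedy : ∀ l ≤ j, ∀ i, ∑ x ∈ jobsOn s l (s l), q x ≤ ∑ x ∈ jobsOn s l i, q x
  opt : ∀ i, ∑ x ∈ jobsOn o (j + 1) i, q x ≤ 1
  bad : 1 + r < ∑ x ∈ jobsOn s j (s j), q x + q j

namespace BadLPT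

variable {m j : ℕ} {q : ℕ → ℝ} {s o : ℕ → Fin m} {r : ℝ}

theorem three_le (h : BadLPT m j q s o r) : (3 : ℝ) ≤ m := by exact_mod_cast h.hm

theorem r_pos (h : BadLPT m j q s o r) : 0 < r := by
  have := h.three_le
  have := h.hr
  by_contra! hr
  nlinarith

theorem le_q (h : BadLPT m j q s o r) {l : ℕ} (hl : l ≤ j) : q j ≤ q l := h.anti l j hl le_rfl

theorem q_nonneg (h : BadLPT m j q s o r) {l : ℕ} (hl : l ≤ j) : 0 ≤ q l :=
  h.nonneg.trans (h.le_q hl)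

theorem lt_load (h : BadLPT m j q s o r) (i : Fin m) :
    1 + r - q j < ∑ x ∈ jobsOn s j i, q x := by
  have := h.greedy j le_rfl i
  have := h.bad
  linarith

theorem sum_le (h : BadLPT m j q s o r) : ∑ x ∈ range (j + 1), q x ≤ m := by
  rw [← sum_sum_jobsOn o]
  calc _ ≤ ∑ _i : Fin m, (1 : ℝ) := sum_le_sum fun i _ => h.opt i
    _ = m := by simp

/-- A lower bound on the load of one machine, together with the bound `1 + r - q j` for the others,
bounds the total processing time. -/
theorem total_gt (h : BadLPT m j q s o r) (i : Fin m) (L : ℝ)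
    (hL : L ≤ ∑ x ∈ jobsOn s j i, q x) : (m - 1) * (1 + r - q j) + L + q j < m := by
  have h1 := h.sum_le
  rw [sum_range_succ, ← sum_sum_jobsOn s, ← add_sum_erase univ _ (mem_univ i)] at h1
  have h2 : ∑ _x ∈ univ.erase i, (1 + r - q j)
      < ∑ x ∈ univ.erase i, ∑ l ∈ jobsOn s j x, q l := by
    refine sum_lt_sum_of_nonempty ?_ fun x _ => h.lt_load x
    rw [← card_pos, card_erase_of_mem (mem_univ i)]
    have := h.hm
    simp
    omega
  rw [sum_const, card_erase_of_mem (mem_univ i), card_univ, Fintype.card_fin, nsmul_eq_mul,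
    Nat.cast_sub (by have := h.hm; omega), Nat.cast_one] at h2
  linarith

theorem mul_r_lt (h : BadLPT m j q s o r) : m * r < (m - 1) * q j := by
  have h1 := h.total_gt (s j) _ (h.lt_load (s j)).le
  linarith

theorem q_pos (h : BadLPT m j q s o r) : 0 < q j := by
  have h1 := h.mul_r_lt
  have h2 := h.r_pos
  have h3 := h.three_le
  by_contra! h4
  nlinarith

theorem q_pos' (h : BadLPT m j q s o r) {l : ℕ} (hl : l ≤ j) : 0 < q l :=
  h.q_pos.trans_le (h.le_q hl)

theorem quarter_lt (h : BadLPT m j q s o r) : 1 / 4 < q j := by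
  have h1 := h.mul_r_lt
  have h2 := h.hr
  have h3 := h.three_le
  by_contra! h4
  have h5 : 3 * ((m : ℝ) - 1) * (m * r) < 3 * (m - 1) * ((m - 1) * q j) :=
    mul_lt_mul_of_pos_left h1 (by linarith)
  have h6 : ((m : ℝ) - 1) * (m - 1) * q j ≤ (m - 1) * (m - 1) * (1 / 4) :=
    mul_le_mul_of_nonneg_left h4 (by nlinarith)
  have h7 : (m : ℝ) * (3 * (m - 1) * r) = m * (m - 2) := by rw [h2]
  nlinarith

theorem q_le_one (h : BadLPT m j q s o r) {l : ℕ} (hl : l ≤ j) : q l ≤ 1 := by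
  refine le_trans ?_ (h.opt (o l))
  exact single_le_sum (f := q) (fun x hx => h.q_nonneg (by rw [mem_jobsOn] at hx; omega))
    (mem_jobsOn.2 ⟨by omega, rfl⟩)

theorem sum_le_one_of_subset (h : BadLPT m j q s o r) (A : Finset ℕ) (i : Fin m)
    (hA : ∀ x ∈ A, x ≤ j ∧ o x = i) : ∑ x ∈ A, q x ≤ 1 := by
  refine le_trans ?_ (h.opt i)
  refine sum_le_sum_of_subset_of_nonneg (fun x hx => ?_) fun x hx _ => ?_
  · have := hA x hx
    exact mem_jobsOn.2 ⟨by omega, this.2⟩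
  · exact h.q_nonneg (by rw [mem_jobsOn] at hx; omega)

theorem pair_le (h : BadLPT m j q s o r) {x y : ℕ} (hx : x ≤ j) (hy : y ≤ j) (hxy : x ≠ y)
    (ho : o x = o y) : q x + q y ≤ 1 := by
  have := h.sum_le_one_of_subset {x, y} (o y) (by simp [ho, hx, hy])
  rwa [sum_pair hxy] at this

theorem triple_le (h : BadLPT m j q s o r) {x y z : ℕ} (hx : x ≤ j) (hy : y ≤ j) (hz : z ≤ j)
    (hxy : x ≠ y) (hxz : x ≠ z) (hyz : y ≠ z) (h1 : o x = o z) (h2 : o y = o z) :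
    q x + q y + q z ≤ 1 := by
  have := h.sum_le_one_of_subset {x, y, z} (o z) (by simp [hx, hy, hz, h1, h2])
  rwa [sum_insert (by simp [hxy, hxz]), sum_pair hyz, ← add_assoc] at this

theorem card_opt_le (h : BadLPT m j q s o r) (i : Fin m) : (jobsOn o (j + 1) i).card ≤ 3 := by
  by_contra! hc
  have h1 : (jobsOn o (j + 1) i).card • (q j) ≤ ∑ x ∈ jobsOn o (j + 1) i, q x :=
    card_nsmul_le_sum _ _ _ fun x hx => h.le_q (by rw [mem_jobsOn] at hx; omega)
  have h2 := h.opt i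
  have h3 := h.quarter_lt
  have h4 : (4 : ℝ) ≤ (jobsOn o (j + 1) i).card := by exact_mod_cast hc
  rw [nsmul_eq_mul] at h1
  nlinarith

/-- LPT puts the first `m` jobs on different machines. -/
theorem inj (h : BadLPT m j q s o r) {l l' : ℕ} (hll : l < l') (hm : l' < m) (hj : l' ≤ j) :
    s l ≠ s l' := by
  intro he
  obtain ⟨i, hi⟩ := exists_jobsOn_eq_empty s hm
  have h1 := h.greedy l' hj i
  rw [hi, sum_empty] at h1
  have h2 : q l ≤ ∑ x ∈ jobsOn s l' (s l'), q x :=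
    single_le_sum (f := q) (fun x hx => h.q_nonneg (by rw [mem_jobsOn] at hx; omega))
      (mem_jobsOn.2 ⟨hll, he⟩)
  have := h.q_pos' (l := l) (by omega)
  linarith

/-- The jobs before `j` that are too long to share a machine with another job in `o`. -/
noncomputable def alone (_h : BadLPT m j q s o r) : Finset ℕ := {l ∈ range j | 1 - q j < q l}

theorem opt_ne_of_mem_alone (h : BadLPT m j q s o r) {l x : ℕ} (hl : l ∈ h.alone) (hx : x ≤ j)
    (hxl : x ≠ l) : o x ≠ o l := by
  intro he
  simp only [alone, mem_filter, mem_range] at hl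
  have := h.pair_le hx (by omega) hxl he
  have := h.le_q hx
  linarith

theorem card_alone_lt (h : BadLPT m j q s o r) : h.alone.card < m := by
  have h1 : (h.alone.image o).card = h.alone.card := by
    refine card_image_of_injOn fun x hx y hy hxy => ?_
    by_contra hne
    have hxj : x ≤ j := by simp [alone] at hx; omega
    exact h.opt_ne_of_mem_alone hy hxj hne hxy
  have h2 : h.alone.image o ⊆ univ.erase (o j) := by
    intro i hi
    obtain ⟨l, hl, rfl⟩ := mem_image.1 hi
    refine mem_erase.2 ⟨fun he => ?_, mem_univ _⟩
    exact h.opt_ne_of_mem_alone hl le_rfl (by simp [alone] at hl; omega) he.symm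
  have h3 := card_le_card h2
  rw [card_erase_of_mem (mem_univ _), card_univ, Fintype.card_fin, h1] at h3
  have := h.hm
  omega

theorem inj_alone (h : BadLPT m j q s o r) {x y : ℕ} (hy : y ∈ h.alone) (hxy : x < y) :
    s x ≠ s y := by
  refine h.inj hxy ?_ ?_
  · -- all predecessors of a job in `alone` are in `alone`
    have h1 : range (y + 1) ⊆ h.alone := by
      intro l hl
      simp only [alone, mem_filter, mem_range] at hl hy ⊢
      exact ⟨by omega, hy.2.trans_le (h.anti l y (by omega) (by omega))⟩
    have h2 := card_le_card h1
    have h3 := h.card_alone_lt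
    rw [card_range] at h2
    omega
  · simp [alone] at hy; omega

/-- Comparison of `s` with `o` on the machines that hold no job of `alone`: there are as many of
them in `s` as in `o`, and they carry the same jobs, except that `j` is missing in `s`. -/
theorem compare (h : BadLPT m j q s o r) (w : ℕ → ℝ) (hw : ∀ l ≤ j, 0 ≤ w l) (U D : ℝ)
    (hU : ∀ i, ∑ x ∈ jobsOn o (j + 1) i, w x ≤ U)
    (hD : ∀ i, (∀ l ∈ h.alone, s l ≠ i) → D ≤ ∑ x ∈ jobsOn s j i, w x) :
    (m - h.alone.card) * D + w j ≤ (m - h.alone.card) * U := by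
  have hlt := h.card_alone_lt
  have hso : (univ \ h.alone.image o).card = m - h.alone.card := by
    rw [card_sdiff_of_subset (subset_univ _), card_image_of_injOn, card_univ, Fintype.card_fin]
    intro x hx y hy hxy
    by_contra hne
    exact h.opt_ne_of_mem_alone hy (by simp [alone] at hx; omega) hne hxy
  have hss : (univ \ h.alone.image s).card = m - h.alone.card := by
    rw [card_sdiff_of_subset (subset_univ _), card_image_of_injOn, card_univ, Fintype.card_fin]
    intro x hx y hy hxy
    rcases lt_trichotomy x y with h1 | h1 | h1
    · exact absurd hxy (h.inj_alone hy h1)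
    · exact h1
    · exact absurd hxy.symm (h.inj_alone hx h1)
  have hjn : j ∉ h.alone := by simp [alone]
  have hup : ∑ x ∈ range (j + 1) \ h.alone, w x ≤ (m - h.alone.card) * U := by
    rw [← sum_fiberwise_of_maps_to (t := univ \ h.alone.image o) (g := o)]
    · calc _ ≤ ∑ _i ∈ univ \ h.alone.image o, U := by
            refine sum_le_sum fun i _ => le_trans ?_ (hU i)
            refine sum_le_sum_of_subset_of_nonneg (fun x hx => ?_) fun x hx _ => ?_
            · simp only [mem_filter, mem_sdiff, mem_range] at hx
              exact mem_jobsOn.2 ⟨hx.1.1, hx.2⟩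
            · exact hw x (by rw [mem_jobsOn] at hx; omega)
        _ = _ := by rw [sum_const, hso, nsmul_eq_mul, Nat.cast_sub hlt.le]
    · intro x hx
      simp only [mem_sdiff, mem_range, mem_image, mem_univ, true_and, not_exists, not_and] at hx ⊢
      intro l hl he
      exact h.opt_ne_of_mem_alone hl (by omega) (by rintro rfl; exact hx.2 hl) he.symm
  have hlow : (m - h.alone.card) * D + w j ≤ ∑ x ∈ range (j + 1) \ h.alone, w x := by
    have hsplit : range (j + 1) \ h.alone = insert j (range j \ h.alone) := by
      ext x
      simp only [mem_sdiff, mem_range, mem_insert]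
      constructor
      · rintro ⟨h1, h2⟩
        by_cases hx : x = j
        · exact Or.inl hx
        · exact Or.inr ⟨by omega, h2⟩
      · rintro (rfl | ⟨h1, h2⟩)
        · exact ⟨by omega, hjn⟩
        · exact ⟨by omega, h2⟩
    rw [hsplit, sum_insert (by simp), add_comm]
    refine add_le_add le_rfl ?_
    calc ((m : ℝ) - h.alone.card) * D = ∑ _i ∈ univ \ h.alone.image s, D := by
          rw [sum_const, hss, nsmul_eq_mul, Nat.cast_sub hlt.le]
      _ ≤ ∑ i ∈ univ \ h.alone.image s, ∑ x ∈ jobsOn s j i, w x := by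
          refine sum_le_sum fun i hi => hD i fun l hl he => ?_
          simp only [mem_sdiff, mem_image, not_exists, not_and] at hi
          exact hi.2 l hl he
      _ = ∑ i ∈ univ \ h.alone.image s, ∑ x ∈ range j \ h.alone with s x = i, w x := by
          refine sum_congr rfl fun i hi => sum_congr ?_ fun _ _ => rfl
          simp only [mem_sdiff, mem_image, not_exists, not_and] at hi
          ext x
          simp only [mem_jobsOn, mem_filter, mem_sdiff, mem_range]
          exact ⟨fun hx => ⟨⟨hx.1, fun hxa => hi.2 x hxa hx.2⟩, hx.2⟩, fun hx => ⟨hx.1.1, hx.2⟩⟩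
      _ ≤ ∑ x ∈ range j \ h.alone, w x := by
          refine (sum_le_sum_of_subset_of_nonneg (subset_univ _) fun i _ _ => ?_).trans
            (sum_fiberwise (range j \ h.alone) s w).le
          exact sum_nonneg fun x hx => hw x (by simp at hx; omega)
  linarith

theorem two_le_card_of_alone (h : BadLPT m j q s o r) (i : Fin m) (hi : ∀ l ∈ h.alone, s l ≠ i) :
    2 ≤ (jobsOn s j i).card := by
  by_contra! hc
  have h1 := h.lt_load i
  have h2 := h.r_pos
  have h3 := h.q_le_one (l := j) le_rfl
  rcases (jobsOn s j i).eq_empty_or_nonempty with he | hne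
  · rw [he, sum_empty] at h1
    linarith
  · obtain ⟨l, hl⟩ := card_eq_one.1 (le_antisymm (by omega) (card_pos.2 hne))
    have hmem : l ∈ jobsOn s j i := by simp [hl]
    rw [mem_jobsOn] at hmem
    rw [hl, sum_singleton] at h1
    refine hi l ?_ hmem.2
    simp only [alone, mem_filter, mem_range]
    exact ⟨hmem.1, by linarith⟩

theorem le_third (h : BadLPT m j q s o r) : q j ≤ 1 / 3 := by
  by_contra! hq
  have h1 := h.compare (fun _ => 1) (fun _ _ => zero_le_one) 2 2 (fun i => ?_) fun i hi => ?_
  · have := h.card_alone_lt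
    linarith
  · rw [sum_const, nsmul_one]
    by_contra! hc
    have hc' : 3 ≤ (jobsOn o (j + 1) i).card := by exact_mod_cast hc
    have h1 : (jobsOn o (j + 1) i).card • (q j) ≤ ∑ x ∈ jobsOn o (j + 1) i, q x :=
      card_nsmul_le_sum _ _ _ fun x hx => h.le_q (by rw [mem_jobsOn] at hx; omega)
    have h2 := h.opt i
    have h4 : (3 : ℝ) ≤ (jobsOn o (j + 1) i).card := by exact_mod_cast hc'
    rw [nsmul_eq_mul] at h1
    nlinarith
  · rw [sum_const, nsmul_one]
    exact_mod_cast h.two_le_card_of_alone i hi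

theorem alone_eq_empty (h : BadLPT m j q s o r) : h.alone = ∅ := by
  by_contra hne
  have hb : 1 ≤ h.alone.card := card_pos.2 (nonempty_iff_ne_empty.2 hne)
  have h1 := h.compare q (fun l hl => h.q_nonneg hl) 1 _ h.opt fun i _ => h.greedy j le_rfl i
  have h2 := h.le_third
  have h3 := h.hr
  have h4 := h.three_le
  have h5 := h.bad
  have hb' : (1 : ℝ) ≤ h.alone.card := by exact_mod_cast hb
  have h6 : (h.alone.card : ℝ) + 1 ≤ m := by exact_mod_cast h.card_alone_lt
  -- with `d` machines left: `d r + q j < d q j`, impossible as `q j ≤ 1/3` and `d ≤ m - 1`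
  set d : ℝ := m - h.alone.card with hd
  have hd1 : 1 ≤ d := by linarith
  have hdm : d ≤ m - 1 := by linarith
  have h8 : d * r < (d - 1) * (1 / 3) := by nlinarith
  have h9 : d * (m - 2) < (d - 1) * (m - 1) := by
    have : (3 * ((m : ℝ) - 1)) * (d * r) < (3 * (m - 1)) * ((d - 1) * (1 / 3)) :=
      mul_lt_mul_of_pos_left h8 (by linarith)
    rw [← h3]
    linarith
  linarith

theorem two_le_card (h : BadLPT m j q s o r) (i : Fin m) : 2 ≤ (jobsOn s j i).card :=
  h.two_le_card_of_alone i (by simp [h.alone_eq_empty])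

theorem le_one_sub (h : BadLPT m j q s o r) {l : ℕ} (hl : l < j) : q l ≤ 1 - q j := by
  by_contra! hq
  have : l ∈ h.alone := by simp [alone, hl, hq]
  simp [h.alone_eq_empty] at this

theorem two_mul_le (h : BadLPT m j q s o r) : 2 * m ≤ j := by
  have h1 : ∑ _i : Fin m, 2 ≤ ∑ i, (jobsOn s j i).card := sum_le_sum fun i _ => h.two_le_card i
  rw [sum_card_jobsOn] at h1
  simp at h1
  omega

/-- Jobs after `j` are short, because in a bad LPT schedule there is little room for them. -/
theorem mul_le_of_sum_le (h : BadLPT m j q s o r) {x : ℝ}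
    (hx : ∑ l ∈ range (j + 1), q l + x ≤ m) : (m - 1) * x ≤ m * r := by
  have h3 := h.three_le
  have h4 := h.hr
  have h5 := h.le_third
  have h1 : m * (1 + r - q j) ≤ ∑ l ∈ range j, q l := by
    rw [← sum_sum_jobsOn s]
    calc _ = ∑ _i : Fin m, (1 + r - q j) := by
          rw [sum_const, card_univ, Fintype.card_fin, nsmul_eq_mul]
      _ ≤ _ := sum_le_sum fun i _ => (h.lt_load i).le
  rw [sum_range_succ] at hx
  have h6 : x ≤ (m - 1) * (1 / 3) - m * r := by nlinarith
  -- `(m - 1)³ ≤ m² (m - 2)`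
  have h7 : ((m : ℝ) - 1) * (m - 1) ≤ 3 * (m * m * r) := by
    have : 0 ≤ (m - 1) * (3 * ((m : ℝ) * m * r) - (m - 1) * (m - 1)) := by
      have : (m - 1) * (3 * ((m : ℝ) * m * r)) = m * m * (m - 2) := by rw [← h4]; ring
      nlinarith
    by_contra! hc
    nlinarith
  nlinarith

/-! ### Two jobs per machine, for at least four machines -/

/-- A machine with two jobs before `j`: the second job is not among the first `m`. -/
theorem exists_pair (h : BadLPT m j q s o r) {i : Fin m} (hi : (jobsOn s j i).card = 2) :
    ∃ x y, x < y ∧ m ≤ y ∧ y < j ∧ s x = i ∧ s y = i ∧ jobsOn s j i = {x, y} ∧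
      1 + r - q j < q x + q y := by
  obtain ⟨x, y, hxy, hyj, hx, hy, he⟩ := exists_lt_of_card_eq_two hi
  refine ⟨x, y, hxy, ?_, hyj, hx, hy, he, ?_⟩
  · by_contra! hm
    exact h.inj hxy hm hyj.le (hx.trans hy.symm)
  · have := h.lt_load i
    rwa [he, sum_pair hxy.ne] at this

theorem opt_three_pair (h : BadLPT m j q s o r) {x y : ℕ} (hx : x ≤ j) (hy : y ≤ j) (hxy : x ≠ y)
    (ho : o x = o y) (hc : (jobsOn o (j + 1) (o x)).card = 3) : q x + q y + q j ≤ 1 := by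
  have hsub : ({x, y} : Finset ℕ) ⊆ jobsOn o (j + 1) (o x) := by
    intro l hl
    simp only [mem_insert, mem_singleton] at hl
    rcases hl with rfl | rfl <;> simp <;> grind
  have h1 : (jobsOn o (j + 1) (o x) \ {x, y}).card = 1 := by
    rw [card_sdiff_of_subset hsub, hc, card_pair hxy]
  obtain ⟨z, hz⟩ := card_eq_one.1 h1
  have hz' : z ∈ jobsOn o (j + 1) (o x) \ {x, y} := by simp [hz]
  simp only [mem_sdiff, mem_jobsOn, mem_insert, mem_singleton, not_or] at hz'
  have h2 := h.triple_le hx hy (z := z) (by omega) hxy (Ne.symm hz'.2.1) (Ne.symm hz'.2.2)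
    hz'.1.2.symm (ho.symm.trans hz'.1.2.symm)
  have := h.le_q (l := z) (by omega)
  linarith

theorem opt_three_single (h : BadLPT m j q s o r) {x : ℕ} (hx : x ≤ j)
    (hc : (jobsOn o (j + 1) (o x)).card = 3) : q x + 2 * q j ≤ 1 := by
  have h1 : ((jobsOn o (j + 1) (o x)).erase x).card = 2 := by
    rw [card_erase_of_mem (by simp; omega), hc]
  obtain ⟨y, hy⟩ := card_pos.1 (by rw [h1]; norm_num)
  simp only [mem_erase, mem_jobsOn] at hy
  have h2 := h.opt_three_pair hx (y := y) (by omega) (Ne.symm hy.1) hy.2.2.symm hc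
  have := h.le_q (l := y) (by omega)
  linarith

theorem one_lt_three_mul_add (h : BadLPT m j q s o r) (hm : 4 ≤ m) : 1 < 3 * q j + r := by
  have h1 := h.mul_r_lt
  have h2 := h.hr
  have h3 : (4 : ℝ) ≤ m := by exact_mod_cast hm
  have h4 : 3 * ((m : ℝ) - 1) * (m * r) < 3 * (m - 1) * ((m - 1) * q j) :=
    mul_lt_mul_of_pos_left h1 (by linarith)
  have h5 : (m : ℝ) * (3 * (m - 1) * r) = m * (m - 2) := by rw [h2]
  by_contra! hc
  have h6 : ((m : ℝ) - 1) * (m - 1) * (3 * q j + r) ≤ (m - 1) * (m - 1) * 1 :=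
    mul_le_mul_of_nonneg_left hc (by nlinarith)
  nlinarith

/-- For `m ≥ 5` a machine with three jobs makes the total processing time too large. -/
theorem card_eq_two_of_five_le (h : BadLPT m j q s o r) (hm : 5 ≤ m) (i : Fin m) :
    (jobsOn s j i).card = 2 := by
  refine le_antisymm ?_ (h.two_le_card i)
  by_contra! hc
  have h1 : (jobsOn s j i).card • (q j) ≤ ∑ x ∈ jobsOn s j i, q x :=
    card_nsmul_le_sum _ _ _ fun x hx => h.le_q (by rw [mem_jobsOn] at hx; omega)
  have h4 : (3 : ℝ) ≤ (jobsOn s j i).card := by exact_mod_cast hc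
  rw [nsmul_eq_mul] at h1
  have h2 := h.total_gt i (3 * q j) (by have := h.q_pos; nlinarith)
  have h3 : (5 : ℝ) ≤ m := by exact_mod_cast hm
  have h5 := h.le_third
  have h6 := h.hr
  nlinarith

theorem card_eq_two_of_eq_four (h : BadLPT m j q s o r) (hm : m = 4) (i : Fin m) :
    (jobsOn s j i).card = 2 := by
  classical
  by_contra hi
  have hp := h.one_lt_three_mul_add hm.ge
  have hpm := h.mul_r_lt
  have hr := h.hr
  have hm4 : (m : ℝ) = 4 := by exact_mod_cast hm
  rw [hm4] at hpm hr
  -- the machines with two jobs before `j`, and those with at most two jobs in the schedule `o`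
  set H : Finset (Fin m) := {i | (jobsOn s j i).card = 2} with hH
  set G : Finset (Fin m) := {i | (jobsOn o (j + 1) i).card ≠ 3} with hG
  have hH3 : H.card ≤ 3 := by
    have : H ⊆ univ.erase i := fun x hx => by
      simp only [hH, mem_filter, mem_univ, true_and] at hx
      exact mem_erase.2 ⟨fun he => hi (he ▸ hx), mem_univ _⟩
    have := card_le_card this
    rw [card_erase_of_mem (mem_univ _), card_univ, Fintype.card_fin] at this
    omega
  have hlow : 3 * m ≤ j + H.card := by
    have : ∑ x : Fin m, 3 ≤ ∑ x, ((jobsOn s j x).card + if x ∈ H then 1 else 0) := by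
      refine sum_le_sum fun x _ => ?_
      have := h.two_le_card x
      by_cases hx : x ∈ H
      · simp [hx]; omega
      · simp only [hH, mem_filter, mem_univ, true_and] at hx
        omega
    rw [sum_add_distrib, sum_card_jobsOn, sum_boole] at this
    simpa [mul_comm] using this
  have hup : j + 1 + G.card ≤ 3 * m := by
    have : ∑ x, ((jobsOn o (j + 1) x).card + if x ∈ G then 1 else 0) ≤ ∑ x : Fin m, 3 := by
      refine sum_le_sum fun x _ => ?_
      have := h.card_opt_le x
      by_cases hx : x ∈ G
      · simp only [hx, if_true]
        simp only [hG, mem_filter, mem_univ, true_and] at hx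
        omega
      · simp [hx]; omega
    rw [sum_add_distrib, sum_card_jobsOn, sum_boole] at this
    simpa [mul_comm] using this
  -- the jobs on the machines in `G`
  set N : Finset ℕ := {l ∈ range (j + 1) | o l ∈ G} with hN
  have hNcard : N.card ≤ 2 * G.card := by
    rw [card_eq_sum_card_fiberwise (t := G) (f := o) (by intro x hx; simp [hN] at hx; exact hx.2)]
    calc _ ≤ ∑ _b ∈ G, 2 := by
          refine sum_le_sum fun b hb => ?_
          have h1 : (N.filter (o · = b)).card ≤ (jobsOn o (j + 1) b).card := by
            refine card_le_card fun x hx => ?_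
            simp only [hN, mem_filter, mem_range] at hx
            exact mem_jobsOn.2 ⟨hx.1.1, hx.2⟩
          have h2 := h.card_opt_le b
          simp only [hG, mem_filter, mem_univ, true_and] at hb
          omega
      _ = _ := by simp [mul_comm]
  have hmemN : ∀ l ≤ j, l ∉ N → q l + 2 * q j ≤ 1 := by
    intro l hl hlN
    refine h.opt_three_single hl ?_
    simp only [hN, hG, mem_filter, mem_range, mem_univ, true_and, not_and, not_not] at hlN
    exact hlN (by omega)
  have key : ∀ b ∈ H, ∃ x, x ≤ j ∧ s x = b ∧ o x ∈ G ∧ r + q j < q x := by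
    intro b hb
    simp only [hH, mem_filter, mem_univ, true_and] at hb
    obtain ⟨x, y, hxy, hmy, hyj, hx, hy, -, hsum⟩ := h.exists_pair hb
    have hyx : q y ≤ q x := h.anti x y hxy.le hyj.le
    have hxN : x ∈ N := by
      by_contra hxN
      have := hmemN x (by omega) hxN
      linarith
    have hy2 : q y + 2 * q j ≤ 1 := by
      by_contra! hy2
      have hsub : insert y (range m) ⊆ N := by
        intro l hl
        rw [mem_insert, mem_range] at hl
        by_contra hlN
        have h1 := hmemN l (by omega) hlN
        have h2 := h.anti l y (by omega) hyj.le
        linarith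
      have := card_le_card hsub
      rw [card_insert_of_notMem (by simp [hmy]), card_range] at this
      omega
    refine ⟨x, by omega, hx, ?_, by linarith⟩
    simp only [hN, mem_filter] at hxN
    exact hxN.2
  choose! f hf using key
  obtain ⟨a, ha, b, hb, hab, he⟩ := exists_ne_map_eq_of_card_lt_of_maps_to (s := H) (t := G)
    (f := fun i => o (f i)) (by omega) (fun i hi => (hf i hi).2.2.1)
  have h1 := h.pair_le (hf a ha).1 (hf b hb).1
    (fun he' => hab (by rw [← (hf a ha).2.1, ← (hf b hb).2.1, he'])) he
  have h2 := (hf a ha).2.2.2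
  have h3 := (hf b hb).2.2.2
  linarith

theorem card_eq_two (h : BadLPT m j q s o r) (hm : 4 ≤ m) (i : Fin m) :
    (jobsOn s j i).card = 2 := by
  rcases eq_or_lt_of_le hm with h4 | h5
  · exact h.card_eq_two_of_eq_four h4.symm i
  · exact h.card_eq_two_of_five_le h5 i

theorem eq_two_mul (_h : BadLPT m j q s o r) (hc : ∀ i, (jobsOn s j i).card = 2) :
    j = 2 * m := by
  have := sum_card_jobsOn s j
  simp only [hc] at this
  simp at this
  omega

end BadLPT

/-! ### The critical job loaded first -/

/-- The jobs on machine `i` at the moment when list scheduling assigns job `l`, if only the jobs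
`0, …, j` are looked at and those in `S` have been loaded first. -/
def earlier {m : ℕ} (S : Finset ℕ) (t : ℕ → Fin m) (j l : ℕ) (i : Fin m) : Finset ℕ :=
  {x ∈ range (j + 1) | (x ∈ S ∨ x < l) ∧ t x = i}

@[simp]
theorem mem_earlier {m : ℕ} {S : Finset ℕ} {t : ℕ → Fin m} {j l x : ℕ} {i : Fin m} :
    x ∈ earlier S t j l i ↔ x ≤ j ∧ (x ∈ S ∨ x < l) ∧ t x = i := by
  simp [earlier]

theorem sum_card_earlier {m : ℕ} (t : ℕ → Fin m) {j l : ℕ} (hl : l ≤ j) :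
    ∑ i, (earlier {j} t j l i).card = l + 1 := by
  have := Finset.card_eq_sum_card_fiberwise (s := insert j (range l)) (t := univ) (f := t)
    (fun _ _ => by simp)
  rw [card_insert_of_notMem (by simp [hl]), card_range] at this
  rw [this]
  refine sum_congr rfl fun i _ => congrArg card ?_
  ext x
  simp only [mem_earlier, mem_filter, mem_insert, mem_singleton, mem_range]
  constructor
  · rintro ⟨-, h1, h2⟩
    exact ⟨h1, h2⟩
  · rintro ⟨h1, h2⟩
    exact ⟨by omega, h1, h2⟩

/-- A schedule `t` obtained by `LPT(S)` in which a job before `j` completes after `1 + r`. -/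
structure BadPreloaded {m : ℕ} (j : ℕ) (q : ℕ → ℝ) (S : Finset ℕ) (t : ℕ → Fin m) (r : ℝ) :
    Prop where
  greedy : ∀ l ≤ j, l ∉ S → ∀ i,
    ∑ x ∈ earlier S t j l (t l), q x ≤ ∑ x ∈ earlier S t j l i, q x
  bad : ∃ l < j, l ∉ S ∧ 1 + r < ∑ x ∈ earlier S t j l (t l), q x + q l

namespace BadLPT

variable {m j : ℕ} {q : ℕ → ℝ} {s o t : ℕ → Fin m} {r : ℝ}

/-- If `LPT({j})` is bad as well, the late job `l` either meets a machine with a single job `x`,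
where `x` is not too small because there are many such machines, or it is the last job and meets
two jobs on every machine, in particular on the one that holds `j`. -/
theorem late_job (h : BadLPT m j q s o r) (hj : j = 2 * m)
    (ht : BadPreloaded j q {j} t r) :
    (∃ x l, x < l ∧ l < j ∧ m ≤ l ∧ j ≤ l + 2 + x ∧ 1 + r < q x + q l) ∨
      ∃ x, m - 1 ≤ x ∧ x < j - 1 ∧ 1 + r < q j + q x + q (j - 1) := by
  obtain ⟨l, hlj, hlS, hbad⟩ := ht.bad
  have hm := h.hm
  have hr := h.r_pos
  have hload : ∀ i, 1 + r < ∑ x ∈ earlier {j} t j l i, q x + q l := fun i => by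
    have := ht.greedy l hlj.le hlS i
    linarith
  have hle := h.le_one_sub hlj
  have hp := h.q_pos
  have hone : ∀ i, 1 ≤ (earlier {j} t j l i).card := by
    intro i
    by_contra! hc
    have h1 := hload i
    rw [card_eq_zero.1 (Nat.lt_one_iff.1 hc), sum_empty] at h1
    linarith
  have hsum := sum_card_earlier t hlj.le
  have hjmem : j ∈ earlier {j} t j l (t j) := by simp
  have hjcard : (earlier {j} t j l (t j)).card ≠ 1 := by
    intro hc
    obtain ⟨x, hx⟩ := card_eq_one.1 hc
    have h1 := hload (t j)
    have : j = x := by simpa [hx] using hjmem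
    rw [hx, sum_singleton, ← this] at h1
    linarith
  have hlm : m ≤ l := by
    by_contra! hlm
    have h1 : ∑ _i : Fin m, 1 < ∑ i, (earlier {j} t j l i).card :=
      sum_lt_sum (fun i _ => hone i) ⟨t j, mem_univ _, by have := hone (t j); omega⟩
    rw [hsum] at h1
    simp at h1
    omega
  set E : Finset (Fin m) := {i | (earlier {j} t j l i).card = 1} with hE
  have hsingle : ∀ i ∈ E, ∃ x, x < l ∧ t x = i ∧ 1 + r < q x + q l := by
    intro i hi
    simp only [hE, mem_filter, mem_univ, true_and] at hi
    obtain ⟨x, hx⟩ := card_eq_one.1 hi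
    have hxm : x ∈ earlier {j} t j l i := by simp [hx]
    have h1 := hload i
    rw [hx, sum_singleton] at h1
    rw [mem_earlier, mem_singleton] at hxm
    refine ⟨x, ?_, hxm.2.2, h1⟩
    rcases hxm.2.1 with rfl | h2
    · exact absurd (hxm.2.2 ▸ hi) hjcard
    · exact h2
  have hEcard : j ≤ l + 1 + E.card := by
    have : ∑ _x : Fin m, 2 ≤ ∑ x, ((earlier {j} t j l x).card + if x ∈ E then 1 else 0) := by
      refine sum_le_sum fun x _ => ?_
      have := hone x
      by_cases hx : x ∈ E
      · simp only [hx, if_true]; omega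
      · simp only [hE, mem_filter, mem_univ, true_and] at hx
        omega
    rw [sum_add_distrib, hsum, sum_boole] at this
    simp at this
    omega
  rcases E.eq_empty_or_nonempty with hE0 | hE0
  · right
    rw [hE0, card_empty] at hEcard
    have hl1 : l = j - 1 := by omega
    have htwo : (earlier {j} t j l (t j)).card = 2 := by
      by_contra hne
      have h1 : ∑ _i : Fin m, 2 < ∑ i, (earlier {j} t j l i).card := by
        refine sum_lt_sum (fun i _ => ?_) ⟨t j, mem_univ _, ?_⟩
        · have := hone i
          have : i ∉ E := by simp [hE0]
          simp only [hE, mem_filter, mem_univ, true_and] at this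
          omega
        · have := hone (t j)
          omega
      rw [hsum] at h1
      simp at h1
      omega
    have h1 : ((earlier {j} t j l (t j)).erase j).card = 1 := by
      rw [card_erase_of_mem hjmem, htwo]
    obtain ⟨x, hx⟩ := card_eq_one.1 h1
    have hxm : x ∈ (earlier {j} t j l (t j)).erase j := by simp [hx]
    have h2 := hload (t j)
    rw [← insert_erase hjmem, sum_insert (notMem_erase _ _), hx, sum_singleton] at h2
    simp only [mem_erase, mem_earlier, mem_singleton] at hxm
    have hxl : x < l := hxm.2.2.1.resolve_left hxm.1
    refine ⟨x, ?_, by omega, hl1 ▸ h2⟩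
    -- otherwise `x` would have been put on an empty machine instead of joining `j`
    by_contra! hxm1
    have hempty : ∃ i, earlier {j} t j x i = ∅ := by
      by_contra! hne
      have h3 : ∑ _i : Fin m, 1 ≤ ∑ i, (earlier {j} t j x i).card :=
        sum_le_sum fun i _ => card_pos.2 (hne i)
      rw [sum_card_earlier t hxm.2.1] at h3
      simp at h3
      omega
    obtain ⟨i, hi⟩ := hempty
    have h3 := ht.greedy x hxm.2.1 (by simpa using hxm.1) i
    rw [hi, sum_empty] at h3
    have h4 : q j ≤ ∑ y ∈ earlier {j} t j x (t x), q y :=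
      single_le_sum (f := q) (fun y hy => h.q_nonneg (by rw [mem_earlier] at hy; omega))
        (by simp [hxm.2.2.2])
    linarith
  · left
    suffices ∃ x, x < l ∧ j ≤ l + 2 + x ∧ 1 + r < q x + q l by
      obtain ⟨x, h1, h2, h3⟩ := this
      exact ⟨x, l, h1, hlj, hlm, h2, h3⟩
    by_contra! hcon
    choose! f hf using hsingle
    have hmaps : E.card ≤ (range (j - (l + 2))).card := by
      refine card_le_card_of_injOn f (fun i hi => ?_) fun a ha b hb hab => ?_
      · have h1 := hf i hi
        have h2 := hcon (f i) h1.1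
        simp only [coe_range, Set.mem_Iio]
        by_contra! h3
        exact absurd h1.2.2 (not_lt.2 (h2 (by omega)))
      · rw [← (hf a ha).2.1, ← (hf b hb).2.1, hab]
    rw [card_range] at hmaps
    obtain ⟨i, hi⟩ := hE0
    have h1 := hf i hi
    have h2 := hcon (f i) h1.1
    by_cases h3 : j ≤ l + 2
    · exact absurd h1.2.2 (not_lt.2 (h2 (by omega)))
    · omega

theorem exists_opt_three (h : BadLPT m j q s o r) (hj : j = 2 * m) :
    ∃ i, (jobsOn o (j + 1) i).card = 3 := by
  by_contra! hne
  have h1 : ∑ i, (jobsOn o (j + 1) i).card ≤ ∑ _i : Fin m, 2 :=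
    sum_le_sum fun i _ => by have := h.card_opt_le i; have := hne i; omega
  rw [sum_card_jobsOn] at h1
  simp at h1
  omega

/-- For `m ≥ 4` the two schedules cannot both be bad. -/
theorem not_badPreloaded_of_four_le (h : BadLPT m j q s o r) (hm : 4 ≤ m) :
    ¬ BadPreloaded j q {j} t r := by
  classical
  intro ht
  have hcard := h.card_eq_two hm
  have hj := h.eq_two_mul hcard
  have hF := h.one_lt_three_mul_add hm
  have hp := h.q_pos
  have hr := h.r_pos
  -- the first `m` jobs are not on machines with three jobs in `o`
  have hbig : ∀ x < m, (jobsOn o (j + 1) (o x)).card ≠ 3 := by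
    intro x hx h3
    obtain ⟨a, b, hab, hmb, hbj, ha, hb, he, hsum⟩ := h.exists_pair (hcard (s x))
    have hxa : x = a := by
      have : x ∈ jobsOn s j (s x) := by simp; omega
      rw [he] at this
      simp at this
      omega
    subst hxa
    have h1 := h.anti x b hab.le hbj.le
    have h2 := h.opt_three_single (by omega) h3
    linarith
  obtain ⟨w, hw⟩ := h.exists_opt_three hj
  obtain ⟨u, v, z, huv, hvz, hzj, hu, hv, hz, -⟩ := exists_lt_of_card_eq_three hw
  have hum : m ≤ u := by
    by_contra! hum
    exact hbig u hum (hu ▸ hw)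
  have hu1 := h.opt_three_single (x := u) (by omega) (hu ▸ hw)
  have hlast : 2 * q (j - 1) + q j ≤ 1 := by
    have h1 := h.opt_three_pair (x := u) (y := v) (by omega) (by omega) huv.ne
      (hu.trans hv.symm) (hu ▸ hw)
    have h2 := h.anti u (j - 1) (by omega) (by omega)
    have h3 := h.anti v (j - 1) (by omega) (by omega)
    linarith
  set G : Finset (Fin m) := {i | (jobsOn o (j + 1) i).card ≠ 3} with hG
  have hGm : G.card ≤ m - 1 := by
    have : G ⊆ univ.erase w := fun x hx => by
      simp only [hG, mem_filter, mem_univ, true_and] at hx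
      exact mem_erase.2 ⟨fun he => hx (he ▸ hw), mem_univ _⟩
    have := card_le_card this
    rwa [card_erase_of_mem (mem_univ _), card_univ, Fintype.card_fin] at this
  rcases h.late_job hj ht with ⟨x, l, hxl, hlj, hml, hjl, hsum⟩ | ⟨x, hmx, hxj, hsum⟩
  · have hx1 := h.le_one_sub (hxl.trans hlj)
    have hlbig : 1 < q l + 2 * q j := by
      by_contra! hc
      linarith
    -- each of the jobs `0, …, x` has a machine of `G` for itself, among the jobs `0, …, l`
    have hlG : ∀ y ≤ l, o y ∈ G := by
      intro y hy
      simp only [hG, mem_filter, mem_univ, true_and]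
      intro h3
      have h1 := h.opt_three_single (x := y) (by omega) h3
      have h2 := h.anti y l hy hlj.le
      linarith
    have hne : ∀ y ≤ x, ∀ z ≤ l, z ≠ y → o z ≠ o y := by
      intro y hy z hz hzy he
      have h1 := h.pair_le (by omega) (by omega) hzy he
      have h2 := h.anti y x hy (by omega)
      have h3 := h.anti z l hz (by omega)
      linarith
    have hA : ((range (x + 1)).image o).card = x + 1 := by
      rw [card_image_of_injOn, card_range]
      intro a ha b hb hab
      simp only [coe_range, Set.mem_Iio] at ha hb
      by_contra hab'
      exact hne b (by omega) a (by omega) hab' hab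
    have hAG : (range (x + 1)).image o ⊆ G := by
      intro i hi
      obtain ⟨y, hy, rfl⟩ := mem_image.1 hi
      rw [mem_range] at hy
      exact hlG y (by omega)
    have hcount : (Ioc x l).card ≤ ∑ _i ∈ G \ (range (x + 1)).image o, 2 := by
      rw [card_eq_sum_card_fiberwise (t := G \ (range (x + 1)).image o) (f := o)]
      · refine sum_le_sum fun i hi => ?_
        have h1 : ((Ioc x l).filter (o · = i)).card ≤ (jobsOn o (j + 1) i).card := by
          refine card_le_card fun y hy => ?_
          simp only [mem_filter, mem_Ioc] at hy
          exact mem_jobsOn.2 ⟨by omega, hy.2⟩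
        have h2 := h.card_opt_le i
        simp only [hG, mem_sdiff, mem_filter, mem_univ, true_and] at hi
        omega
      · intro y hy
        simp only [coe_Ioc, Set.mem_Ioc] at hy
        simp only [coe_sdiff, coe_image, Set.mem_sdiff, mem_coe, Set.mem_image]
        refine ⟨hlG y hy.2, ?_⟩
        rintro ⟨z, hz, he⟩
        rw [mem_range] at hz
        exact hne z (by omega) y hy.2 (by omega) he.symm
    rw [Nat.card_Ioc, sum_const, card_sdiff_of_subset hAG, hA, smul_eq_mul] at hcount
    have hlj1 : l ≠ j - 1 := by
      rintro rfl
      linarith [h.le_q (l := j - 1) (by omega)]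
    omega
  · obtain ⟨a, ha, b, hb, hab, he⟩ := exists_ne_map_eq_of_card_lt_of_maps_to
      (s := range m) (t := G) (f := o) (by rw [card_range]; omega) (fun y hy => by
        simp only [coe_range, Set.mem_Iio] at hy
        simpa [hG] using hbig y hy)
    rw [mem_range] at ha hb
    have h1 := h.pair_le (by omega) (by omega) hab he
    have h2 := h.anti a x (by omega) (by omega)
    have h3 := h.anti b x (by omega) (by omega)
    have h4 := h.le_third
    have h5 := h.hr
    have h6 := h.three_le
    nlinarith

/-! ### Three machines -/

section three

variable {j : ℕ} {q : ℕ → ℝ} {s o t t' : ℕ → Fin 3} {r : ℝ}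

theorem r_eq (h : BadLPT 3 j q s o r) : r = 1 / 6 := by
  have := h.hr
  norm_num at this
  linarith

theorem sum_card_three (s : ℕ → Fin 3) (k : ℕ) {a b c : Fin 3} (hab : a ≠ b) (hac : a ≠ c)
    (hbc : b ≠ c) : (jobsOn s k a).card + (jobsOn s k b).card + (jobsOn s k c).card = k := by
  have h0 := sum_card_jobsOn s k
  have : (univ : Finset (Fin 3)) = {a, b, c} := by
    symm
    rw [← card_eq_iff_eq_univ, card_insert_of_notMem (by simp [hab, hac]), card_pair hbc]
    rfl
  rw [this, sum_insert (by simp [hab, hac]), sum_pair hbc] at h0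
  omega

theorem sum_three (s : ℕ → Fin 3) (k : ℕ) (w : ℕ → ℝ) {a b c : Fin 3} (hab : a ≠ b)
    (hac : a ≠ c) (hbc : b ≠ c) : ∑ x ∈ range k, w x =
      ∑ x ∈ jobsOn s k a, w x + ∑ x ∈ jobsOn s k b, w x + ∑ x ∈ jobsOn s k c, w x := by
  have h0 := sum_sum_jobsOn s k w
  have : (univ : Finset (Fin 3)) = {a, b, c} := by
    symm
    rw [← card_eq_iff_eq_univ, card_insert_of_notMem (by simp [hab, hac]), card_pair hbc]
    rfl
  rw [this, sum_insert (by simp [hab, hac]), sum_pair hbc] at h0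
  linarith

theorem exists_others (a : Fin 3) : ∃ b c : Fin 3, a ≠ b ∧ a ≠ c ∧ b ≠ c := by
  revert a
  decide

theorem exists_other (a b : Fin 3) : ∃ c : Fin 3, a ≠ c ∧ b ≠ c := by
  revert a b
  decide

/-- Two jobs longer than `1/6 + q j` do not share a machine with a third job. -/
theorem opt_ne_of_large (h : BadLPT 3 j q s o r) {x y : ℕ} (hx : x ≤ j) (hy : y ≤ j)
    (hxy : x ≠ y) (hc : (jobsOn o (j + 1) (o x)).card = 3) (h1 : 1 / 6 + q j < q x)
    (h2 : 1 / 6 + q j < q y) : o x ≠ o y := by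
  intro he
  have h3 := h.opt_three_pair hx hy hxy he hc
  have h4 := h.quarter_lt
  linarith

/-- If the first of two jobs on a machine shares its machine in `o` with two other jobs, then the
second one is longer than `1/6 + q j`. -/
theorem large_of_pair (h : BadLPT 3 j q s o r) {x y : ℕ} (hx : x ≤ j)
    (hc : (jobsOn o (j + 1) (o x)).card = 3) (hsum : 1 + r - q j < q x + q y) :
    1 / 6 + q j < q y := by
  have h1 := h.opt_three_single hx hc
  have h2 := h.r_eq
  linarith

theorem ne_eight (h : BadLPT 3 j q s o r) : j ≠ 8 := by
  rintro rfl
  have hall : ∀ i, (jobsOn o 9 i).card = 3 := by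
    by_contra! hne
    obtain ⟨i, hi⟩ := hne
    have h1 : ∑ i, (jobsOn o 9 i).card < ∑ _i : Fin 3, 3 :=
      sum_lt_sum (fun i _ => h.card_opt_le i)
        ⟨i, mem_univ _, lt_of_le_of_ne (h.card_opt_le i) hi⟩
    rw [sum_card_jobsOn] at h1
    simp at h1
  obtain ⟨i, hi⟩ : ∃ i, (jobsOn s 8 i).card = 2 := by
    by_contra! hne
    have h1 : ∑ _i : Fin 3, 3 ≤ ∑ i, (jobsOn s 8 i).card :=
      sum_le_sum fun i _ => by have := h.two_le_card i; have := hne i; omega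
    rw [sum_card_jobsOn] at h1
    simp at h1
  obtain ⟨x, y, hxy, hmy, hyj, -, -, -, hsum⟩ := h.exists_pair hi
  have hy := h.large_of_pair (by omega) (hall _) hsum
  have hbig : ∀ l ∈ insert y (range 3), l ≤ 8 ∧ 1 / 6 + q 8 < q l := by
    intro l hl
    rw [mem_insert, mem_range] at hl
    have : l ≤ y := by omega
    exact ⟨by omega, hy.trans_le (h.anti l y this hyj.le)⟩
  obtain ⟨a, ha, b, hb, hab, he⟩ := exists_ne_map_eq_of_card_lt_of_maps_to
    (s := insert y (range 3)) (t := univ) (f := o)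
    (by rw [card_insert_of_notMem (by simp [hmy])]; simp) (fun _ _ => by simp)
  exact h.opt_ne_of_large (hbig a ha).1 (hbig b hb).1 hab (hall _) (hbig a ha).2 (hbig b hb).2 he

/-- With eight jobs, a set of long jobs has at most two elements outside the machine of `o` that
holds only two jobs. -/
theorem card_sdiff_le_two (h : BadLPT 3 j q s o r) {i₀ : Fin 3}
    (h3 : ∀ i, i ≠ i₀ → (jobsOn o (j + 1) i).card = 3) (A : Finset ℕ)
    (hA : ∀ x ∈ A, x ≤ j ∧ 1 / 6 + q j < q x) : (A \ jobsOn o (j + 1) i₀).card ≤ 2 := by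
  have hmem : ∀ x ∈ A \ jobsOn o (j + 1) i₀, x ∈ A ∧ o x ≠ i₀ := by
    intro x hx
    simp only [mem_sdiff, mem_jobsOn, not_and] at hx
    have := (hA x hx.1).1
    exact ⟨hx.1, hx.2 (by omega)⟩
  have h1 : (A \ jobsOn o (j + 1) i₀).card ≤ (univ.erase i₀).card := by
    refine card_le_card_of_injOn o (fun x hx => ?_) fun x hx y hy he => ?_
    · simpa using (hmem x hx).2
    · by_contra hxy
      have hx' := hmem x hx
      have hy' := hmem y hy
      exact h.opt_ne_of_large (hA x hx'.1).1 (hA y hy'.1).1 hxy (h3 _ hx'.2) (hA x hx'.1).2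
        (hA y hy'.1).2 he
  rwa [card_erase_of_mem (mem_univ _), card_univ, Fintype.card_fin] at h1

/-- Eight jobs on three machines, `{a, a'}`, `{b, b'}` and `{c, d, e}` before job `7` in `s`, and
only two jobs on machine `i₀` in `o`: then `a` is one of these two jobs. -/
theorem mem_of_eq_seven (h : BadLPT 3 7 q s o r) {i₀ : Fin 3}
    (h2 : (jobsOn o 8 i₀).card = 2) (h3 : ∀ i, i ≠ i₀ → (jobsOn o 8 i).card = 3)
    {a a' b b' c d e : ℕ} (ha : a < 3) (hb : b < 3) (hc : c < 3) (hab : a ≠ b) (hac : a ≠ c)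
    (hbc : b ≠ c) (ha' : 3 ≤ a') (hb' : 3 ≤ b') (hd : 3 ≤ d) (he : 3 ≤ e) (ha7 : a' < 7)
    (hb7 : b' < 7) (hd7 : d < 7) (he7 : e < 7) (hab' : a' ≠ b') (had : a' ≠ d)
    (hA : 1 + r - q 7 < q a + q a') (hB : 1 + r - q 7 < q b + q b')
    (htot : q a + q a' + (q b + q b') + (q c + q d + q e) + q 7
      ≤ 2 + ∑ x ∈ jobsOn o 8 i₀, q x)
    (hgr : a' < d → q a ≤ q c) : a ∈ jobsOn o 8 i₀ := by
  by_contra haP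
  set P := jobsOn o 8 i₀ with hP
  have hr := h.r_eq
  have hp := h.quarter_lt
  have hPsum : ∑ x ∈ P, q x ≤ 1 := h.opt i₀
  have hthree : ∀ x ≤ 7, x ∉ P → (jobsOn o 8 (o x)).card = 3 := by
    intro x hx hxP
    refine h3 _ fun hxi => hxP ?_
    rw [hP, mem_jobsOn]
    exact ⟨by omega, hxi⟩
  have hlong := h.large_of_pair (by omega) (hthree a (by omega) haP) hA
  have hL : ∀ x ≤ a', x ≤ 7 ∧ 1 / 6 + q 7 < q x := fun x hx =>
    ⟨by omega, hlong.trans_le (h.anti x a' hx (by omega))⟩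
  have hfive : ∀ z, 3 ≤ z → z ≤ 7 → z ≠ a' → ¬ 1 / 6 + q 7 < q z := by
    intro z hz hz7 hza hzl
    have h1 := h.card_sdiff_le_two h3 (insert z (insert a' (range 3))) (by
      intro x hx
      simp only [mem_insert, mem_range] at hx
      rcases hx with rfl | hx
      · exact ⟨hz7, hzl⟩
      · exact hL x (by omega))
    replace h1 : (insert z (insert a' (range 3)) \ P).card ≤ 2 := h1
    have h4 := le_card_sdiff P (insert z (insert a' (range 3)))
    rw [h2, card_insert_of_notMem (by simp [hza, hz]), card_insert_of_notMem (by simp [ha']),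
      card_range] at h4
    omega
  have hPsub : P ⊆ insert a' (range 3) := by
    have h1 := h.card_sdiff_le_two h3 (insert a' (range 3)) (by
      intro x hx
      simp only [mem_insert, mem_range] at hx
      exact hL x (by omega))
    replace h1 : (insert a' (range 3) \ P).card ≤ 2 := h1
    have h4 := card_sdiff_add_card_inter (insert a' (range 3)) P
    rw [card_insert_of_notMem (by simp [ha']), card_range] at h4
    have h5 : (insert a' (range 3) ∩ P).card = P.card :=
      le_antisymm (card_le_card inter_subset_right) (by rw [h2]; omega)
    have h6 := eq_of_subset_of_card_le inter_subset_right h5.ge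
    rw [← h6]
    exact inter_subset_left
  have hbP : b ∈ P := by
    by_contra hbP
    exact hfive b' hb' (by omega) hab'.symm
      (h.large_of_pair (by omega) (hthree b (by omega) hbP) hB)
  obtain ⟨z, hz⟩ : ∃ z, P.erase b = {z} :=
    card_eq_one.1 (by rw [card_erase_of_mem hbP, h2])
  have hzP : z ∈ P.erase b := by simp [hz]
  have hsumP : ∑ x ∈ P, q x = q b + q z := by
    rw [← insert_erase hbP, sum_insert (notMem_erase _ _), hz, sum_singleton]
  rw [mem_erase] at hzP
  have hz' := hPsub hzP.2
  rw [mem_insert, mem_range] at hz'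
  have hza : z ≠ a := fun he => haP (he ▸ hzP.2)
  have hqd := h.le_q (l := d) (by omega)
  have hqe := h.le_q (l := e) (by omega)
  have hqb' := h.le_q (l := b') (by omega)
  have hq1 := h.anti c a' (by omega) (by omega)
  have hq2 := h.anti a a' (by omega) (by omega)
  have hq3 := h.opt_three_single (by omega) (hthree a (by omega) haP)
  rcases hz' with rfl | hz'
  · linarith
  · have hzc : z = c := by have := hzP.1; omega
    subst hzc
    have hq4 := hgr (by
      by_contra hda
      exact hfive d hd (by omega) had.symm (hL d (by omega)).2)
    linarith

theorem ne_seven (h : BadLPT 3 j q s o r) : j ≠ 7 := by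
  rintro rfl
  have hr := h.r_eq
  -- the shape of the schedule `o`
  obtain ⟨i₀, hi₀⟩ : ∃ i, (jobsOn o 8 i).card ≠ 3 := by
    by_contra! hne
    have h1 := sum_card_jobsOn o 8
    simp [hne] at h1
  obtain ⟨i₁, i₂, h01, h02, h12⟩ := exists_others i₀
  have hsumo := sum_card_three o 8 h01 h02 h12
  have hc0 := h.card_opt_le i₀
  have hc1 := h.card_opt_le i₁
  have hc2 := h.card_opt_le i₂
  norm_num at hc0 hc1 hc2
  have h2 : (jobsOn o 8 i₀).card = 2 := by omega
  have h3 : ∀ i, i ≠ i₀ → (jobsOn o 8 i).card = 3 := by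
    intro i hi
    by_contra hne
    obtain ⟨k, h5, h6⟩ := exists_other i₀ i
    have h7 := sum_card_three o 8 (Ne.symm hi) h5 h6
    have h8 : _ ≤ 3 := h.card_opt_le i
    have h9 : _ ≤ 3 := h.card_opt_le k
    norm_num at h8 h9
    omega
  -- the shape of the schedule `s`
  obtain ⟨C, hC⟩ : ∃ i, (jobsOn s 7 i).card ≠ 2 := by
    by_contra! hne
    have h1 := sum_card_jobsOn s 7
    simp [hne] at h1
  obtain ⟨A, B, hCA, hCB, hAB⟩ := exists_others C
  have hsums := sum_card_three s 7 hCA hCB hAB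
  have hcA := h.two_le_card A
  have hcB := h.two_le_card B
  have hcC := h.two_le_card C
  obtain ⟨a, a', haa, ha', ha7, has, has', hAe, hA⟩ :=
    h.exists_pair (i := A) (by omega)
  obtain ⟨b, b', hbb, hb', hb7, hbs, hbs', hBe, hB⟩ :=
    h.exists_pair (i := B) (by omega)
  obtain ⟨c, d, e, hcd, hde, he7, hcs, hds, hes, hCe⟩ :=
    exists_lt_of_card_eq_three (s := s) (k := 7) (i := C) (by omega)
  have hd3 : 3 ≤ d := by
    by_contra! hd
    exact h.inj hcd hd (by omega) (hcs.trans hds.symm)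
  have hfirst : ∀ x < 3, x = a ∨ x = b ∨ x = c := by
    intro x hx
    have hx' : x ∈ jobsOn s 7 (s x) := by simp; omega
    have : s x = A ∨ s x = B ∨ s x = C := by
      revert hCA hCB hAB; generalize s x = k; clear * -; revert A B C k; decide
    rcases this with h1 | h1 | h1 <;> rw [h1] at hx'
    · rw [hAe] at hx'; simp at hx'; omega
    · rw [hBe] at hx'; simp at hx'; omega
    · rw [hCe] at hx'; simp at hx'; omega
  have hf0 := hfirst 0 (by omega)
  have hf1 := hfirst 1 (by omega)
  have hf2 := hfirst 2 (by omega)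
  have hab' : a' ≠ b' := fun he => hAB (by rw [← has', ← hbs', he])
  have had : a' ≠ d := fun he => hCA (by rw [← has', ← hds, he])
  have hbd : b' ≠ d := fun he => hCB (by rw [← hbs', ← hds, he])
  have htot : q a + q a' + (q b + q b') + (q c + q d + q e) + q 7
      ≤ 2 + ∑ x ∈ jobsOn o 8 i₀, q x := by
    have h1 := sum_three o 8 q h01 h02 h12
    have h4 := sum_three s 7 q hCA hCB hAB
    rw [hAe, hBe, hCe, sum_pair haa.ne, sum_pair hbb.ne,
      sum_insert (by simp; omega), sum_pair hde.ne] at h4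
    rw [sum_range_succ] at h1
    have h5 : _ ≤ (1 : ℝ) := h.opt i₁
    have h6 : _ ≤ (1 : ℝ) := h.opt i₂
    norm_num at h5 h6
    linarith
  have hgr : ∀ x x' : ℕ, x < x' → x' < 7 → s x = s x' → x' < d → q x ≤ q c := by
    intro x x' hx hx' hs hxd
    have h1 := h.greedy x' hx'.le C
    have h4 : q x ≤ ∑ y ∈ jobsOn s x' (s x'), q y :=
      single_le_sum (f := q) (fun y hy => h.q_nonneg (by rw [mem_jobsOn] at hy; omega))
        (mem_jobsOn.2 ⟨hx, hs⟩)
    have h5 : ∑ y ∈ jobsOn s x' C, q y ≤ ∑ y ∈ {c}, q y := by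
      refine sum_le_sum_of_subset_of_nonneg (fun y hy => ?_) fun y hy _ => ?_
      · have hy' := jobsOn_mono hx'.le hy
        rw [hCe] at hy'
        rw [mem_jobsOn] at hy
        simp at hy' ⊢
        omega
      · rw [mem_singleton] at hy
        exact h.q_nonneg (by omega)
    rw [sum_singleton] at h5
    linarith
  have haP := h.mem_of_eq_seven h2 h3 (a := a) (a' := a') (b := b) (b' := b') (c := c) (d := d)
    (e := e) (by omega) (by omega) (by omega) (by omega) (by omega) (by omega) ha' hb' hd3
    (by omega) ha7 hb7 (by omega) he7 hab' had hA hB htot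
    (hgr a a' haa ha7 (has.trans has'.symm))
  have hbP := h.mem_of_eq_seven h2 h3 (a := b) (a' := b') (b := a) (b' := a') (c := c) (d := d)
    (e := e) (by omega) (by omega) (by omega) (by omega) (by omega) (by omega) hb' ha' hd3
    (by omega) hb7 ha7 (by omega) he7 hab'.symm hbd hB hA (by linarith)
    (hgr b b' hbb hb7 (hbs.trans hbs'.symm))
  have hane : a ≠ b := by omega
  have hPsum : ∑ x ∈ jobsOn o 8 i₀, q x = q a + q b := by
    have h1 : ({a, b} : Finset ℕ) = jobsOn o 8 i₀ :=
      eq_of_subset_of_card_le (by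
        intro x hx
        simp only [mem_insert, mem_singleton] at hx
        rcases hx with rfl | rfl <;> assumption) (by rw [h2, card_pair hane])
    rw [← h1, sum_pair hane]
  have hP1 : _ ≤ (1 : ℝ) := h.opt i₀
  norm_num at hP1
  have hqd := h.le_q (l := d) (by omega)
  have hqe := h.le_q (l := e) (by omega)
  have hq1 := h.anti c a' (by omega) (by omega)
  have hq2 := h.anti c b' (by omega) (by omega)
  linarith

theorem eq_six (h : BadLPT 3 j q s o r) : j = 6 := by
  have h1 := h.two_mul_le
  have h2 : ∑ i, (jobsOn o (j + 1) i).card ≤ ∑ _i : Fin 3, 3 :=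
    sum_le_sum fun i _ => h.card_opt_le i
  rw [sum_card_jobsOn] at h2
  simp at h2
  have h3 := h.ne_seven
  have h4 := h.ne_eight
  omega

theorem card_eq_two_of_six (h : BadLPT 3 6 q s o r) (i : Fin 3) : (jobsOn s 6 i).card = 2 := by
  obtain ⟨k, l, h1, h2, h3⟩ := exists_others i
  have h4 := sum_card_three s 6 h1 h2 h3
  have h5 := h.two_le_card i
  have h6 := h.two_le_card k
  have h7 := h.two_le_card l
  omega

/-- In the schedule `o` exactly one machine has three jobs, and the others have two. -/
theorem exists_opt_shape (h : BadLPT 3 6 q s o r) :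
    ∃ w, (jobsOn o 7 w).card = 3 ∧ ∀ i, i ≠ w → (jobsOn o 7 i).card = 2 := by
  obtain ⟨w, hw⟩ := h.exists_opt_three rfl
  norm_num at hw
  refine ⟨w, hw, fun i hi => ?_⟩
  obtain ⟨k, hwk, hik⟩ := exists_other w i
  have hsum := sum_card_three o 7 (Ne.symm hi) hwk hik
  have h1 : _ ≤ 3 := h.card_opt_le i
  have h2 : _ ≤ 3 := h.card_opt_le k
  norm_num at h1 h2
  -- two machines with three jobs and one with a single job are impossible
  have key : ∀ a b, w ≠ a → w ≠ b → a ≠ b → (jobsOn o 7 a).card = 3 →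
      (jobsOn o 7 b).card = 1 → False := by
    intro a b hwa hwb hab ha hb
    have h3 : ∀ i, i ≠ b → (jobsOn o 7 i).card = 3 := by
      intro i hib
      have : i = w ∨ i = a := by
        clear * - hwa hwb hab hib; revert w a b i; decide
      rcases this with rfl | rfl <;> assumption
    obtain ⟨x, y, hxy, hy, hy6, hx, -, -, hs⟩ := h.exists_pair (h.card_eq_two_of_six 0)
    obtain ⟨x', y', hxy', hy', hy6', hx', -, -, hs'⟩ := h.exists_pair (h.card_eq_two_of_six 1)
    have hlong : ∃ y, 3 ≤ y ∧ y < 6 ∧ 1 / 6 + q 6 < q y := by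
      by_cases ho : o x = b
      · refine ⟨y', hy', hy6', h.large_of_pair (by omega) (h3 _ fun ho' => ?_) hs'⟩
        have hsub : ({x, x'} : Finset ℕ) ⊆ jobsOn o 7 b := by
          intro l hl
          simp only [mem_insert, mem_singleton] at hl
          rw [mem_jobsOn]
          rcases hl with rfl | rfl
          · exact ⟨by omega, ho⟩
          · exact ⟨by omega, ho'⟩
        have hne : x ≠ x' := by
          rintro rfl
          rw [hx] at hx'
          exact absurd hx' (by decide)
        have := card_le_card hsub
        rw [hb, card_pair hne] at this
        omega
      · exact ⟨y, hy, hy6, h.large_of_pair (by omega) (h3 _ ho) hs⟩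
    obtain ⟨y, hy, hy6, hlong⟩ := hlong
    have h4 := h.card_sdiff_le_two h3 (insert y (range 3)) (by
      intro z hz
      simp only [mem_insert, mem_range] at hz
      exact ⟨by omega, hlong.trans_le (h.anti z y (by omega) (by omega))⟩)
    replace h4 : (insert y (range 3) \ jobsOn o 7 b).card ≤ 2 := h4
    have h5 := le_card_sdiff (jobsOn o 7 b) (insert y (range 3))
    rw [hb, card_insert_of_notMem (by simp [hy]), card_range] at h5
    omega
  by_contra hne
  by_cases h3 : (jobsOn o 7 i).card = 3
  · exact key i k (Ne.symm hi) hwk hik h3 (by omega)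
  · exact key k i hwk (Ne.symm hi) hik.symm (by omega) (by omega)

/-- If `o` puts the critical tuple `{4, 5, 6}` on one machine, then LPT with the critical tuple
loaded first is not bad. -/
theorem not_badPreloaded_tuple (h : BadLPT 3 6 q s o r) {w : Fin 3}
    (hw : jobsOn o 7 w = {4, 5, 6}) (h2 : ∀ i, i ≠ w → (jobsOn o 7 i).card = 2)
    (ht : ∀ x ∈ ({4, 5, 6} : Finset ℕ), t x = t 6) : ¬ BadPreloaded 6 q {4, 5, 6} t r := by
  intro hb
  obtain ⟨l, hl, hlS, hbad⟩ := hb.bad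
  have hl3 : l ≤ 3 := by simp at hlS; omega
  have hr := h.r_pos
  have hload : ∀ i, 1 + r < ∑ x ∈ earlier {4, 5, 6} t 6 l i, q x + q l := fun i => by
    have := hb.greedy l hl.le hlS i
    linarith
  -- job `0` shares its machine in `o` with a job `x ≤ 3`
  have hnw : ∀ y ≤ 3, o y ≠ w := by
    intro y hy hyw
    have : y ∈ jobsOn o 7 w := mem_jobsOn.2 ⟨by omega, hyw⟩
    rw [hw] at this
    simp at this
    omega
  have hpartner : ∀ y ≤ 3, ∃ x ≤ 3, x ≠ y ∧ o x = o y := by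
    intro y hy
    have h1 : ((jobsOn o 7 (o y)).erase y).card = 1 := by
      rw [card_erase_of_mem (by simp; omega), h2 _ (hnw y hy)]
    obtain ⟨x, hx⟩ := card_pos.1 (by rw [h1]; norm_num)
    rw [mem_erase, mem_jobsOn] at hx
    refine ⟨x, ?_, hx.1, hx.2.2⟩
    by_contra! hx3
    have h3 : x ∈ jobsOn o 7 w := by rw [hw]; simp; omega
    exact hnw y hy (hx.2.2.symm.trans (mem_jobsOn.1 h3).2)
  obtain ⟨x, hx3, hx0, hox⟩ := hpartner 0 (by omega)
  have h0x := h.pair_le (by omega) (by omega) hx0 hox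
  have h03 : q 0 + q 3 ≤ 1 := by
    have := h.anti x 3 hx3 (by omega)
    linarith
  have h12 : q 1 + q 2 ≤ 1 := by
    have h01 := h.anti 0 1 (by omega) (by omega)
    by_cases hx : x = 3
    · subst hx
      obtain ⟨y, hy3, hy1, hoy⟩ := hpartner 1 (by omega)
      have h1y := h.pair_le (by omega) (by omega) hy1 hoy
      have : y ≠ 3 := by
        -- otherwise three jobs would share a machine
        rintro rfl
        have hsub : ({0, 1, 3} : Finset ℕ) ⊆ jobsOn o 7 (o 3) := by
          intro z hz
          simp only [mem_insert, mem_singleton] at hz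
          rcases hz with rfl | rfl | rfl
          · exact mem_jobsOn.2 ⟨by omega, hox.symm⟩
          · exact mem_jobsOn.2 ⟨by omega, hoy.symm⟩
          · exact mem_jobsOn.2 ⟨by omega, rfl⟩
        have := card_le_card hsub
        rw [h2 _ (hnw 3 (by omega))] at this
        simp at this
      have := h.anti y 2 (by omega) (by omega)
      linarith
    · have := h.anti x 2 (by omega) (by omega)
      linarith
  -- the machines that do not hold the critical tuple
  obtain ⟨k₁, k₂, hk1, hk2, hk12⟩ := exists_others (t 6)
  have hset : ∀ k, t 6 ≠ k → earlier {4, 5, 6} t 6 l k = jobsOn t l k := by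
    intro k hk
    ext x
    rw [mem_earlier, mem_jobsOn]
    constructor
    · rintro ⟨-, hx | hx, hxk⟩
      · exact absurd ((ht x hx).symm.trans hxk) hk
      · exact ⟨hx, hxk⟩
    · rintro ⟨hx, hxk⟩
      exact ⟨by omega, Or.inr hx, hxk⟩
  have hl1 := hload k₁
  have hl2 := hload k₂
  rw [hset _ hk1] at hl1
  rw [hset _ hk2] at hl2
  have hsum := sum_card_three t l hk1 hk2 hk12
  have hone := h.q_le_one (l := l) (by omega)
  have hsmall : ∀ k, 1 + r < ∑ x ∈ jobsOn t l k, q x + q l → (jobsOn t l k).card ≤ 1 →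
      ∃ x < l, jobsOn t l k = {x} ∧ 1 < q x + q l := by
    intro k hk hc
    rcases (jobsOn t l k).eq_empty_or_nonempty with he | hne
    · rw [he, sum_empty] at hk
      linarith
    · obtain ⟨x, hx⟩ := card_eq_one.1 (le_antisymm hc (card_pos.2 hne))
      have hxm : x ∈ jobsOn t l k := by simp [hx]
      rw [hx, sum_singleton] at hk
      exact ⟨x, (mem_jobsOn.1 hxm).1, hx, by linarith⟩
  by_cases hl3' : l = 3
  · subst hl3'
    have : ∃ x < 3, 1 < q x + q 3 := by
      by_cases hc : (jobsOn t 3 k₁).card ≤ 1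
      · obtain ⟨x, hx, -, h1⟩ := hsmall k₁ hl1 hc
        exact ⟨x, hx, h1⟩
      · obtain ⟨x, hx, -, h1⟩ := hsmall k₂ hl2 (by omega)
        exact ⟨x, hx, h1⟩
    obtain ⟨x, hx, h1⟩ := this
    have := h.anti 0 x (by omega) (by omega)
    linarith
  · -- each of the two machines holds one job, so one of them holds job `1`
    have hc1 : (jobsOn t l k₁).card ≠ 0 := fun hc => by
      obtain ⟨x, -, hx, -⟩ := hsmall k₁ hl1 (by omega)
      simp [hx] at hc
    have hc2 : (jobsOn t l k₂).card ≠ 0 := fun hc => by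
      obtain ⟨x, -, hx, -⟩ := hsmall k₂ hl2 (by omega)
      simp [hx] at hc
    obtain ⟨x, hx, hxe, h1⟩ := hsmall k₁ hl1 (by omega)
    obtain ⟨y, hy, hye, h3⟩ := hsmall k₂ hl2 (by omega)
    have hxy : x ≠ y := by
      rintro rfl
      have ha : x ∈ jobsOn t l k₁ := by simp [hxe]
      have hb' : x ∈ jobsOn t l k₂ := by simp [hye]
      exact hk12 ((mem_jobsOn.1 ha).2.symm.trans (mem_jobsOn.1 hb').2)
    have hl2' : l = 2 := by omega
    subst hl2'
    have : x = 1 ∨ y = 1 := by omega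
    rcases this with rfl | rfl <;> linarith

theorem not_badPreloaded_of_three (h : BadLPT 3 6 q s o r)
    (ht : BadPreloaded 6 q {6} t r)
    (ht' : q 4 + q 5 + q 6 ≤ 1 + r → BadPreloaded 6 q {4, 5, 6} t' r)
    (htt : ∀ x ∈ ({4, 5, 6} : Finset ℕ), t' x = t' 6) : False := by
  have hp := h.quarter_lt
  have hp3 := h.le_third
  have hr := h.r_eq
  obtain ⟨w, hw, hother⟩ := h.exists_opt_shape
  obtain ⟨u, v, z, huv, hvz, hz7, hu, hv, hz, hW⟩ := exists_lt_of_card_eq_three hw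
  by_cases hu3 : u ≤ 3
  swap
  · have hu4 : u = 4 := by omega
    have hv5 : v = 5 := by omega
    have hz6 : z = 6 := by omega
    subst hu4 hv5 hz6
    have h1 : _ ≤ (1 : ℝ) := h.opt w
    norm_num at h1
    rw [hW, sum_insert (by simp), sum_pair (by norm_num), ← add_assoc] at h1
    exact h.not_badPreloaded_tuple hW hother htt (ht' (by linarith))
  have huv' := h.opt_three_pair (x := u) (y := v) (by omega) (by omega) huv.ne
    (hu.trans hv.symm) (hu ▸ hw)
  have hu' := h.opt_three_single (x := u) (by omega) (hu ▸ hw)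
  have hnl : ¬ (1 / 6 + q 6 < q v) := fun hl =>
    h.opt_ne_of_large (by omega) (by omega) huv.ne (hu ▸ hw)
      (hl.trans_le (h.anti u v huv.le (by omega))) hl (hu.trans hv.symm)
  have hv4 : 4 ≤ v := by
    by_contra! hv4
    obtain ⟨x, y, hxy, hy3, hy6, -, -, he, hs⟩ := h.exists_pair (h.card_eq_two_of_six (s u))
    have hux : u = x := by
      have : u ∈ jobsOn s 6 (s u) := by simp; omega
      rw [he] at this
      simp at this
      omega
    subst hux
    exact hnl
      ((h.large_of_pair (by omega) (hu ▸ hw) hs).trans_le (h.anti v y (by omega) (by omega)))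
  -- of the other three jobs among `0, 1, 2, 3`, two share a machine in `o`
  have hnw : ∀ y < 7, y ≠ u → y ≠ v → y ≠ z → o y ≠ w := by
    intro y hy h1 h2 h3 hyw
    have : y ∈ jobsOn o 7 w := mem_jobsOn.2 ⟨hy, hyw⟩
    rw [hW] at this
    simp at this
    omega
  obtain ⟨a, b, hab, hb3, hau, hbu, hpair⟩ :
      ∃ a b, a < b ∧ b ≤ 3 ∧ a ≠ u ∧ b ≠ u ∧ q a + q b ≤ 1 := by
    obtain ⟨a, ha, b, hb, hab, he⟩ := exists_ne_map_eq_of_card_lt_of_maps_to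
      (s := (range 4).erase u) (t := univ.erase w) (f := o)
      (by rw [card_erase_of_mem (mem_univ w), card_erase_of_mem (mem_range.2 (by omega))]; simp)
      (fun y hy => by
        rw [mem_coe, mem_erase, mem_range] at hy
        rw [mem_coe, mem_erase]
        refine ⟨?_, mem_univ _⟩
        exact hnw y (by omega) hy.1 (by omega) (by omega))
    rw [mem_erase, mem_range] at ha hb
    have h1 := h.pair_le (by omega) (by omega) hab he
    rcases lt_or_gt_of_ne hab with h2 | h2
    · exact ⟨a, b, h2, by omega, ha.1, hb.1, h1⟩
    · exact ⟨b, a, h2, by omega, hb.1, ha.1, by linarith⟩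
  rcases h.late_job rfl ht with ⟨x, l, hxl, hl6, hl3, hxl4, hsum⟩ | ⟨x, hx2, hx5, hsum⟩
  · have hx1 := h.le_one_sub (hxl.trans hl6)
    obtain rfl | rfl | rfl : l = 3 ∨ l = 4 ∨ l = 5 := by omega
    · have h1 := h.anti 1 x (by omega) (by omega)
      have h2 := h.anti 1 3 (by omega) (by omega)
      by_cases hu1 : u ≤ 1
      · have h3 := h.anti u 1 (by omega) (by omega)
        linarith
      · have h3 := h.anti a 1 (by omega) (by omega)
        have h4 := h.anti b 3 (by omega) (by omega)
        linarith
    · have h1 := h.anti 0 x (by omega) (by omega)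
      have h2 := h.anti 0 4 (by omega) (by omega)
      have hv5 : v = 5 := by
        by_contra hv5
        have : v = 4 := by omega
        subst this
        exact hnl (by linarith)
      subst hv5
      have hu0 : u ≠ 0 := by
        rintro rfl
        linarith
      -- job `0` shares its machine in `o` with a job `y ≤ 4`
      have h3 : ((jobsOn o 7 (o 0)).erase 0).card = 1 := by
        rw [card_erase_of_mem (by simp), hother _ (hnw 0 (by omega) (by omega) (by omega)
          (by omega))]
      obtain ⟨y, hy⟩ := card_pos.1 (by rw [h3]; norm_num)
      rw [mem_erase, mem_jobsOn] at hy
      have hy4 : y ≤ 4 := by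
        by_contra! hy4
        refine hnw 0 (by omega) (by omega) (by omega) (by omega) ?_
        rw [← hy.2.2]
        have : y = 5 ∨ y = z := by omega
        rcases this with rfl | rfl <;> assumption
      have h4 := h.pair_le (by omega) (by omega) hy.1 hy.2.2
      have h5 := h.anti y 4 hy4 (by omega)
      linarith
    · have h1 := h.anti v 5 (by omega) (by omega)
      exact hnl (by linarith)
  · have h1 := h.anti 2 x (by omega) (by omega)
    have h2 := h.anti v 5 (by omega) (by omega)
    norm_num at hsum
    by_cases hu2 : u ≤ 2
    · have h3 := h.anti u 2 hu2 (by omega)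
      linarith
    · have hu3' : u = 3 := by omega
      subst hu3'
      have h3 := h.anti a 2 (by omega) (by omega)
      have h4 := h.anti b 2 (by omega) (by omega)
      have h5 := h.anti 3 5 (by omega) (by omega)
      linarith

end three

end BadLPT

/-! ### The approximation ratio -/

/-- Extension of a family indexed by `Fin n` to a sequence, with the constant value `d` beyond. -/
def extend {α : Type*} {n : ℕ} (f : Fin n → α) (d : α) (l : ℕ) : α :=
  if h : l < n then f ⟨l, h⟩ else d

@[simp]
theorem extend_val {α : Type*} {n : ℕ} (f : Fin n → α) (d : α) (l : Fin n) :
    extend f d l = f l := by simp [extend]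

theorem sum_extend {n : ℕ} (f : Fin n → ℝ) (A : Finset ℕ) (B : Finset (Fin n))
    (hA : ∀ x ∈ A, x < n) (hAB : ∀ l : Fin n, (l : ℕ) ∈ A ↔ l ∈ B) :
    ∑ x ∈ A, extend f 0 x = ∑ l ∈ B, f l := by
  have : A = B.map Fin.valEmbedding := by
    ext x
    simp only [mem_map, Fin.valEmbedding_apply]
    constructor
    · intro hx
      exact ⟨⟨x, hA x hx⟩, (hAB ⟨x, hA x hx⟩).1 hx, rfl⟩
    · rintro ⟨l, hl, rfl⟩
      exact (hAB l).2 hl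
  rw [this, sum_map]
  simp

section Fin

variable {n m : ℕ}

theorem load_le_makespan (p : Fin n → ℝ) (s : Fin n → Fin m) (i : Fin m) :
    load p s i ≤ makespan p s :=
  le_ciSup (Set.finite_range _).bddAbove i

theorem exists_load_eq_makespan [Nonempty (Fin m)] (p : Fin n → ℝ) (s : Fin n → Fin m) :
    ∃ i, load p s i = makespan p s :=
  exists_eq_ciSup_of_finite

theorem sum_load (p : Fin n → ℝ) (s : Fin n → Fin m) : ∑ i, load p s i = ∑ l, p l :=
  Finset.sum_fiberwise univ s p

theorem load_comp_perm (p : Fin n → ℝ) (s : Fin n → Fin m) (σ : Equiv.Perm (Fin n)) (i : Fin m) :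
    load (p ∘ σ) (s ∘ σ) i = load p s i := by
  unfold load
  rw [sum_filter, sum_filter]
  exact Equiv.sum_comp σ (fun l => if s l = i then p l else 0)

/-- An optimal schedule, with the jobs renumbered by `σ`. -/
theorem exists_load_le_optMakespan [Nonempty (Fin m)] (p : Fin n → ℝ) (σ : Equiv.Perm (Fin n)) :
    ∃ o : Fin n → Fin m, ∀ i, load (p ∘ σ) o i ≤ optMakespan m p := by
  obtain ⟨o, ho⟩ : ∃ o : Fin n → Fin m, makespan p o = optMakespan m p :=
    exists_eq_ciInf_of_finite
  exact ⟨o ∘ σ, fun i => by rw [load_comp_perm, ← ho]; exact load_le_makespan p o i⟩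

/-- In a schedule of `LPT(S)` with a makespan larger than the sum of `S`, take the last job `l`
on the machine with the largest load. -/
theorem exists_last_job [Nonempty (Fin m)] {S : Finset (Fin n)} {q : Fin n → ℝ}
    {t : Fin n → Fin m} (hq : ∀ l, 0 ≤ q l) (hS : ∑ l ∈ S, q l < makespan q t) :
    ∃ l, l ∉ S ∧ makespan q t = loadBefore S q t l (t l) + q l := by
  obtain ⟨i, hi⟩ := exists_load_eq_makespan q t
  set A : Finset (Fin n) := {l | l ∉ S ∧ t l = i} with hA
  rcases A.eq_empty_or_nonempty with hA0 | hA0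
  · refine absurd hS (not_lt.2 ?_)
    rw [← hi]
    refine sum_le_sum_of_subset_of_nonneg (fun l hl => ?_) fun l _ _ => hq l
    by_contra hlS
    have : l ∈ A := by simp at hl; simp [hA, hl, hlS]
    simp [hA0] at this
  · have hmem := max'_mem A hA0
    set l := A.max' hA0
    simp only [hA, mem_filter, mem_univ, true_and] at hmem
    refine ⟨l, hmem.1, ?_⟩
    have hset : ({x | t x = i} : Finset (Fin n)) =
        insert l ({x | (x ∈ S ∨ x < l) ∧ t x = t l} : Finset (Fin n)) := by
      ext x
      simp only [mem_filter, mem_univ, true_and, mem_insert]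
      constructor
      · intro hx
        by_cases hxS : x ∈ S
        · exact Or.inr ⟨Or.inl hxS, hx.trans hmem.2.symm⟩
        · have : x ≤ l := le_max' A x (by simp [hA, hx, hxS])
          rcases this.eq_or_lt with h1 | h1
          · exact Or.inl h1
          · exact Or.inr ⟨Or.inr h1, hx.trans hmem.2.symm⟩
      · rintro (rfl | ⟨-, hx⟩)
        · exact hmem.2
        · exact hx.trans hmem.2
    rw [← hi, load, hset, sum_insert (by simp [hmem.1]), loadBefore, add_comm]

/-- The usual averaging argument of list scheduling. -/
theorem mul_loadBefore_add_le {S : Finset (Fin n)} {q : Fin n → ℝ} {t : Fin n → Fin m}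
    (hq : ∀ l, 0 ≤ q l) (ht : IsLPTSchedule S q t) {l : Fin n} (hl : l ∉ S) :
    m * loadBefore S q t l (t l) + q l ≤ ∑ x, q x := by
  have h1 : m * loadBefore S q t l (t l) ≤ ∑ i, loadBefore S q t l i := by
    calc _ = ∑ _i : Fin m, loadBefore S q t l (t l) := by
          rw [sum_const, card_univ, Fintype.card_fin, nsmul_eq_mul]
      _ ≤ _ := sum_le_sum fun i _ => ht.2 l hl i
  have h2 : ∑ i, loadBefore S q t l i = ∑ x with x ∈ S ∨ x < l, q x := by
    simp only [loadBefore, ← filter_filter]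
    exact sum_fiberwise _ t q
  have h3 : ∑ x with x ∈ S ∨ x < l, q x + q l ≤ ∑ x, q x := by
    rw [add_comm, ← sum_insert (by simp [hl])]
    exact sum_le_sum_of_subset_of_nonneg (subset_univ _) fun x _ _ => hq x
  linarith

/-- A makespan of LPT above `(1 + r) C`, where `C` bounds the loads of a schedule `o`, gives a bad
LPT schedule of the jobs up to the critical one, after scaling by `C`. -/
theorem badLPT_of_isCritical {q : Fin n → ℝ} {s o : Fin n → Fin m} {j : Fin n} {r C : ℝ}
    (hm : 3 ≤ m) (hr : 3 * ((m : ℝ) - 1) * r = m - 2) (hC : 0 < C) (hq : ∀ l, 0 ≤ q l)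
    (hanti : Antitone q) (ho : ∀ i, load q o i ≤ C) (hs : IsLPTSchedule ∅ q s)
    (hj : IsCritical q s j) (hbad : (1 + r) * C < makespan q s) :
    BadLPT m j (extend (fun l => q l / C) 0) (extend s (s j)) (extend o (o j)) r := by
  have hjobs : ∀ (t : Fin n → Fin m) (k : ℕ) (i : Fin m), k ≤ n →
      ∑ x ∈ jobsOn (extend t (t j)) k i, extend (fun l => q l / C) 0 x =
        (∑ l ∈ univ.filter fun l : Fin n => l.val < k ∧ t l = i, q l) / C := by
    intro t k i hk
    rw [sum_div]
    refine sum_extend _ _ _ (fun x hx => ?_) fun l => ?_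
    · rw [mem_jobsOn] at hx
      omega
    · simp
  have hbefore : ∀ (l : Fin n) (i : Fin m),
      ∑ x ∈ jobsOn (extend s (s j)) l i, extend (fun l => q l / C) 0 x =
        loadBefore ∅ q s l i / C := by
    intro l i
    rw [hjobs _ _ _ l.2.le, loadBefore]
    simp
  refine ⟨hm, hr, fun i l hil hl => ?_, ?_, fun l hl i => ?_, fun i => ?_, ?_⟩
  · have hln : l < n := by omega
    have hin : i < n := by omega
    have := hanti (show (⟨i, hin⟩ : Fin n) ≤ ⟨l, hln⟩ from hil)
    simp only [extend, hln, hin, dif_pos]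
    gcongr
  · rw [extend_val]
    exact div_nonneg (hq j) hC.le
  · have hln : l < n := by omega
    have h1 := hs.2 ⟨l, hln⟩ (by simp) i
    rw [show extend s (s j) l = s ⟨l, hln⟩ by simp [extend, hln], hbefore ⟨l, hln⟩,
      hbefore ⟨l, hln⟩]
    gcongr
  · rw [hjobs _ _ _ (by omega), div_le_one hC]
    refine le_trans ?_ (ho i)
    refine sum_le_sum_of_subset_of_nonneg (fun l hl => ?_) fun l _ _ => hq l
    simp only [mem_filter, mem_univ, true_and] at hl ⊢
    exact hl.2
  · rw [extend_val, extend_val, hbefore, ← add_div, lt_div_iff₀ hC]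
    refine hbad.trans_le (le_of_eq ?_)
    rw [← hj, loadBefore, add_comm, ← sum_insert (by simp)]
    refine sum_congr ?_ fun _ _ => rfl
    ext x
    simp only [jobsUpTo, mem_filter, mem_univ, true_and, mem_insert, notMem_empty, false_or]
    constructor
    · rintro ⟨h1, h2⟩
      rcases h1.eq_or_lt with h3 | h3
      · exact Or.inl h3
      · exact Or.inr ⟨h3, h2⟩
    · rintro (rfl | ⟨h1, h2⟩)
      · simp
      · exact ⟨h1.le, h2⟩

/-- If the makespan of `LPT(S)` exceeds `(1 + r) C` as well, a late job precedes `j`. -/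
theorem badPreloaded_of_lt {q : Fin n → ℝ} {s o : ℕ → Fin m} {t : Fin n → Fin m} {j : Fin n}
    {r C : ℝ} {S : Finset (Fin n)} {S' : Finset ℕ} {o' : Fin n → Fin m}
    (h : BadLPT m j (extend (fun l => q l / C) 0) s o r) (hC : 0 < C) (hq : ∀ l, 0 ≤ q l)
    (ho : ∀ i, load q o' i ≤ C) (hS : ∀ l ∈ S, l ≤ j) (hjS : j ∈ S)
    (hSS' : ∀ l : Fin n, (l : ℕ) ∈ S' ↔ l ∈ S)
    (hsum : ∑ l ∈ S, q l ≤ (1 + r) * C) (ht : IsLPTSchedule S q t)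
    (hbad : (1 + r) * C < makespan q t) :
    BadPreloaded j (extend (fun l => q l / C) 0) S' (extend t (t j)) r := by
  have hbefore : ∀ (l : Fin n) (i : Fin m), l ≤ j →
      ∑ x ∈ earlier S' (extend t (t j)) j l i, extend (fun l => q l / C) 0 x =
        loadBefore S q t l i / C := by
    intro l i hl
    rw [loadBefore, sum_div]
    refine sum_extend _ _ _ (fun x hx => ?_) fun x => ?_
    · rw [mem_earlier] at hx
      omega
    · simp only [mem_earlier, extend_val, hSS', mem_filter, mem_univ, true_and, Fin.val_fin_lt,
        Fin.val_fin_le, and_iff_right_iff_imp]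
      rintro ⟨hx | hx, -⟩
      · exact hS x hx
      · exact hx.le.trans hl
  refine ⟨fun l hl hlS i => ?_, ?_⟩
  · have hln : l < n := by omega
    have h1 := ht.2 ⟨l, hln⟩ (by rw [← hSS']; exact hlS) i
    rw [show extend t (t j) l = t ⟨l, hln⟩ by simp [extend, hln], hbefore ⟨l, hln⟩ _ hl,
      hbefore ⟨l, hln⟩ _ hl]
    gcongr
  · have hm := h.hm
    have : Nonempty (Fin m) := ⟨⟨0, by omega⟩⟩
    obtain ⟨l, hlS, hl⟩ := exists_last_job hq (hsum.trans_lt hbad)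
    have h1 := mul_loadBefore_add_le hq ht hlS
    have h2 : ∑ x, q x ≤ m * C := by
      rw [← sum_load q o']
      calc _ ≤ ∑ _i : Fin m, C := sum_le_sum fun i _ => ho i
        _ = _ := by rw [sum_const, card_univ, Fintype.card_fin, nsmul_eq_mul]
    have h3 := h.three_le
    have h4 : m * r * C < (m - 1) * q l := by nlinarith
    have hlj : l < j := by
      by_contra! hlj
      have hne : j < l := lt_of_le_of_ne hlj fun he => hlS (he ▸ hjS)
      have h5 : ∑ x ∈ range (j + 1), extend (fun l => q l / C) 0 x + q l / C ≤ m := by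
        rw [sum_extend (fun l => q l / C) (range (j + 1)) {x | x ≤ j}
          (fun x hx => by rw [mem_range] at hx; omega)
          (fun x => by simp), ← sum_div, ← add_div, div_le_iff₀ hC, add_comm,
          ← sum_insert (by simp [hne])]
        exact (sum_le_sum_of_subset_of_nonneg (subset_univ _) fun x _ _ => hq x).trans h2
      have h6 := h.mul_le_of_sum_le h5
      rw [mul_div_assoc', div_le_iff₀ hC] at h6
      linarith
    refine ⟨l, hlj, by rw [hSS']; exact hlS, ?_⟩
    rw [extend_val, extend_val, hbefore _ _ hlj.le, ← add_div, lt_div_iff₀ hC, ← hl]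
    exact hbad

/-- The approximation ratio of LPT-REV for sorted jobs. -/
theorem min_le_of_isLPTSchedule {q : Fin n → ℝ} {s₁ s₂ s₃ o : Fin n → Fin m} {j : Fin n}
    {r C : ℝ} (hm : 3 ≤ m) (hr : 3 * ((m : ℝ) - 1) * r = m - 2) (hq : ∀ l, 0 ≤ q l)
    (hanti : Antitone q) (ho : ∀ i, load q o i ≤ C) (hs₁ : IsLPTSchedule ∅ q s₁)
    (hj : IsCritical q s₁ j) (hs₂ : IsLPTSchedule {j} q s₂)
    (hs₃ : IsLPTSchedule (criticalTuple s₁ j) q s₃) :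
    min (makespan q s₁) (min (makespan q s₂) (makespan q s₃)) ≤ (1 + r) * C := by
  by_contra! hcon
  rw [lt_min_iff, lt_min_iff] at hcon
  obtain ⟨h1, h2, h3⟩ := hcon
  have hqC : ∀ l, q l ≤ C := fun l =>
    (single_le_sum (f := q) (fun x _ => hq x) (by simp)).trans (ho (o l))
  have hr0 : 0 < r := by
    have : (3 : ℝ) ≤ m := by exact_mod_cast hm
    by_contra! hr
    nlinarith
  have hC : 0 < C := by
    by_contra! hC
    have hq0 : ∀ l, q l = 0 := fun l => le_antisymm ((hqC l).trans hC) (hq l)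
    have hC0 : C = 0 := le_antisymm hC ((hq j).trans (hqC j))
    rw [← hj] at h1
    simp [hq0, hC0] at h1
  have h := badLPT_of_isCritical hm hr hC hq hanti ho hs₁ hj h1
  have hb : BadPreloaded j (extend (fun l => q l / C) 0) {(j : ℕ)} (extend s₂ (s₂ j)) r := by
    refine badPreloaded_of_lt h hC hq ho (S := {j}) (by simp) (by simp) (by simp [Fin.ext_iff])
      ?_ hs₂ h2
    rw [sum_singleton]
    have := hqC j
    nlinarith
  rcases eq_or_lt_of_le hm with rfl | hm4
  · have hj6 := h.eq_six
    rw [hj6] at h hb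
    have hmem : ∀ l : Fin n, (l : ℕ) ∈ ({4, 5, 6} : Finset ℕ) ↔ l ∈ criticalTuple s₁ j := by
      have hcard : (jobsUpTo s₁ j).card = 3 := by
        have hset : (jobsOn (extend s₁ (s₁ j)) 7 (s₁ j)) =
            (jobsUpTo s₁ j).map Fin.valEmbedding := by
          ext x
          simp only [mem_jobsOn, mem_map, jobsUpTo, mem_filter, mem_univ, true_and,
            Fin.valEmbedding_apply]
          constructor
          · rintro ⟨hx, hxs⟩
            have hxn : x < n := by omega
            refine ⟨⟨x, hxn⟩, ⟨?_, ?_⟩, rfl⟩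
            · rw [Fin.le_def]
              simp only
              omega
            · simpa [extend, hxn] using hxs
          · rintro ⟨l, ⟨hl, hls⟩, rfl⟩
            rw [Fin.le_def] at hl
            exact ⟨by omega, by rw [extend_val, hls]⟩
        have h6 : jobsOn (extend s₁ (s₁ j)) 7 (s₁ j) =
            insert 6 (jobsOn (extend s₁ (s₁ j)) 6 (s₁ j)) := by
          have h0 : extend s₁ (s₁ j) 6 = s₁ j := by rw [← hj6, extend_val]
          ext x
          simp only [mem_jobsOn, mem_insert]
          constructor
          · rintro ⟨hx, hxs⟩
            by_cases hx6 : x = 6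
            · exact Or.inl hx6
            · exact Or.inr ⟨by omega, hxs⟩
          · rintro (rfl | ⟨hx, hxs⟩)
            · exact ⟨by omega, h0⟩
            · exact ⟨by omega, hxs⟩
        rw [← card_map Fin.valEmbedding, ← hset, h6, card_insert_of_notMem (by simp),
          h.card_eq_two_of_six]
      intro l
      simp only [criticalTuple, hcard, mem_filter, mem_univ, true_and, Fin.le_def, mem_insert,
        mem_singleton]
      omega
    refine h.not_badPreloaded_of_three hb (t' := extend s₃ (s₃ j)) (fun hle => ?_)
      fun x hx => ?_
    · have hS : ∀ l ∈ criticalTuple s₁ j, l ≤ j := fun l hl => by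
        simp only [criticalTuple, mem_filter] at hl
        exact hl.2.1
      have hjS : j ∈ criticalTuple s₁ j := by
        rw [← hmem, hj6]
        simp
      have hmem' := hmem
      rw [← hj6] at h hmem' ⊢
      refine badPreloaded_of_lt h hC hq ho hS hjS hmem' ?_ hs₃ h3
      have h4 : ∑ x ∈ ({4, 5, 6} : Finset ℕ), extend (fun l => q l / C) 0 x =
          (∑ l ∈ criticalTuple s₁ j, q l) / C := by
        rw [sum_div]
        refine sum_extend _ _ _ (fun x hx => ?_) hmem
        simp at hx
        omega
      rw [sum_insert (by simp), sum_pair (by norm_num), ← add_assoc] at h4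
      rw [h4, div_le_iff₀ hC] at hle
      exact hle
    · have hxn : x < n := by simp at hx; omega
      have h6 : extend s₃ (s₃ j) 6 = s₃ j := by rw [← hj6, extend_val]
      rw [h6, show x = ((⟨x, hxn⟩ : Fin n) : ℕ) from rfl, extend_val]
      refine hs₃.1 _ ?_ _ ?_
      · rw [← hmem]
        exact hx
      · rw [← hmem, hj6]
        simp
  · exact h.not_badPreloaded_of_four_le hm4 hb

theorem le_of_isOutput {p : Fin n → ℝ} (hm : 3 ≤ m) (hp : ∀ j, 0 ≤ p j) {z : ℝ}
    (hz : IsOutput m p z) : z ≤ (4 / 3 - 1 / (3 * ((m : ℝ) - 1))) * optMakespan m p := by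
  obtain ⟨σ, hσ, s₁, s₂, s₃, j, hs₁, hj, hs₂, hs₃, rfl⟩ := hz
  have : Nonempty (Fin m) := ⟨⟨0, by omega⟩⟩
  obtain ⟨o, ho⟩ := exists_load_le_optMakespan (m := m) p σ
  have hm' : (3 : ℝ) ≤ m := by exact_mod_cast hm
  have hm0 : (m : ℝ) - 1 ≠ 0 := by linarith
  have := min_le_of_isLPTSchedule (r := 1 / 3 - 1 / (3 * ((m : ℝ) - 1))) hm
    (by field_simp; ring) (fun l => hp (σ l)) hσ ho hs₁ hj hs₂ hs₃
  rwa [show (4 / 3 - 1 / (3 * ((m : ℝ) - 1)) : ℝ) = 1 + (1 / 3 - 1 / (3 * ((m : ℝ) - 1))) by ring]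

end Fin

/-! ### Heaps -/

/-- Binary trees whose nodes carry a key and a second number. -/
inductive Heap : Type
  | nil : Heap
  | node (k c : ℝ) (l r : Heap) : Heap

/-- A node label as a value of the machine model. -/
noncomputable def encodeEntry (k c : ℝ) : Val := .pair (.num k) (.num c)

namespace Heap

/-- A tree as a value of the machine model. -/
noncomputable def encode : Heap → Val
  | nil => .nil
  | node k c l r => .pair (encodeEntry k c) (.pair l.encode r.encode)

/-- The number of levels. -/
def height : Heap → ℕ
  | nil => 0
  | node _ _ l r => max l.height r.height + 1

/-- The number of nodes. -/
def size : Heap → ℕ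
  | nil => 0
  | node _ _ l r => l.size + r.size + 1

/-- A tree is a Braun tree if at every node the left subtree has as many nodes as the right one,
or one more. -/
def IsBraun : Heap → Prop
  | nil => True
  | node _ _ l r => l.IsBraun ∧ r.IsBraun ∧ r.size ≤ l.size ∧ l.size ≤ r.size + 1

/-- Insertion into a Braun tree: the two subtrees change places. -/
noncomputable def insert (k c : ℝ) : Heap → Heap
  | nil => node k c nil nil
  | node k' c' l r =>
    if k ≤ k' then node k c (insert k' c' r) l else node k' c' (insert k c r) l

/-- The heap with the same shape as `node k c l r` that is obtained by sifting down the root. -/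
noncomputable def sift (k c : ℝ) : Heap → Heap → Heap
  | nil, r => node k c nil r
  | node kl cl ll lr, nil =>
    if k ≤ kl then node k c (node kl cl ll lr) nil else node kl cl (sift k c ll lr) nil
  | node kl cl ll lr, node kr cr rl rr =>
    if kl ≤ kr then
      if k ≤ kl then node k c (node kl cl ll lr) (node kr cr rl rr)
      else node kl cl (sift k c ll lr) (node kr cr rl rr)
    else
      if k ≤ kr then node k c (node kl cl ll lr) (node kr cr rl rr)
      else node kr cr (node kl cl ll lr) (sift k c rl rr)
termination_by l r => l.size + r.size
decreasing_by all_goals simp only [size]; omega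

/-- The node labels. -/
def entries : Heap → Multiset (ℝ × ℝ)
  | nil => 0
  | node k c l r => (k, c) ::ₘ (l.entries + r.entries)

/-- The heap order: no key is smaller than that of its parent. -/
def IsHeap : Heap → Prop
  | nil => True
  | node k _ l r => l.IsHeap ∧ r.IsHeap ∧ (∀ e ∈ l.entries, k ≤ e.1) ∧ ∀ e ∈ r.entries, k ≤ e.1

theorem eq_nil_of_size {h : Heap} (hs : h.size = 0) : h = nil := by
  cases h with
  | nil => rfl
  | node => simp [size] at hs

theorem IsBraun.two_pow_height_le {h : Heap} (hb : h.IsBraun) (hs : 0 < h.size) :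
    2 ^ h.height ≤ 2 * h.size := by
  induction h with
  | nil => simp [size] at hs
  | node k c l r hl hr =>
    obtain ⟨h1, h2, h3, h4⟩ := hb
    simp only [height, size]
    have hl' : 2 ^ l.height ≤ l.size + r.size + 1 := by
      rcases Nat.eq_zero_or_pos l.size with h0 | h0
      · rw [eq_nil_of_size h0]; simp [height]
      · have := hl h1 h0; omega
    have hr' : 2 ^ r.height ≤ l.size + r.size + 1 := by
      rcases Nat.eq_zero_or_pos r.size with h0 | h0
      · rw [eq_nil_of_size h0]; simp [height]
      · have := hr h2 h0; omega
    rcases le_total l.height r.height with h0 | h0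
    · rw [max_eq_right h0, pow_succ]; omega
    · rw [max_eq_left h0, pow_succ]; omega

theorem IsBraun.height_le {h : Heap} (hb : h.IsBraun) {n : ℕ} (hs : h.size ≤ n) :
    h.height ≤ Nat.log 2 n + 1 := by
  rcases Nat.eq_zero_or_pos h.size with h0 | h0
  · rw [eq_nil_of_size h0]; simp [height]
  · have h1 := hb.two_pow_height_le h0
    have h2 : n < 2 ^ (Nat.log 2 n + 1) := Nat.lt_pow_succ_log_self (by norm_num) n
    by_contra! h3
    have h4 : 2 ^ (Nat.log 2 n + 1 + 1) ≤ 2 ^ h.height := Nat.pow_le_pow_right (by norm_num) h3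
    rw [pow_succ] at h4
    omega

theorem size_insert (k c : ℝ) (h : Heap) : (h.insert k c).size = h.size + 1 := by
  induction h generalizing k c with
  | nil => rfl
  | node k' c' l r hl hr =>
    rw [insert]
    split_ifs <;> simp only [size, hr] <;> omega

theorem IsBraun.insert {h : Heap} (hb : h.IsBraun) (k c : ℝ) : (h.insert k c).IsBraun := by
  induction h generalizing k c with
  | nil => simp [Heap.insert, IsBraun, size]
  | node k' c' l r hl hr =>
    obtain ⟨h1, h2, h3, h4⟩ := hb
    rw [Heap.insert]
    split_ifs <;> refine ⟨hr h2 _ _, h1, ?_, ?_⟩ <;> rw [size_insert] <;> omega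

theorem entries_insert (k c : ℝ) (h : Heap) : (h.insert k c).entries = (k, c) ::ₘ h.entries := by
  induction h generalizing k c with
  | nil => rfl
  | node k' c' l r hl hr =>
    rw [insert]
    split_ifs
    · rw [entries, hr, entries, Multiset.cons_add, add_comm r.entries]
    · rw [entries, hr, entries, Multiset.cons_add, add_comm r.entries, Multiset.cons_swap]

theorem IsHeap.insert {h : Heap} (hh : h.IsHeap) (k c : ℝ) : (h.insert k c).IsHeap := by
  induction h generalizing k c with
  | nil => simp [Heap.insert, IsHeap, entries]
  | node k' c' l r hl hr =>
    obtain ⟨h1, h2, h3, h4⟩ := hh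
    rw [Heap.insert]
    split_ifs with hk
    · refine ⟨hr h2 _ _, h1, fun e he => ?_, fun e he => hk.trans (h3 e he)⟩
      rw [entries_insert, Multiset.mem_cons] at he
      rcases he with rfl | he
      · exact hk
      · exact hk.trans (h4 e he)
    · refine ⟨hr h2 _ _, h1, fun e he => ?_, fun e he => h3 e he⟩
      rw [entries_insert, Multiset.mem_cons] at he
      rcases he with rfl | he
      · exact (not_le.1 hk).le
      · exact h4 e he

theorem size_sift (k c : ℝ) (l r : Heap) : (sift k c l r).size = l.size + r.size + 1 := by
  induction l, r using sift.induct (k := k) with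
  | case1 r => rw [sift]; rfl
  | case2 kl cl ll lr h => rw [sift, if_pos h]; rfl
  | case3 kl cl ll lr h ih => rw [sift, if_neg h]; simp only [size, ih]
  | case4 kl cl ll lr kr cr rl rr h h' => rw [sift, if_pos h, if_pos h']; rfl
  | case5 kl cl ll lr kr cr rl rr h h' ih =>
    rw [sift, if_pos h, if_neg h']; simp only [size, ih]
  | case6 kl cl ll lr kr cr rl rr h h' => rw [sift, if_neg h, if_pos h']; rfl
  | case7 kl cl ll lr kr cr rl rr h h' ih =>
    rw [sift, if_neg h, if_neg h']; simp only [size, ih]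

theorem IsBraun.sift {k c : ℝ} {l r : Heap} (hb : (node k c l r).IsBraun) (k' c' : ℝ) :
    (sift k' c' l r).IsBraun := by
  induction l, r using sift.induct (k := k') generalizing k c with
  | case1 r => rw [Heap.sift]; exact hb
  | case2 kl cl ll lr h => rw [Heap.sift, if_pos h]; exact hb
  | case3 kl cl ll lr h ih =>
    rw [Heap.sift, if_neg h]
    refine ⟨ih hb.1, hb.2.1, ?_, ?_⟩ <;> rw [size_sift]
    · exact hb.2.2.1
    · exact hb.2.2.2
  | case4 kl cl ll lr kr cr rl rr h h' => rw [Heap.sift, if_pos h, if_pos h']; exact hb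
  | case5 kl cl ll lr kr cr rl rr h h' ih =>
    rw [Heap.sift, if_pos h, if_neg h']
    refine ⟨ih hb.1, hb.2.1, ?_, ?_⟩ <;> rw [size_sift]
    · exact hb.2.2.1
    · exact hb.2.2.2
  | case6 kl cl ll lr kr cr rl rr h h' => rw [Heap.sift, if_neg h, if_pos h']; exact hb
  | case7 kl cl ll lr kr cr rl rr h h' ih =>
    rw [Heap.sift, if_neg h, if_neg h']
    refine ⟨hb.1, ih hb.2.1, ?_, ?_⟩ <;> rw [size_sift]
    · exact hb.2.2.1
    · exact hb.2.2.2

theorem entries_sift (k c : ℝ) (l r : Heap) :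
    (sift k c l r).entries = (k, c) ::ₘ (l.entries + r.entries) := by
  induction l, r using sift.induct (k := k) with
  | case1 r => rw [sift]; rfl
  | case2 kl cl ll lr h => rw [sift, if_pos h]; rfl
  | case3 kl cl ll lr h ih =>
    rw [sift, if_neg h]
    simp only [entries, ih, Multiset.cons_add, Multiset.cons_swap (k, c)]
  | case4 kl cl ll lr kr cr rl rr h h' => rw [sift, if_pos h, if_pos h']; rfl
  | case5 kl cl ll lr kr cr rl rr h h' ih =>
    rw [sift, if_pos h, if_neg h']
    simp only [entries, ih, Multiset.cons_add]
    rw [Multiset.cons_swap]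
  | case6 kl cl ll lr kr cr rl rr h h' => rw [sift, if_neg h, if_pos h']; rfl
  | case7 kl cl ll lr kr cr rl rr h h' ih =>
    rw [sift, if_neg h, if_neg h']
    simp only [entries, ih, Multiset.add_cons]
    rw [Multiset.cons_swap]

theorem IsHeap.le_of_mem {k c : ℝ} {l r : Heap} (hh : (node k c l r).IsHeap) {e : ℝ × ℝ}
    (he : e ∈ (node k c l r).entries) : k ≤ e.1 := by
  rw [entries, Multiset.mem_cons, Multiset.mem_add] at he
  rcases he with rfl | he | he
  · exact le_rfl
  · exact hh.2.2.1 e he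
  · exact hh.2.2.2 e he

theorem IsHeap.sift {k c : ℝ} {l r : Heap} (hb : (node k c l r).IsBraun) (hl : l.IsHeap)
    (hr : r.IsHeap) (k' c' : ℝ) : (sift k' c' l r).IsHeap := by
  have hnil : ∀ {a : ℝ}, ∀ e ∈ nil.entries, a ≤ e.1 := fun e he => by simp [entries] at he
  induction l, r using sift.induct (k := k') generalizing k c with
  | case1 r =>
    have : r = nil := eq_nil_of_size (by have := hb.2.2.1; simpa [size] using this)
    subst this
    rw [Heap.sift]
    exact ⟨hl, hr, hnil, hnil⟩
  | case2 kl cl ll lr h =>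
    rw [Heap.sift, if_pos h]
    exact ⟨hl, hr, fun e he => h.trans (hl.le_of_mem he), hnil⟩
  | case3 kl cl ll lr h ih =>
    rw [Heap.sift, if_neg h]
    refine ⟨ih hb.1 hl.1 hl.2.1, hr, fun e he => ?_, hnil⟩
    rw [entries_sift, Multiset.mem_cons] at he
    rcases he with rfl | he
    · exact (not_le.1 h).le
    · exact hl.le_of_mem (Multiset.mem_cons_of_mem he)
  | case4 kl cl ll lr kr cr rl rr h h' =>
    rw [Heap.sift, if_pos h, if_pos h']
    exact ⟨hl, hr, fun e he => h'.trans (hl.le_of_mem he),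
      fun e he => (h'.trans h).trans (hr.le_of_mem he)⟩
  | case5 kl cl ll lr kr cr rl rr h h' ih =>
    rw [Heap.sift, if_pos h, if_neg h']
    refine ⟨ih hb.1 hl.1 hl.2.1, hr, fun e he => ?_, fun e he => h.trans (hr.le_of_mem he)⟩
    rw [entries_sift, Multiset.mem_cons] at he
    rcases he with rfl | he
    · exact (not_le.1 h').le
    · exact hl.le_of_mem (Multiset.mem_cons_of_mem he)
  | case6 kl cl ll lr kr cr rl rr h h' =>
    rw [Heap.sift, if_neg h, if_pos h']
    have h0 := (not_le.1 h).le
    exact ⟨hl, hr, fun e he => (h'.trans h0).trans (hl.le_of_mem he),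
      fun e he => h'.trans (hr.le_of_mem he)⟩
  | case7 kl cl ll lr kr cr rl rr h h' ih =>
    rw [Heap.sift, if_neg h, if_neg h']
    have h0 := (not_le.1 h).le
    refine ⟨hl, ih hb.2.1 hr.1 hr.2.1, fun e he => h0.trans (hl.le_of_mem he), fun e he => ?_⟩
    rw [entries_sift, Multiset.mem_cons] at he
    rcases he with rfl | he
    · exact (not_le.1 h').le
    · exact hr.le_of_mem (Multiset.mem_cons_of_mem he)

end Heap

/-! ### The algorithm as a function on lists -/

/-- The heap of the negated numbers of a list, so that the largest number is at the root. -/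
noncomputable def heapOfList : List ℝ → Heap
  | [] => .nil
  | x :: xs => (heapOfList xs).insert (0 - x) 0

/-- Take the root of the heap as often as the first list is long, each time replacing it by the
key `1`, which is larger than all negated processing times. -/
noncomputable def popAll : List ℝ → Heap → List ℝ
  | [], _ => []
  | _ :: _, .nil => []
  | _ :: xs, .node k _ l r => (0 - k) :: popAll xs (Heap.sift 1 0 l r)

/-- Heapsort, in non-increasing order. -/
noncomputable def sortDesc (xs : List ℝ) : List ℝ := popAll xs (heapOfList xs)

/-- A heap of idle machines, as many as `m` but not more than there are elements in the list.
Every machine is represented by its load and the number of its jobs. -/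
noncomputable def machines : ℝ → List ℝ → Heap
  | _, [] => .nil
  | m, _ :: xs => if 1 ≤ m then (machines (m - 1) xs).insert 0 0 else .nil

/-- List scheduling on a heap of machines of the jobs in the list, the first of which has the
number `idx`: the latest completion time, the number of a job that attains it, and the number of
jobs on its machine at that time. -/
noncomputable def schedule : List ℝ → Heap → ℝ → ℝ × ℝ × ℝ
  | [], _, _ => (0, 0, 0)
  | _ :: _, .nil, _ => (0, 0, 0)
  | x :: xs, .node load c l r, idx =>
    let res := schedule xs (Heap.sift (load + x) (c + 1) l r) (idx + 1)
    if res.1 ≤ load + x then (load + x, idx, c + 1) else res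

/-- For a list whose first element has the number `idx`: the sum of the elements with the numbers
`j - k + 1, …, j`, and the list of the others. -/
noncomputable def extract : List ℝ → ℝ → ℝ → ℝ → ℝ × List ℝ
  | [], _, _, _ => (0, [])
  | x :: xs, idx, j, k =>
    let res := extract xs (idx + 1) j k
    if idx ≤ j ∧ j + 1 ≤ idx + k then (x + res.1, res.2) else (res.1, x :: res.2)

/-- List scheduling with the elements `j - k + 1, …, j` joined to one job that comes first. -/
noncomputable def scheduleJoined (xs : List ℝ) (h : Heap) (j k : ℝ) : ℝ :=
  (schedule ((extract xs 0 j k).1 :: (extract xs 0 j k).2) h 0).1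

/-- Algorithm LPT-REV. -/
noncomputable def lptRev (m : ℝ) (xs : List ℝ) : ℝ :=
  let ys := sortDesc xs
  let h := machines m xs
  let res := schedule ys h 0
  min res.1 (min (scheduleJoined ys h res.2.1 1) (scheduleJoined ys h res.2.1 res.2.2))

/-! ### The program -/

/-- The first component of the pair in variable `i`. -/
def keyOf (i : ℕ) : Expr := .casePair (.var i) (.var 0) .nil

/-- `Heap.insert`, with the argument `(entry, heap)`. -/
def insertBody : Expr :=
  .casePair (.var 0)
    (.casePair (.var 1)
      (.casePair (.var 1)
        (.ifLe (keyOf 4) (keyOf 2)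
          (.pair (.var 4) (.pair (.call 1 (.pair (.var 2) (.var 1))) (.var 0)))
          (.pair (.var 2) (.pair (.call 1 (.pair (.var 4) (.var 1))) (.var 0))))
        .nil)
      (.pair (.var 0) (.pair .nil .nil)))
    .nil

/-- `Heap.sift`, with the argument `(entry, (left, right))`. -/
def siftBody : Expr :=
  .casePair (.var 0)
    (.casePair (.var 1)
      (.casePair (.var 0)
        (.casePair (.var 3)
          (.ifLe (keyOf 2) (keyOf 0)
            (.ifLe (keyOf 6) (keyOf 2) (.var 8)
              (.pair (.var 2) (.pair (.call 2 (.pair (.var 6) (.var 3))) (.var 5))))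
            (.ifLe (keyOf 6) (keyOf 0) (.var 8)
              (.pair (.var 0) (.pair (.var 4) (.call 2 (.pair (.var 6) (.var 1)))))))
          (.ifLe (keyOf 4) (keyOf 0) (.var 6)
            (.pair (.var 0) (.pair (.call 2 (.pair (.var 4) (.var 1))) .nil))))
        (.var 4))
      .nil)
    .nil

/-- `heapOfList`. -/
def heapOfListBody : Expr :=
  .casePair (.var 0)
    (.call 1 (.pair (.pair (.sub (.const 0) (.var 0)) (.const 0)) (.call 3 (.var 1))))
    .nil

/-- `popAll`, with the argument `(list, heap)`. -/
def popAllBody : Expr :=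
  .casePair (.var 0)
    (.casePair (.var 0)
      (.casePair (.var 3)
        (.pair (.sub (.const 0) (keyOf 0))
          (.call 4 (.pair (.var 3)
            (.call 2 (.pair (.pair (.const 1) (.const 0)) (.var 1))))))
        .nil)
      .nil)
    .nil

/-- `machines`, with the argument `(number, list)`. -/
def machinesBody : Expr :=
  .casePair (.var 0)
    (.casePair (.var 1)
      (.ifLe (.const 1) (.var 2)
        (.call 1 (.pair (.pair (.const 0) (.const 0))
          (.call 5 (.pair (.sub (.var 2) (.const 1)) (.var 1)))))
        .nil)
      .nil)
    .nil

/-- `schedule`, with the argument `(list, (heap, idx))`. -/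
def scheduleBody : Expr :=
  .casePair (.var 0)
    (.casePair (.var 0)
      (.casePair (.var 3)
        (.casePair (.var 0)
          (.casePair (.var 0)
            (.letIn (.add (.var 0) (.var 6))
              (.letIn (.add (.var 2) (.const 1))
                (.letIn (.call 6 (.pair (.var 9)
                    (.pair (.call 2 (.pair (.pair (.var 1) (.var 0)) (.var 5)))
                      (.add (.var 7) (.const 1)))))
                  (.ifLe (keyOf 0) (.var 2)
                    (.pair (.var 2) (.pair (.var 8) (.var 1)))
                    (.var 0)))))
            .nil)
          (.pair (.const 0) (.pair (.const 0) (.const 0))))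
        .nil)
      (.pair (.const 0) (.pair (.const 0) (.const 0))))
    .nil

/-- `extract`, with the argument `(list, (idx, (j, k)))`. -/
def extractBody : Expr :=
  .casePair (.var 0)
    (.casePair (.var 0)
      (.casePair (.var 3)
        (.casePair (.var 1)
          (.letIn (.call 7 (.pair (.var 5) (.pair (.add (.var 2) (.const 1)) (.var 3))))
            (.casePair (.var 0)
              (.ifLe (.var 5) (.var 3)
                (.ifLe (.add (.var 3) (.const 1)) (.add (.var 5) (.var 4))
                  (.pair (.add (.var 7) (.var 0)) (.var 1))
                  (.pair (.var 0) (.pair (.var 7) (.var 1))))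
                (.pair (.var 0) (.pair (.var 7) (.var 1))))
              .nil))
          .nil)
        .nil)
      (.pair (.const 0) .nil))
    .nil

/-- `scheduleJoined`, with the argument `((list, (0, (j, k))), heap)`. -/
def scheduleJoinedBody : Expr :=
  .casePair (.var 0)
    (.casePair (.call 6 (.pair (.call 7 (.var 0)) (.pair (.var 1) (.const 0)))) (.var 0) .nil)
    .nil

/-- `lptRev`, with the argument `(m, list)`. -/
def mainBody : Expr :=
  .casePair (.var 0)
    (.letIn (.call 4 (.pair (.var 1) (.call 3 (.var 1))))
      (.letIn (.call 5 (.pair (.var 1) (.var 2)))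
        (.letIn (.call 6 (.pair (.var 1) (.pair (.var 0) (.const 0))))
          (.casePair (.var 0)
            (.casePair (.var 1)
              (.letIn (.call 8 (.pair
                  (.pair (.var 6) (.pair (.const 0) (.pair (.var 0) (.const 1)))) (.var 5)))
                (.letIn (.call 8 (.pair
                    (.pair (.var 7) (.pair (.const 0) (.var 4))) (.var 6)))
                  (.letIn (.ifLe (.var 1) (.var 0) (.var 1) (.var 0))
                    (.ifLe (.var 5) (.var 0) (.var 5) (.var 0)))))
              .nil)
            .nil))))
    .nil

/-- The implementation of LPT-REV. -/
def program : Program :=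
  [mainBody, insertBody, siftBody, heapOfListBody, popAllBody, machinesBody, scheduleBody,
    extractBody, scheduleJoinedBody]

/-! ### Running time -/

theorem eval_keyOf {env : List Val} {i : ℕ} {k : ℝ} {v : Val}
    (h : env[i]? = some (.pair (.num k) v)) : Eval program env (keyOf i) (.num k) 3 :=
  .casePair_yes (.var h) (.var rfl)

theorem eval_insert (k c : ℝ) (h : Heap) :
    ∃ t ≤ 40 * (h.height + 1),
      Eval program [.pair (encodeEntry k c) h.encode] insertBody (h.insert k c).encode t := by
  induction h generalizing k c with
  | nil =>
    exact ⟨_, by simp only [Heap.height]; omega, .casePair_yes (.var rfl) (.casePair_no (.var rfl)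
      (.pair (.var rfl) (.pair .nil .nil)))⟩
  | node k' c' l r _ hr =>
    rw [Heap.insert]
    split_ifs with hk
    · obtain ⟨t, ht, he⟩ := hr k' c'
      refine ⟨_, ?_, .casePair_yes (.var rfl) (.casePair_yes (.var rfl) (.casePair_yes (.var rfl)
        (.ifLe_yes (eval_keyOf rfl) (eval_keyOf rfl) hk
          (.pair (.var rfl) (.pair (.call (.pair (.var rfl) (.var rfl)) rfl he) (.var rfl))))))⟩
      simp only [Heap.height]
      omega
    · obtain ⟨t, ht, he⟩ := hr k c
      refine ⟨_, ?_, .casePair_yes (.var rfl) (.casePair_yes (.var rfl) (.casePair_yes (.var rfl)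
        (.ifLe_no (eval_keyOf rfl) (eval_keyOf rfl) hk
          (.pair (.var rfl) (.pair (.call (.pair (.var rfl) (.var rfl)) rfl he) (.var rfl))))))⟩
      simp only [Heap.height]
      omega

theorem eval_zero {P : Program} {env : List Val} : Eval P env (.const 0) (.num 0) 1 := by
  simpa using Eval.const (P := P) (env := env) (c := 0)

theorem eval_one {P : Program} {env : List Val} : Eval P env (.const 1) (.num 1) 1 := by
  simpa using Eval.const (P := P) (env := env) (c := 1)

theorem eval_sift (k c : ℝ) (l r : Heap) :
    ∃ t ≤ 60 * (max l.height r.height + 1),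
      Eval program [.pair (encodeEntry k c) (.pair l.encode r.encode)] siftBody
        (Heap.sift k c l r).encode t := by
  induction l, r using Heap.sift.induct (k := k) with
  | case1 r =>
    rw [Heap.sift]
    exact ⟨_, by omega, .casePair_yes (.var rfl) (.casePair_yes (.var rfl)
      (.casePair_no (.var rfl) (.var rfl)))⟩
  | case2 kl cl ll lr h =>
    rw [Heap.sift, if_pos h]
    exact ⟨_, by omega, .casePair_yes (.var rfl) (.casePair_yes (.var rfl)
      (.casePair_yes (.var rfl) (.casePair_no (.var rfl)
        (.ifLe_yes (eval_keyOf rfl) (eval_keyOf rfl) h (.var rfl)))))⟩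
  | case3 kl cl ll lr h ih =>
    obtain ⟨t, ht, he⟩ := ih
    rw [Heap.sift, if_neg h]
    refine ⟨_, ?_, .casePair_yes (.var rfl) (.casePair_yes (.var rfl)
      (.casePair_yes (.var rfl) (.casePair_no (.var rfl)
        (.ifLe_no (eval_keyOf rfl) (eval_keyOf rfl) h (.pair (.var rfl)
          (.pair (.call (.pair (.var rfl) (.var rfl)) rfl he) .nil))))))⟩
    simp only [Heap.height]
    omega
  | case4 kl cl ll lr kr cr rl rr h h' =>
    rw [Heap.sift, if_pos h, if_pos h']
    exact ⟨_, by omega, .casePair_yes (.var rfl) (.casePair_yes (.var rfl)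
      (.casePair_yes (.var rfl) (.casePair_yes (.var rfl)
        (.ifLe_yes (eval_keyOf rfl) (eval_keyOf rfl) h
          (.ifLe_yes (eval_keyOf rfl) (eval_keyOf rfl) h' (.var rfl))))))⟩
  | case5 kl cl ll lr kr cr rl rr h h' ih =>
    obtain ⟨t, ht, he⟩ := ih
    rw [Heap.sift, if_pos h, if_neg h']
    refine ⟨_, ?_, .casePair_yes (.var rfl) (.casePair_yes (.var rfl)
      (.casePair_yes (.var rfl) (.casePair_yes (.var rfl)
        (.ifLe_yes (eval_keyOf rfl) (eval_keyOf rfl) h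
          (.ifLe_no (eval_keyOf rfl) (eval_keyOf rfl) h' (.pair (.var rfl)
            (.pair (.call (.pair (.var rfl) (.var rfl)) rfl he) (.var rfl))))))))⟩
    simp only [Heap.height]
    omega
  | case6 kl cl ll lr kr cr rl rr h h' =>
    rw [Heap.sift, if_neg h, if_pos h']
    exact ⟨_, by omega, .casePair_yes (.var rfl) (.casePair_yes (.var rfl)
      (.casePair_yes (.var rfl) (.casePair_yes (.var rfl)
        (.ifLe_no (eval_keyOf rfl) (eval_keyOf rfl) h
          (.ifLe_yes (eval_keyOf rfl) (eval_keyOf rfl) h' (.var rfl))))))⟩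
  | case7 kl cl ll lr kr cr rl rr h h' ih =>
    obtain ⟨t, ht, he⟩ := ih
    rw [Heap.sift, if_neg h, if_neg h']
    refine ⟨_, ?_, .casePair_yes (.var rfl) (.casePair_yes (.var rfl)
      (.casePair_yes (.var rfl) (.casePair_yes (.var rfl)
        (.ifLe_no (eval_keyOf rfl) (eval_keyOf rfl) h
          (.ifLe_no (eval_keyOf rfl) (eval_keyOf rfl) h' (.pair (.var rfl)
            (.pair (.var rfl) (.call (.pair (.var rfl) (.var rfl)) rfl he))))))))⟩
    simp only [Heap.height]
    omega

/-- A bound, up to constants, for the number of steps of a heap operation on a heap with at most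
`N` nodes. -/
def opCost (N : ℕ) : ℕ := 60 * (Nat.log 2 N + 3)

theorem eval_insert_le {N : ℕ} (k c : ℝ) {h : Heap} (hb : h.IsBraun) (hs : h.size ≤ N) :
    ∃ t ≤ opCost N,
      Eval program [.pair (encodeEntry k c) h.encode] insertBody (h.insert k c).encode t := by
  obtain ⟨t, ht, he⟩ := eval_insert k c h
  have := hb.height_le hs
  exact ⟨t, by unfold opCost; omega, he⟩

theorem eval_sift_le {N : ℕ} (k c : ℝ) {k' c' : ℝ} {l r : Heap}
    (hb : (Heap.node k' c' l r).IsBraun) (hs : (Heap.node k' c' l r).size ≤ N) :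
    ∃ t ≤ opCost N, Eval program [.pair (encodeEntry k c) (.pair l.encode r.encode)] siftBody
        (Heap.sift k c l r).encode t := by
  obtain ⟨t, ht, he⟩ := eval_sift k c l r
  have := hb.height_le hs
  simp only [Heap.height] at this
  exact ⟨t, by unfold opCost; omega, he⟩

theorem size_heapOfList (xs : List ℝ) : (heapOfList xs).size = xs.length := by
  induction xs with
  | nil => rfl
  | cons x xs ih => rw [heapOfList, Heap.size_insert, ih, List.length_cons]

theorem isBraun_heapOfList (xs : List ℝ) : (heapOfList xs).IsBraun := by
  induction xs with
  | nil => trivial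
  | cons x xs ih => exact ih.insert _ _

theorem isHeap_heapOfList (xs : List ℝ) : (heapOfList xs).IsHeap := by
  induction xs with
  | nil => trivial
  | cons x xs ih => exact ih.insert _ _

theorem eval_heapOfList {N : ℕ} (xs : List ℝ) (hN : xs.length ≤ N) :
    ∃ t ≤ xs.length * (opCost N + 40) + 40,
      Eval program [encodeList xs] heapOfListBody (heapOfList xs).encode t := by
  induction xs with
  | nil => exact ⟨_, by omega, .casePair_no (.var rfl) .nil⟩
  | cons x xs ih =>
    rw [List.length_cons] at hN ⊢
    obtain ⟨t, ht, he⟩ := ih (by omega)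
    obtain ⟨u, hu, hf⟩ := eval_insert_le (N := N) (0 - x) 0 (isBraun_heapOfList xs)
      (by rw [size_heapOfList]; omega)
    refine ⟨_, ?_, .casePair_yes (.var rfl) (.call (.pair (.pair (.sub eval_zero (.var rfl))
      eval_zero) (.call (.var rfl) rfl he)) rfl hf)⟩
    rw [add_mul]
    omega

theorem eval_popAll {N : ℕ} (xs : List ℝ) (h : Heap) (hb : h.IsBraun) (hs : h.size ≤ N) :
    ∃ t ≤ xs.length * (opCost N + 40) + 40,
      Eval program [.pair (encodeList xs) h.encode] popAllBody (encodeList (popAll xs h)) t := by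
  induction xs generalizing h with
  | nil => exact ⟨_, by omega, .casePair_yes (.var rfl) (.casePair_no (.var rfl) .nil)⟩
  | cons x xs ih =>
    rw [List.length_cons]
    cases h with
    | nil =>
      refine ⟨_, ?_, .casePair_yes (.var rfl) (.casePair_yes (.var rfl)
        (.casePair_no (.var rfl) .nil))⟩
      omega
    | node k c l r =>
      obtain ⟨u, hu, hf⟩ := eval_sift_le (N := N) 1 0 hb hs
      obtain ⟨t, ht, he⟩ := ih (Heap.sift 1 0 l r) (hb.sift 1 0) (by
        rw [Heap.size_sift]; exact hs)
      refine ⟨_, ?_, .casePair_yes (.var rfl) (.casePair_yes (.var rfl)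
        (.casePair_yes (.var rfl) (.pair (.sub eval_zero (eval_keyOf rfl))
          (.call (.pair (.var rfl) (.call (.pair (.pair eval_one eval_zero) (.var rfl)) rfl hf))
            rfl he))))⟩
      rw [add_mul]
      omega

theorem size_machines_le (m : ℝ) (xs : List ℝ) : (machines m xs).size ≤ xs.length := by
  induction xs generalizing m with
  | nil => simp [machines, Heap.size]
  | cons x xs ih =>
    rw [machines]
    split_ifs
    · rw [Heap.size_insert, List.length_cons]
      exact Nat.succ_le_succ (ih _)
    · simp [Heap.size]

theorem isBraun_machines (m : ℝ) (xs : List ℝ) : (machines m xs).IsBraun := by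
  induction xs generalizing m with
  | nil => simp [machines, Heap.IsBraun]
  | cons x xs ih =>
    rw [machines]
    split_ifs
    · exact (ih _).insert _ _
    · trivial

theorem isHeap_machines (m : ℝ) (xs : List ℝ) : (machines m xs).IsHeap := by
  induction xs generalizing m with
  | nil => simp [machines, Heap.IsHeap]
  | cons x xs ih =>
    rw [machines]
    split_ifs
    · exact (ih _).insert _ _
    · trivial

theorem eval_machines {N : ℕ} (m : ℝ) (xs : List ℝ) (hN : xs.length ≤ N) :
    ∃ t ≤ xs.length * (opCost N + 40) + 40,
      Eval program [.pair (.num m) (encodeList xs)] machinesBody (machines m xs).encode t := by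
  induction xs generalizing m with
  | nil =>
    rw [machines]
    exact ⟨_, by omega, .casePair_yes (.var rfl) (.casePair_no (.var rfl) .nil)⟩
  | cons x xs ih =>
    rw [List.length_cons] at hN ⊢
    rw [machines]
    split_ifs with hm
    · obtain ⟨t, ht, he⟩ := ih (m - 1) (by omega)
      obtain ⟨u, hu, hf⟩ := eval_insert_le (N := N) 0 0 (isBraun_machines (m - 1) xs)
        ((size_machines_le (m - 1) xs).trans (by omega))
      refine ⟨_, ?_, .casePair_yes (.var rfl) (.casePair_yes (.var rfl)
        (.ifLe_yes eval_one (.var rfl) hm (.call (.pair (.pair eval_zero eval_zero)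
          (.call (.pair (.sub (.var rfl) eval_one) (.var rfl)) rfl he)) rfl hf)))⟩
      rw [add_mul]
      omega
    · refine ⟨_, ?_, .casePair_yes (.var rfl) (.casePair_yes (.var rfl)
        (.ifLe_no eval_one (.var rfl) hm .nil))⟩
      omega

/-- The result of `schedule` as a value of the machine model. -/
noncomputable def encodeTriple (a : ℝ × ℝ × ℝ) : Val :=
  .pair (.num a.1) (.pair (.num a.2.1) (.num a.2.2))

theorem eval_schedule {N : ℕ} (xs : List ℝ) (h : Heap) (idx : ℝ) (hb : h.IsBraun)
    (hs : h.size ≤ N) :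
    ∃ t ≤ xs.length * (opCost N + 60) + 40,
      Eval program [.pair (encodeList xs) (.pair h.encode (.num idx))] scheduleBody
        (encodeTriple (schedule xs h idx)) t := by
  induction xs generalizing h idx with
  | nil => exact ⟨_, by omega, .casePair_yes (.var rfl) (.casePair_no (.var rfl)
      (.pair eval_zero (.pair eval_zero eval_zero)))⟩
  | cons x xs ih =>
    rw [List.length_cons]
    cases h with
    | nil =>
      refine ⟨_, ?_, .casePair_yes (.var rfl) (.casePair_yes (.var rfl)
        (.casePair_yes (.var rfl) (.casePair_no (.var rfl)
          (.pair eval_zero (.pair eval_zero eval_zero)))))⟩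
      omega
    | node load c l r =>
      obtain ⟨u, hu, hf⟩ := eval_sift_le (N := N) (load + x) (c + 1) hb hs
      obtain ⟨t, ht, he⟩ := ih (Heap.sift (load + x) (c + 1) l r) (idx + 1) (hb.sift _ _) (by
        rw [Heap.size_sift]; exact hs)
      rw [schedule]
      split_ifs with hle
      · refine ⟨_, ?_, .casePair_yes (.var rfl) (.casePair_yes (.var rfl)
          (.casePair_yes (.var rfl) (.casePair_yes (.var rfl) (.casePair_yes (.var rfl)
          (.letIn (.add (.var rfl) (.var rfl)) (.letIn (.add (.var rfl) eval_one)
            (.letIn (.call (.pair (.var rfl) (.pair (.call (.pair (.pair (.var rfl) (.var rfl))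
              (.var rfl)) rfl hf) (.add (.var rfl) eval_one))) rfl he)
              (.ifLe_yes (eval_keyOf rfl) (.var rfl) hle
                (.pair (.var rfl) (.pair (.var rfl) (.var rfl)))))))))))⟩
        rw [add_mul]
        omega
      · refine ⟨_, ?_, .casePair_yes (.var rfl) (.casePair_yes (.var rfl)
          (.casePair_yes (.var rfl) (.casePair_yes (.var rfl) (.casePair_yes (.var rfl)
          (.letIn (.add (.var rfl) (.var rfl)) (.letIn (.add (.var rfl) eval_one)
            (.letIn (.call (.pair (.var rfl) (.pair (.call (.pair (.pair (.var rfl) (.var rfl))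
              (.var rfl)) rfl hf) (.add (.var rfl) eval_one))) rfl he)
              (.ifLe_no (eval_keyOf rfl) (.var rfl) hle (.var rfl)))))))))⟩
        rw [add_mul]
        omega

theorem eval_extract (xs : List ℝ) (idx j k : ℝ) :
    ∃ t ≤ xs.length * 60 + 40,
      Eval program [.pair (encodeList xs) (.pair (.num idx) (.pair (.num j) (.num k)))]
        extractBody (encodeList ((extract xs idx j k).1 :: (extract xs idx j k).2)) t := by
  induction xs generalizing idx with
  | nil => exact ⟨_, by omega, .casePair_yes (.var rfl) (.casePair_no (.var rfl)
      (.pair eval_zero .nil))⟩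
  | cons x xs ih =>
    rw [List.length_cons]
    obtain ⟨t, ht, he⟩ := ih (idx + 1)
    rw [extract]
    by_cases h1 : idx ≤ j
    · by_cases h2 : j + 1 ≤ idx + k
      · rw [if_pos ⟨h1, h2⟩]
        refine ⟨_, ?_, .casePair_yes (.var rfl) (.casePair_yes (.var rfl)
          (.casePair_yes (.var rfl) (.casePair_yes (.var rfl)
          (.letIn (.call (.pair (.var rfl) (.pair (.add (.var rfl) eval_one) (.var rfl))) rfl he)
            (.casePair_yes (.var rfl) (.ifLe_yes (.var rfl) (.var rfl) h1
              (.ifLe_yes (.add (.var rfl) eval_one) (.add (.var rfl) (.var rfl)) h2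
                (.pair (.add (.var rfl) (.var rfl)) (.var rfl)))))))))⟩
        omega
      · rw [if_neg fun h => h2 h.2]
        refine ⟨_, ?_, .casePair_yes (.var rfl) (.casePair_yes (.var rfl)
          (.casePair_yes (.var rfl) (.casePair_yes (.var rfl)
          (.letIn (.call (.pair (.var rfl) (.pair (.add (.var rfl) eval_one) (.var rfl))) rfl he)
            (.casePair_yes (.var rfl) (.ifLe_yes (.var rfl) (.var rfl) h1
              (.ifLe_no (.add (.var rfl) eval_one) (.add (.var rfl) (.var rfl)) h2
                (.pair (.var rfl) (.pair (.var rfl) (.var rfl))))))))))⟩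
        omega
    · rw [if_neg fun h => h1 h.1]
      refine ⟨_, ?_, .casePair_yes (.var rfl) (.casePair_yes (.var rfl)
        (.casePair_yes (.var rfl) (.casePair_yes (.var rfl)
        (.letIn (.call (.pair (.var rfl) (.pair (.add (.var rfl) eval_one) (.var rfl))) rfl he)
          (.casePair_yes (.var rfl) (.ifLe_no (.var rfl) (.var rfl) h1
            (.pair (.var rfl) (.pair (.var rfl) (.var rfl)))))))))⟩
      omega

theorem length_popAll_le (xs : List ℝ) (h : Heap) : (popAll xs h).length ≤ xs.length := by
  induction xs generalizing h with
  | nil => simp [popAll]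
  | cons x xs ih =>
    cases h with
    | nil => simp [popAll]
    | node k c l r => simpa [popAll] using ih _

theorem length_extract_le (xs : List ℝ) (idx j k : ℝ) :
    (extract xs idx j k).2.length ≤ xs.length := by
  induction xs generalizing idx with
  | nil => simp [extract]
  | cons x xs ih =>
    have := ih (idx + 1)
    rw [extract]
    split_ifs
    · simp only [List.length_cons]; omega
    · simpa using this

theorem eval_scheduleJoined {N : ℕ} (xs : List ℝ) (h : Heap) (j k : ℝ) (hb : h.IsBraun)
    (hs : h.size ≤ N) (hN : xs.length ≤ N) :
    ∃ t ≤ (N + 1) * (opCost N + 120) + 100,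
      Eval program [.pair (.pair (encodeList xs) (.pair (.num 0) (.pair (.num j) (.num k))))
        h.encode] scheduleJoinedBody (.num (scheduleJoined xs h j k)) t := by
  obtain ⟨t, ht, he⟩ := eval_extract xs 0 j k
  obtain ⟨u, hu, hf⟩ := eval_schedule (N := N)
    ((extract xs 0 j k).1 :: (extract xs 0 j k).2) h 0 hb hs
  refine ⟨_, ?_, .casePair_yes (.var rfl) (.casePair_yes (.call (.pair (.call (.var rfl) rfl he)
    (.pair (.var rfl) eval_zero)) rfl hf) (.var rfl))⟩
  have h1 := length_extract_le xs 0 j k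
  rw [List.length_cons] at hu
  have h2 : ((extract xs 0 j k).2.length + 1) * (opCost N + 60) ≤ (N + 1) * (opCost N + 60) :=
    Nat.mul_le_mul_right _ (by omega)
  have h3 : (N + 1) * (opCost N + 120) = (N + 1) * (opCost N + 60) + (N + 1) * 60 := by ring
  omega

theorem eval_min {P : Program} {env : List Val} {i i' : ℕ} {x y : ℝ}
    (h : env[i]? = some (.num x)) (h' : env[i']? = some (.num y)) :
    Eval P env (.ifLe (.var i) (.var i') (.var i) (.var i')) (.num (min x y)) 4 := by
  by_cases hxy : x ≤ y
  · rw [min_eq_left hxy]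
    exact .ifLe_yes (.var h) (.var h') hxy (.var h)
  · rw [min_eq_right (not_le.1 hxy).le]
    exact .ifLe_no (.var h) (.var h') hxy (.var h')

theorem haltsWith_lptRev (m : ℝ) (xs : List ℝ) :
    ∃ t ≤ (xs.length + 1) * (6 * opCost xs.length + 1000),
      HaltsWith program (.pair (.num m) (encodeList xs)) (.num (lptRev m xs)) t := by
  set N := xs.length with hN
  have hHb := isBraun_heapOfList xs
  have hHs := size_heapOfList xs
  have hMb := isBraun_machines m xs
  have hMs := size_machines_le m xs
  have hlen : (sortDesc xs).length ≤ N := length_popAll_le _ _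
  obtain ⟨t₁, ht₁, h₁⟩ := eval_heapOfList (N := N) xs le_rfl
  obtain ⟨t₂, ht₂, h₂⟩ := eval_popAll (N := N) xs _ hHb hHs.le
  obtain ⟨t₃, ht₃, h₃⟩ := eval_machines (N := N) m xs le_rfl
  obtain ⟨t₄, ht₄, h₄⟩ := eval_schedule (N := N) (sortDesc xs) _ 0 hMb hMs
  obtain ⟨t₅, ht₅, h₅⟩ := eval_scheduleJoined (N := N) (sortDesc xs) _
    (schedule (sortDesc xs) (machines m xs) 0).2.1 1 hMb hMs hlen
  obtain ⟨t₆, ht₆, h₆⟩ := eval_scheduleJoined (N := N) (sortDesc xs) _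
    (schedule (sortDesc xs) (machines m xs) 0).2.1
    (schedule (sortDesc xs) (machines m xs) 0).2.2 hMb hMs hlen
  refine ⟨_, ?_, .call (.var rfl) rfl (.casePair_yes (.var rfl)
    (.letIn (.call (.pair (.var rfl) (.call (.var rfl) rfl h₁)) rfl h₂)
    (.letIn (.call (.pair (.var rfl) (.var rfl)) rfl h₃)
    (.letIn (.call (.pair (.var rfl) (.pair (.var rfl) eval_zero)) rfl h₄)
    (.casePair_yes (.var rfl) (.casePair_yes (.var rfl)
    (.letIn (.call (.pair (.pair (.var rfl) (.pair eval_zero (.pair (.var rfl) eval_one)))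
      (.var rfl)) rfl h₅)
    (.letIn (.call (.pair (.pair (.var rfl) (.pair eval_zero (.var rfl)))
      (.var rfl)) rfl h₆)
    (.letIn (eval_min rfl rfl) (eval_min rfl rfl))))))))))⟩
  have h7 : (sortDesc xs).length * (opCost N + 60) ≤ N * (opCost N + 60) :=
    Nat.mul_le_mul_right _ hlen
  rw [← hN] at ht₁ ht₂ ht₃
  ring_nf at *
  omega

/-! ### Sorting and list scheduling with heaps -/

theorem entries_heapOfList (xs : List ℝ) :
    (heapOfList xs).entries = (xs : Multiset ℝ).map fun y => (0 - y, 0) := by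
  induction xs with
  | nil => rfl
  | cons x xs ih =>
    rw [heapOfList, Heap.entries_insert, ih, ← Multiset.cons_coe, Multiset.map_cons]

theorem popAll_spec (xs : List ℝ) (ys : Multiset ℝ) (a : ℕ) (h : Heap) (hy : ∀ y ∈ ys, 0 ≤ y)
    (hb : h.IsBraun) (hh : h.IsHeap)
    (hent : h.entries = ys.map (fun y => (0 - y, (0 : ℝ))) + Multiset.replicate a (1, 0))
    (hc : xs.length = Multiset.card ys) :
    ((popAll xs h : List ℝ) : Multiset ℝ) = ys ∧ (popAll xs h).Pairwise (· ≥ ·) := by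
  induction xs generalizing ys a h with
  | nil =>
    rw [List.length_nil] at hc
    rw [Multiset.card_eq_zero.1 hc.symm, popAll]
    simp
  | cons x xs ih =>
    rw [List.length_cons] at hc
    obtain ⟨y₀, hy₀⟩ := Multiset.card_pos_iff_exists_mem.1 (by omega : 0 < Multiset.card ys)
    have hmem : ∀ y ∈ ys, (0 - y, (0 : ℝ)) ∈ h.entries := fun y hy' => by
      rw [hent]
      exact Multiset.mem_add.2 (Or.inl (Multiset.mem_map.2 ⟨y, hy', rfl⟩))
    cases h with
    | nil => simpa [Heap.entries] using hmem y₀ hy₀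
    | node k c l r =>
      have hk : ∀ y ∈ ys, k ≤ 0 - y := fun y hy' => hh.le_of_mem (hmem y hy')
      -- the root is not one of the keys `1`
      obtain ⟨y, hyy, hkc⟩ : ∃ y ∈ ys, (0 - y, (0 : ℝ)) = (k, c) := by
        have hroot : (k, c) ∈ (Heap.node k c l r).entries := Multiset.mem_cons_self _ _
        rw [hent, Multiset.mem_add] at hroot
        rcases hroot with hroot | hroot
        · exact Multiset.mem_map.1 hroot
        · have h1 := Multiset.eq_of_mem_replicate hroot
          have h2 := hk y₀ hy₀
          have h3 := hy y₀ hy₀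
          rw [Prod.mk.injEq] at h1
          linarith [h1.1]
      obtain ⟨ys', rfl⟩ := Multiset.exists_cons_of_mem hyy
      rw [Prod.mk.injEq] at hkc
      obtain ⟨rfl, rfl⟩ := hkc
      rw [Heap.entries, Multiset.map_cons, Multiset.cons_add, Multiset.cons_inj_right] at hent
      rw [Multiset.card_cons] at hc
      obtain ⟨h1, h2⟩ := ih ys' (a + 1) (Heap.sift 1 0 l r)
        (fun z hz => hy z (Multiset.mem_cons_of_mem hz)) (hb.sift _ _)
        (Heap.IsHeap.sift hb hh.1 hh.2.1 _ _)
        (by rw [Heap.entries_sift, hent, Multiset.replicate_succ, Multiset.add_cons]) (by omega)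
      rw [popAll, sub_sub_cancel]
      refine ⟨by rw [← Multiset.cons_coe, h1], List.pairwise_cons.2 ⟨fun z hz => ?_, h2⟩⟩
      rw [← Multiset.mem_coe, h1] at hz
      have := hk z (Multiset.mem_cons_of_mem hz)
      show z ≤ y
      linarith

theorem exists_sortDesc_eq {n : ℕ} (p : Fin n → ℝ) (hp : ∀ j, 0 ≤ p j) :
    ∃ σ : Equiv.Perm (Fin n), Antitone (p ∘ σ) ∧
      sortDesc (List.ofFn p) = List.ofFn (p ∘ σ) := by
  obtain ⟨h1, h2⟩ := popAll_spec (List.ofFn p) (List.ofFn p) 0 (heapOfList (List.ofFn p))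
    (by simpa using hp) (isBraun_heapOfList _) (isHeap_heapOfList _)
    (by rw [entries_heapOfList]; simp) (by simp)
  refine ⟨Tuple.sort fun j => -p j, fun i j hij => ?_, ?_⟩
  · have := Tuple.monotone_sort (fun j => -p j) hij
    simpa using this
  · refine List.Perm.eq_of_pairwise' (r := (· ≥ ·)) h2 ?_ ?_
    · rw [List.pairwise_ofFn]
      intro i j hij
      have := Tuple.monotone_sort (fun j => -p j) hij.le
      simpa using this
    · exact (Multiset.coe_eq_coe.1 h1).trans (Equiv.Perm.ofFn_comp_perm _ _).symm

theorem entries_machines (m : ℕ) (xs : List ℝ) :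
    (machines m xs).entries = Multiset.replicate (min m xs.length) (0, 0) := by
  induction xs generalizing m with
  | nil => simp [machines, Heap.entries]
  | cons x xs ih =>
    rw [machines]
    cases m with
    | zero => rw [if_neg (by norm_num)]; simp [Heap.entries]
    | succ m =>
      rw [if_pos (by push_cast; linarith [(Nat.cast_nonneg m : (0 : ℝ) ≤ m)]),
        Heap.entries_insert, Nat.cast_succ, add_sub_cancel_right, ih, List.length_cons,
        Nat.add_min_add_right, Multiset.replicate_succ]

/-- Replacing the root of a heap that describes the machines: it stands for a machine `i₀` with
minimal load, and only the entry of `i₀` changes. -/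
theorem exists_root {M : ℕ} {L c : Fin M → ℝ} {load c₀ : ℝ} {l r : Heap}
    (hh : (Heap.node load c₀ l r).IsHeap)
    (hent : (Heap.node load c₀ l r).entries = univ.val.map fun i => (L i, c i)) :
    ∃ i₀, L i₀ = load ∧ c i₀ = c₀ ∧ (∀ i, L i₀ ≤ L i) ∧ ∀ a b : ℝ,
      (Heap.sift a b l r).entries =
        univ.val.map fun i => (Function.update L i₀ a i, Function.update c i₀ b i) := by
  have hroot : (load, c₀) ∈ (Heap.node load c₀ l r).entries := Multiset.mem_cons_self _ _
  rw [hent, Multiset.mem_map] at hroot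
  obtain ⟨i₀, -, h0⟩ := hroot
  rw [Prod.mk.injEq] at h0
  obtain ⟨rfl, rfl⟩ := h0
  refine ⟨i₀, rfl, rfl, fun i => ?_, fun a b => ?_⟩
  · refine hh.le_of_mem (e := (L i, c i)) ?_
    rw [hent]
    exact Multiset.mem_map.2 ⟨i, mem_univ i, rfl⟩
  · have huniv : (univ : Finset (Fin M)).val = i₀ ::ₘ (univ.erase i₀).val := by
      rw [← insert_val_of_notMem (notMem_erase i₀ univ), insert_erase (mem_univ i₀)]
    rw [huniv, Multiset.map_cons, Heap.entries, Multiset.cons_inj_right] at hent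
    rw [Heap.entries_sift, hent, huniv, Multiset.map_cons, Function.update_self,
      Function.update_self]
    refine congrArg _ (Multiset.map_congr rfl fun i hi => ?_)
    have hne : i ≠ i₀ := ne_of_mem_erase (mem_def.2 hi)
    rw [Function.update_of_ne hne, Function.update_of_ne hne]

theorem sum_filter_cons {n M : ℕ} (f : Fin n → ℝ) {x : Fin n} {xs : List (Fin n)} (hx : x ∉ xs)
    (s : Fin n → Fin M) (i₀ i : Fin M) (D : Fin n → Prop) [DecidablePred D] (hD : D x) :
    ∑ y with y ∈ x :: xs ∧ D y ∧ Function.update s x i₀ y = i, f y =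
      (if i = i₀ then f x else 0) + ∑ y with y ∈ xs ∧ D y ∧ s y = i, f y := by
  rw [sum_filter, sum_filter, ← sum_erase_add _ _ (mem_univ x), ← sum_erase_add univ
    (fun y => if y ∈ xs ∧ D y ∧ s y = i then f y else 0) (mem_univ x)]
  rw [if_neg (fun h : x ∈ xs ∧ _ => hx h.1), add_zero, add_comm]
  congr 1
  · simp [hD, eq_comm]
  · refine sum_congr rfl fun y hy => ?_
    have hne : y ≠ x := ne_of_mem_erase hy
    simp [hne]

/-- `schedule` follows the rule of list scheduling and reports the latest completion time. -/
theorem schedule_spec {n M : ℕ} (w : Fin n → ℝ) (hw : ∀ l, 0 ≤ w l) (ls : List (Fin n))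
    (hls : ls.Pairwise (· < ·)) (L c : Fin M → ℝ) (hL : ∀ i, 0 ≤ L i) (hM : 0 < M) (h : Heap)
    (hb : h.IsBraun) (hh : h.IsHeap) (hent : h.entries = univ.val.map fun i => (L i, c i))
    (a : ℕ) :
    0 ≤ (schedule (ls.map w) h a).1 ∧ ∃ s : Fin n → Fin M,
      (∀ l ∈ ls, ∀ i, L (s l) + ∑ x with x ∈ ls ∧ x < l ∧ s x = s l, w x ≤
        L i + ∑ x with x ∈ ls ∧ x < l ∧ s x = i, w x) ∧
      (∀ l ∈ ls, L (s l) + ∑ x with x ∈ ls ∧ x ≤ l ∧ s x = s l, w x ≤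
        (schedule (ls.map w) h a).1) ∧
      (ls ≠ [] → ∃ l ∈ ls,
        (schedule (ls.map w) h a).1 =
          L (s l) + ∑ x with x ∈ ls ∧ x ≤ l ∧ s x = s l, w x ∧
        (schedule (ls.map w) h a).2.2 =
          c (s l) + ∑ x with x ∈ ls ∧ x ≤ l ∧ s x = s l, (1 : ℝ) ∧
        ((∀ i (hi : i < ls.length), (ls[i] : ℕ) = a + i) →
          (schedule (ls.map w) h a).2.1 = (l : ℕ))) := by
  induction ls generalizing L c h a with
  | nil => exact ⟨by simp [schedule], fun _ => ⟨0, hM⟩, by simp⟩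
  | cons x xs ih =>
    rw [List.pairwise_cons] at hls
    have hxs : x ∉ xs := fun hx => lt_irrefl _ (hls.1 x hx)
    cases h with
    | nil =>
      have := congrArg Multiset.card hent
      simp [Heap.entries] at this
      omega
    | node load c₀ l r =>
      obtain ⟨i₀, rfl, rfl, hmin, hsift⟩ := exists_root hh hent
      set L' := Function.update L i₀ (L i₀ + w x) with hL'
      set c' := Function.update c i₀ (c i₀ + 1) with hc'
      obtain ⟨hz, s, h1, h2, h3⟩ := ih hls.2 L' c' (fun i => by
          by_cases hi : i = i₀
          · rw [hi, hL', Function.update_self]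
            exact add_nonneg (hL i₀) (hw x)
          · rw [hL', Function.update_of_ne hi]
            exact hL i) (Heap.sift (L i₀ + w x) (c i₀ + 1) l r) (hb.sift _ _)
        (Heap.IsHeap.sift hb hh.1 hh.2.1 _ _) (hsift _ _) (a + 1)
      rw [Nat.cast_succ] at hz h2 h3
      set res := schedule (xs.map w) (Heap.sift (L i₀ + w x) (c i₀ + 1) l r) (a + 1) with hres
      have hrun : schedule ((x :: xs).map w) (Heap.node (L i₀) (c i₀) l r) a =
          if res.1 ≤ L i₀ + w x then (L i₀ + w x, (a : ℝ), c i₀ + 1) else res := by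
        rw [List.map_cons, schedule]
      rw [hrun]
      set s' := Function.update s x i₀ with hs'
      have hs'x : s' x = i₀ := by rw [hs', Function.update_self]
      have hs'l : ∀ l ∈ xs, s' l = s l := fun l hl => by
        rw [hs', Function.update_of_ne]
        rintro rfl
        exact hxs hl
      -- the loads seen by the jobs after `x`
      have hload : ∀ (D : Fin n → Prop) [DecidablePred D] (i : Fin M), D x →
          L i + ∑ y with y ∈ x :: xs ∧ D y ∧ s' y = i, w y =
            L' i + ∑ y with y ∈ xs ∧ D y ∧ s y = i, w y := by
        intro D _ i hD
        rw [hs', sum_filter_cons w hxs s i₀ i D hD, hL']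
        by_cases hi : i = i₀
        · rw [if_pos hi, hi, Function.update_self]; ring
        · rw [if_neg hi, Function.update_of_ne hi]; ring
      have hcount : ∀ (D : Fin n → Prop) [DecidablePred D] (i : Fin M), D x →
          c i + ∑ y with y ∈ x :: xs ∧ D y ∧ s' y = i, (1 : ℝ) =
            c' i + ∑ y with y ∈ xs ∧ D y ∧ s y = i, (1 : ℝ) := by
        intro D _ i hD
        rw [hs', sum_filter_cons (fun _ => 1) hxs s i₀ i D hD, hc']
        by_cases hi : i = i₀
        · rw [if_pos hi, hi, Function.update_self]; ring
        · rw [if_neg hi, Function.update_of_ne hi]; ring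
      have hempty : ∀ i, ({y | y ∈ xs ∧ y ≤ x ∧ s y = i} : Finset (Fin n)) = ∅ := by
        intro i
        refine filter_eq_empty_iff.2 fun y _ hy => ?_
        exact absurd hy.2.1 (not_le.2 (hls.1 y hy.1))
      have hempty' : ∀ i, ({y | y ∈ x :: xs ∧ y < x ∧ s' y = i} : Finset (Fin n)) = ∅ := by
        intro i
        refine filter_eq_empty_iff.2 fun y _ hy => ?_
        rcases List.mem_cons.1 hy.1 with rfl | h
        · exact lt_irrefl _ hy.2.1
        · exact absurd hy.2.1 (not_lt.2 (hls.1 y h).le)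
      have hfirst : L i₀ + ∑ y with y ∈ x :: xs ∧ y ≤ x ∧ s' y = i₀, w y = L i₀ + w x := by
        rw [hload (· ≤ x) i₀ le_rfl, hempty, sum_empty, hL', Function.update_self, add_zero]
      refine ⟨?_, s', fun l hl i => ?_, fun l hl => ?_, fun _ => ?_⟩
      · split_ifs
        · exact add_nonneg (hL i₀) (hw x)
        · exact hz
      · rcases List.mem_cons.1 hl with rfl | hl
        · rw [hs'x, hempty', hempty', sum_empty, add_zero, add_zero]
          exact hmin i
        · rw [hs'l l hl, hload (· < l) _ (hls.1 l hl), hload (· < l) _ (hls.1 l hl)]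
          exact h1 l hl i
      · have hmax : L i₀ + w x ≤ (if res.1 ≤ L i₀ + w x then (L i₀ + w x, (a : ℝ), c i₀ + 1)
            else res).1 ∧ res.1 ≤ (if res.1 ≤ L i₀ + w x then (L i₀ + w x, (a : ℝ), c i₀ + 1)
            else res).1 := by
          split_ifs with hle
          · exact ⟨le_rfl, hle⟩
          · exact ⟨(not_le.1 hle).le, le_rfl⟩
        rcases List.mem_cons.1 hl with rfl | hl
        · rw [hs'x, hfirst]
          exact hmax.1
        · rw [hs'l l hl, hload (· ≤ l) _ (hls.1 l hl).le]
          exact (h2 l hl).trans hmax.2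
      · by_cases hle : res.1 ≤ L i₀ + w x
        · rw [if_pos hle]
          refine ⟨x, List.mem_cons_self, ?_, ?_, fun hnum => ?_⟩
          · rw [hs'x, hfirst]
          · rw [hs'x, hcount (· ≤ x) i₀ le_rfl, hempty, sum_empty, hc', Function.update_self,
              add_zero]
          · have := hnum 0 (by simp)
            simp at this
            rw [this]
        · rw [if_neg hle]
          have hne : xs ≠ [] := by
            rintro rfl
            refine hle ?_
            rw [hres]
            simp only [List.map_nil, schedule]
            exact add_nonneg (hL i₀) (hw x)
          obtain ⟨l, hl, h4, h5, h6⟩ := h3 hne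
          refine ⟨l, List.mem_cons_of_mem _ hl, ?_, ?_, fun hnum => h6 fun i hi => ?_⟩
          · rw [hs'l l hl, hload (· ≤ l) _ (hls.1 l hl).le]
            exact h4
          · rw [hs'l l hl, hcount (· ≤ l) _ (hls.1 l hl).le]
            exact h5
          · have := hnum (i + 1) (by simpa using hi)
            simp at this
            omega

/-! ### The value that is returned -/

section Fin

variable {n M : ℕ}

/-- `schedule`, run on the jobs outside `S` after the jobs of `S` have been put on machine `i₀`,
yields an `LPT(S)` schedule. -/
theorem exists_isLPTSchedule (S : Finset (Fin n)) (q : Fin n → ℝ) (hq : ∀ l, 0 ≤ q l)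
    (hM : 0 < M) (i₀ : Fin M) (c : Fin M → ℝ) (h : Heap) (hb : h.IsBraun) (hh : h.IsHeap)
    (hent : h.entries =
      univ.val.map fun i => (Function.update (fun _ => (0 : ℝ)) i₀ (∑ l ∈ S, q l) i, c i)) (a : ℕ) :
    ∃ s : Fin n → Fin M, (∀ l ∈ S, s l = i₀) ∧ IsLPTSchedule S q s ∧
      (∀ l ∉ S, loadBefore S q s l (s l) + q l ≤
        (schedule (((List.finRange n).filter (· ∉ S)).map q) h a).1) ∧
      ((List.finRange n).filter (· ∉ S) ≠ [] → ∃ l ∉ S,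
        (schedule (((List.finRange n).filter (· ∉ S)).map q) h a).1 =
          loadBefore S q s l (s l) + q l ∧
        (schedule (((List.finRange n).filter (· ∉ S)).map q) h a).2.2 =
          c (s l) + ∑ x with x ∉ S ∧ x ≤ l ∧ s x = s l, (1 : ℝ) ∧
        (S = ∅ → a = 0 →
          (schedule (((List.finRange n).filter (· ∉ S)).map q) h a).2.1 = (l : ℕ))) := by
  classical
  set ls := (List.finRange n).filter (· ∉ S) with hls
  have hmem : ∀ l, l ∈ ls ↔ l ∉ S := by simp [hls]
  have hsum0 : 0 ≤ ∑ l ∈ S, q l := sum_nonneg fun l _ => hq l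
  obtain ⟨-, s, h1, h2, h3⟩ := schedule_spec q hq ls
    ((List.pairwise_lt_finRange n).filter _)
    (Function.update (fun _ => (0 : ℝ)) i₀ (∑ l ∈ S, q l)) c (fun i => by
      by_cases hi : i = i₀
      · rw [hi, Function.update_self]; exact hsum0
      · rw [Function.update_of_ne hi]) hM h hb hh hent a
  set s' : Fin n → Fin M := fun l => if l ∈ S then i₀ else s l with hs'
  have hS : ∀ l ∈ S, s' l = i₀ := fun l hl => if_pos hl
  have hnS : ∀ l ∉ S, s' l = s l := fun l hl => if_neg hl
  -- the load of a machine consists of the jobs of `S` and of jobs in the list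
  have hsplit : ∀ (D : Fin n → Prop) [DecidablePred D] (i : Fin M),
      Function.update (fun _ => (0 : ℝ)) i₀ (∑ l ∈ S, q l) i + ∑ x with x ∈ ls ∧ D x ∧ s x = i, q x =
        ∑ x with (x ∈ S ∨ D x) ∧ s' x = i, q x := by
    intro D _ i
    have hset : ({x | (x ∈ S ∨ D x) ∧ s' x = i} : Finset (Fin n)) =
        {x ∈ S | i = i₀} ∪ ({x | x ∈ ls ∧ D x ∧ s x = i} : Finset (Fin n)) := by
      ext x
      simp only [mem_filter, mem_univ, true_and, mem_union, hmem]
      by_cases hx : x ∈ S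
      · rw [hS x hx]; simp [hx, eq_comm]
      · rw [hnS x hx]; simp [hx]
    rw [hset, sum_union]
    · congr 1
      by_cases hi : i = i₀
      · rw [hi, Function.update_self]; simp
      · rw [Function.update_of_ne hi]; simp [hi]
    · rw [disjoint_left]
      intro x hx hx'
      simp only [mem_filter, mem_univ, true_and, hmem] at hx hx'
      exact hx'.1 hx.1
  have hle : ∀ l ∉ S, Function.update (fun _ => (0 : ℝ)) i₀ (∑ l ∈ S, q l) (s l) +
      ∑ x with x ∈ ls ∧ x ≤ l ∧ s x = s l, q x = loadBefore S q s' l (s' l) + q l := by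
    intro l hl
    have hset : ({x | x ∈ ls ∧ x ≤ l ∧ s x = s l} : Finset (Fin n)) =
        insert l ({x | x ∈ ls ∧ x < l ∧ s x = s l} : Finset (Fin n)) := by
      ext x
      simp only [mem_filter, mem_univ, true_and, mem_insert]
      constructor
      · rintro ⟨hx1, hx2, hx3⟩
        rcases hx2.eq_or_lt with hx | hx
        · exact Or.inl hx
        · exact Or.inr ⟨hx1, hx, hx3⟩
      · rintro (rfl | ⟨hx1, hx2, hx3⟩)
        · exact ⟨(hmem x).2 hl, le_rfl, rfl⟩
        · exact ⟨hx1, hx2.le, hx3⟩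
    rw [hset, sum_insert (by simp), hnS l hl, loadBefore, ← hsplit (· < l) (s l)]
    ring
  refine ⟨s', hS, ⟨fun j hj l hl => (hS j hj).trans (hS l hl).symm, fun j hj i => ?_⟩,
    fun l hl => ?_, fun hne => ?_⟩
  · have := h1 j ((hmem j).2 hj) i
    rw [hnS j hj, loadBefore, loadBefore, ← hsplit (· < j), ← hsplit (· < j)]
    exact this
  · rw [← hle l hl]
    exact h2 l ((hmem l).2 hl)
  · obtain ⟨l, hl, h4, h5, h6⟩ := h3 hne
    rw [hmem] at hl
    refine ⟨l, hl, by rw [← hle l hl]; exact h4, ?_, fun hS0 ha => h6 fun i hi => ?_⟩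
    · rw [h5, hnS l hl]
      congr 1
      refine sum_congr ?_ fun _ _ => rfl
      ext x
      simp only [mem_filter, mem_univ, true_and, hmem]
      constructor
      · rintro ⟨hx1, hx2, hx3⟩
        exact ⟨hx1, hx2, by rw [hnS x hx1]; exact hx3⟩
      · rintro ⟨hx1, hx2, hx3⟩
        exact ⟨hx1, hx2, by rw [hnS x hx1] at hx3; exact hx3⟩
    · subst hS0 ha
      have : ls = List.finRange n := by simp [hls]
      simp [this]

theorem load_nonneg {q : Fin n → ℝ} (hq : ∀ l, 0 ≤ q l) (s : Fin n → Fin M) (i : Fin M) :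
    0 ≤ load q s i :=
  sum_nonneg fun l _ => hq l

theorem loadBefore_add_le_load {S : Finset (Fin n)} {q : Fin n → ℝ} (hq : ∀ l, 0 ≤ q l)
    {s : Fin n → Fin M} {l : Fin n} (hl : l ∉ S) :
    loadBefore S q s l (s l) + q l ≤ load q s (s l) := by
  rw [loadBefore, add_comm, ← sum_insert (by simp [hl])]
  refine sum_le_sum_of_subset_of_nonneg (fun x hx => ?_) fun x _ _ => hq x
  simp only [mem_insert, mem_filter, mem_univ, true_and] at hx ⊢
  rcases hx with rfl | ⟨-, hx⟩
  · rfl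
  · exact hx

/-- The makespan of a schedule that starts with `S` on one machine is the latest completion time. -/
theorem makespan_eq {S : Finset (Fin n)} {q : Fin n → ℝ} (hq : ∀ l, 0 ≤ q l) (hM : 0 < M)
    {s : Fin n → Fin M} {z : ℝ} (hS : ∑ l ∈ S, q l ≤ z)
    (hle : ∀ l ∉ S, loadBefore S q s l (s l) + q l ≤ z)
    (hz : (∃ l ∉ S, z = loadBefore S q s l (s l) + q l) ∨
      ∃ i, (∀ l ∈ S, s l = i) ∧ z = ∑ l ∈ S, q l) : makespan q s = z := by
  have : Nonempty (Fin M) := ⟨⟨0, hM⟩⟩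
  refine le_antisymm ?_ ?_
  · by_contra! hlt
    obtain ⟨l, hl, he⟩ := exists_last_job hq (hS.trans_lt hlt)
    exact absurd (he ▸ hlt) (not_lt.2 (hle l hl))
  · rcases hz with ⟨l, hl, rfl⟩ | ⟨i, hi, rfl⟩
    · exact (loadBefore_add_le_load hq hl).trans (load_le_makespan q s _)
    · refine le_trans ?_ (load_le_makespan q s i)
      exact sum_le_sum_of_subset_of_nonneg (fun x hx => by simpa using hi x hx) fun x _ _ => hq x

theorem makespan_castLE {m : ℕ} (hMm : M ≤ m) (hM : 0 < M) {q : Fin n → ℝ} (hq : ∀ l, 0 ≤ q l)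
    (s : Fin n → Fin M) : makespan q (fun l => Fin.castLE hMm (s l)) = makespan q s := by
  have : Nonempty (Fin M) := ⟨⟨0, hM⟩⟩
  have : Nonempty (Fin m) := ⟨⟨0, hM.trans_le hMm⟩⟩
  have hload : ∀ i, load q (fun l => Fin.castLE hMm (s l)) (Fin.castLE hMm i) = load q s i :=
    fun i => by simp [load, Fin.castLE_inj]
  refine le_antisymm (ciSup_le fun i => ?_) (ciSup_le fun i => ?_)
  · by_cases hi : ∃ i', Fin.castLE hMm i' = i
    · obtain ⟨i', rfl⟩ := hi
      rw [hload]
      exact load_le_makespan q s i'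
    · have h0 : load q (fun l => Fin.castLE hMm (s l)) i = 0 := by
        refine sum_eq_zero fun l hl => ?_
        exact absurd ⟨s l, by simpa using hl⟩ hi
      rw [h0]
      exact (load_nonneg hq s ⟨0, hM⟩).trans (load_le_makespan q s _)
  · rw [← hload]
    exact load_le_makespan _ _ _

/-- With at least as many machines as jobs, an LPT schedule on `n` of them is one on all of them,
because one of the `n` machines is always empty. -/
theorem isLPTSchedule_castLE {m : ℕ} (hMm : M ≤ m) (hM : M = m ∨ M = n) {S : Finset (Fin n)}
    {q : Fin n → ℝ} (hq : ∀ l, 0 ≤ q l) {s : Fin n → Fin M} (hs : IsLPTSchedule S q s) :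
    IsLPTSchedule S q fun l => Fin.castLE hMm (s l) := by
  have hload : ∀ j i, loadBefore S q (fun l => Fin.castLE hMm (s l)) j (Fin.castLE hMm i) =
      loadBefore S q s j i := fun j i => by simp [loadBefore, Fin.castLE_inj]
  refine ⟨fun j hj l hl => congrArg (Fin.castLE hMm) (hs.1 j hj l hl), fun j hj i => ?_⟩
  rw [hload]
  by_cases hi : ∃ i', Fin.castLE hMm i' = i
  · obtain ⟨i', rfl⟩ := hi
    rw [hload]
    exact hs.2 j hj i'
  · have hMn : M = n := by
      rcases hM with rfl | h
      · exact absurd ⟨i, by simp⟩ hi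
      · exact h
    obtain ⟨i', hi'⟩ : ∃ i', i' ∉ ({x | x ∈ S ∨ x < j} : Finset (Fin n)).image s := by
      by_contra! hall
      have h1 : (univ : Finset (Fin M)).card ≤
          (({x | x ∈ S ∨ x < j} : Finset (Fin n)).image s).card :=
        card_le_card fun x _ => hall x
      have h2 := card_image_le (s := ({x | x ∈ S ∨ x < j} : Finset (Fin n))) (f := s)
      have h3 : ({x | x ∈ S ∨ x < j} : Finset (Fin n)).card < (univ : Finset (Fin n)).card :=
        card_lt_card (ssubset_univ_iff.2 fun he => by
          have : j ∈ ({x | x ∈ S ∨ x < j} : Finset (Fin n)) := by rw [he]; exact mem_univ j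
          simp [hj] at this)
      rw [card_univ, Fintype.card_fin] at h1 h3
      omega
    have h0 : loadBefore S q s j i' = 0 := by
      refine sum_eq_zero fun x hx => ?_
      simp only [mem_filter, mem_univ, true_and] at hx
      exact absurd (mem_image.2 ⟨x, by simpa using hx.1, hx.2⟩) hi'
    refine (hs.2 j hj i').trans ?_
    rw [h0]
    exact sum_nonneg fun x _ => hq x

theorem extract_spec (q : Fin n → ℝ) (j K : ℕ) (S : Finset (Fin n))
    (hS : ∀ l : Fin n, l ∈ S ↔ (l : ℕ) ≤ j ∧ j < l + K) (ls : List (Fin n)) (a : ℕ)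
    (hls : ∀ i (hi : i < ls.length), (ls[i] : ℕ) = a + i) :
    extract (ls.map q) a j K =
      (((ls.filter (· ∈ S)).map q).sum, (ls.filter (· ∉ S)).map q) := by
  induction ls generalizing a with
  | nil => simp [extract]
  | cons x xs ih =>
    have hx : (x : ℕ) = a := (hls 0 (by simp)).trans (add_zero a)
    have hxs := ih (a + 1) fun i hi => by
      have := hls (i + 1) (by simpa using hi)
      simp at this
      omega
    rw [Nat.cast_succ] at hxs
    rw [List.map_cons, extract, hxs]
    have hcond : ((a : ℝ) ≤ j ∧ (j : ℝ) + 1 ≤ a + K) ↔ x ∈ S := by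
      rw [hS, hx, Nat.lt_iff_add_one_le]
      norm_cast
    by_cases hxS : x ∈ S
    · rw [if_pos (hcond.2 hxS)]
      simp [hxS]
    · rw [if_neg fun h => hxS (hcond.1 h)]
      simp [hxS]

theorem scheduleJoined_spec (q : Fin n → ℝ) (hq : ∀ l, 0 ≤ q l) (j K : ℕ) (S : Finset (Fin n))
    (hS : ∀ l : Fin n, l ∈ S ↔ (l : ℕ) ≤ j ∧ j < l + K) (hM : 0 < M) (h : Heap)
    (hb : h.IsBraun) (hh : h.IsHeap) (hent : h.entries = Multiset.replicate M (0, 0)) :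
    ∃ s : Fin n → Fin M, IsLPTSchedule S q s ∧
      makespan q s = scheduleJoined (List.ofFn q) h j K := by
  have hex : extract (List.ofFn q) 0 j K =
      (∑ l ∈ S, q l, ((List.finRange n).filter (· ∉ S)).map q) := by
    have := extract_spec q j K S hS (List.finRange n) 0 (by simp)
    rw [Nat.cast_zero, ← List.ofFn_eq_map] at this
    rw [this, ← List.sum_toFinset _ ((List.nodup_finRange n).filter _)]
    congr 2
    ext l
    simp
  have hsum0 : 0 ≤ ∑ l ∈ S, q l := sum_nonneg fun l _ => hq l
  rw [scheduleJoined, hex]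
  cases h with
  | nil =>
    have := congrArg Multiset.card hent
    simp [Heap.entries] at this
    omega
  | node load c₀ l r =>
    have hent' : (Heap.node load c₀ l r).entries =
        univ.val.map fun i : Fin M => ((fun _ => (0 : ℝ)) i, (fun _ => (0 : ℝ)) i) := by
      rw [hent]
      simp
    obtain ⟨i₀, rfl, rfl, -, hsift⟩ := exists_root hh hent'
    obtain ⟨s, hs₀, hs, hle, hatt⟩ := exists_isLPTSchedule S q hq hM i₀ _
      (Heap.sift (0 + ∑ l ∈ S, q l) (0 + 1) l r) (hb.sift _ _)
      (Heap.IsHeap.sift hb hh.1 hh.2.1 _ _) (by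
        have := hsift (0 + ∑ l ∈ S, q l) (0 + 1)
        rw [zero_add] at this ⊢
        exact this) 1
    rw [Nat.cast_one] at hle hatt
    refine ⟨s, hs, ?_⟩
    rw [schedule]
    simp only [zero_add] at hle hatt ⊢
    split_ifs with hc
    · exact makespan_eq hq hM le_rfl (fun l hl => (hle l hl).trans hc) (Or.inr ⟨i₀, hs₀, rfl⟩)
    · have hne : (List.finRange n).filter (· ∉ S) ≠ [] := by
        intro hnil
        rw [hnil] at hc
        exact hc (by simpa [schedule] using hsum0)
      obtain ⟨x, hx, hxz, -⟩ := hatt hne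
      exact makespan_eq hq hM (not_le.1 hc).le hle (Or.inl ⟨x, hx, hxz⟩)

theorem isOutput_lptRev {m : ℕ} (p : Fin n → ℝ) (hn : 1 ≤ n) (hm : 1 ≤ m) (hp : ∀ j, 0 ≤ p j) :
    IsOutput m p (lptRev m (List.ofFn p)) := by
  obtain ⟨σ, hσ, hsort⟩ := exists_sortDesc_eq p hp
  set q : Fin n → ℝ := p ∘ σ with hqdef
  have hq : ∀ l, 0 ≤ q l := fun l => hp (σ l)
  set h := machines m (List.ofFn p) with hh
  have hb : h.IsBraun := isBraun_machines _ _
  have hheap : h.IsHeap := isHeap_machines _ _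
  set M := min m n with hMdef
  have hM : 0 < M := by omega
  have hMm : M ≤ m := min_le_left _ _
  have hMmn : M = m ∨ M = n := by omega
  have hent : h.entries = Multiset.replicate M (0, 0) := by
    rw [hh, entries_machines, List.length_ofFn]
  obtain ⟨s, -, hs, hle, hatt⟩ := exists_isLPTSchedule (∅ : Finset (Fin n)) q hq hM ⟨0, hM⟩
    (fun _ => 0) h hb hheap (by rw [hent, sum_empty]; simp) 0
  have hfin : ((List.finRange n).filter (· ∉ (∅ : Finset (Fin n)))).map q = List.ofFn q := by
    rw [List.ofFn_eq_map]
    simp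
  rw [hfin, Nat.cast_zero] at hle hatt
  obtain ⟨j, -, hz, hk, hj⟩ := hatt (by
    intro hnil
    have := congrArg List.length hnil
    simp at this
    omega)
  replace hj := hj rfl rfl
  have hmk : makespan q s = (schedule (List.ofFn q) h 0).1 :=
    makespan_eq hq hM (by
      rw [sum_empty, hz]
      exact add_nonneg (sum_nonneg fun x _ => hq x) (hq j)) hle (Or.inl ⟨j, by simp, hz⟩)
  have hjobs : jobsUpTo (fun l => Fin.castLE hMm (s l)) j = jobsUpTo s j := by
    simp [jobsUpTo, Fin.castLE_inj]
  have hcard : (schedule (List.ofFn q) h 0).2.2 = ((jobsUpTo s j).card : ℝ) := by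
    rw [hk, zero_add, sum_const, nsmul_one, jobsUpTo]
    simp
  obtain ⟨s₂, hs₂, hz₂⟩ := scheduleJoined_spec q hq j 1 {j} (fun l => by
    rw [Finset.mem_singleton, Fin.ext_iff]; omega) hM h hb hheap hent
  obtain ⟨s₃, hs₃, hz₃⟩ := scheduleJoined_spec q hq j (jobsUpTo s j).card
    (criticalTuple (fun l => Fin.castLE hMm (s l)) j) (fun l => by
      rw [criticalTuple, hjobs, mem_filter, Fin.le_def]
      exact and_iff_right (mem_univ l)) hM h hb hheap hent
  refine ⟨σ, hσ, fun l => Fin.castLE hMm (s l), fun l => Fin.castLE hMm (s₂ l),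
    fun l => Fin.castLE hMm (s₃ l), j, isLPTSchedule_castLE hMm hMmn hq hs, ?_,
    isLPTSchedule_castLE hMm hMmn hq hs₂, isLPTSchedule_castLE hMm hMmn hq hs₃, ?_⟩
  · rw [IsCritical, hjobs, makespan_castLE hMm hM hq, hmk, hz, loadBefore, add_comm,
      ← sum_insert (by simp)]
    refine sum_congr ?_ fun _ _ => rfl
    ext x
    simp only [jobsUpTo, mem_filter, mem_univ, true_and, mem_insert, notMem_empty, false_or]
    constructor
    · rintro ⟨h1, h2⟩
      rcases h1.eq_or_lt with h3 | h3
      · exact Or.inl h3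
      · exact Or.inr ⟨h3, h2⟩
    · rintro (rfl | ⟨h1, h2⟩)
      · simp
      · exact ⟨h1.le, h2⟩
  · rw [makespan_castLE hMm hM hq, makespan_castLE hMm hM hq, makespan_castLE hMm hM hq, hmk, hz₂,
      hz₃, lptRev, hsort, ← hh]
    rw [hj, hcard, Nat.cast_one]

end Fin

/-! ### The time bound -/

/-- `(n + 1) (a log₂ n + b)` is at most a multiple of `n log n` for `n ≥ 2`. -/
theorem exists_le_mul_log : ∃ C : ℝ, ∀ n : ℕ, 2 ≤ n →
    (((n + 1) * (6 * opCost n + 1000) : ℕ) : ℝ) ≤ C * (n * Real.log n) := by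
  refine ⟨2 * (360 / Real.log 2 + 2080 / Real.log 2), fun n hn => ?_⟩
  have hn' : (2 : ℝ) ≤ n := by exact_mod_cast hn
  have hl2 : 0 < Real.log 2 := Real.log_pos (by norm_num)
  have hlog : Real.log 2 ≤ Real.log n := Real.log_le_log (by norm_num) hn'
  have h1 : (Nat.log 2 n : ℝ) ≤ Real.log n / Real.log 2 := by
    have := Real.natLog_le_logb n 2
    rwa [Real.logb, Nat.cast_ofNat] at this
  have h2 : (1 : ℝ) ≤ Real.log n / Real.log 2 := by rwa [one_le_div hl2]
  unfold opCost
  push_cast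
  have h3 : (6 * (60 * ((Nat.log 2 n : ℝ) + 3)) + 1000) ≤
      2440 * (Real.log n / Real.log 2) := by linarith
  calc ((n : ℝ) + 1) * (6 * (60 * ((Nat.log 2 n : ℝ) + 3)) + 1000)
      ≤ (2 * n) * (2440 * (Real.log n / Real.log 2)) :=
        mul_le_mul (by linarith) h3 (by positivity) (by positivity)
    _ = _ := by ring

end LPTRev

theorem mainTheorem1 :
    -- LPT-REV has an implementation that runs in time `O(n log n)`, uniformly in `m`
    (∃ (P : LPTRev.Program) (C : ℝ), ∀ (n m : ℕ) (p : Fin n → ℝ),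
      1 ≤ n → 1 ≤ m → (∀ j, 0 ≤ p j) →
        ∃ (z : ℝ) (t : ℕ),
          LPTRev.HaltsWith P (LPTRev.encodeInstance m p) (LPTRev.Val.num z) t ∧
          LPTRev.IsOutput m p z ∧
          (2 ≤ n → (t : ℝ) ≤ C * ((n : ℝ) * Real.log (n : ℝ)))) ∧
    -- for `m ≥ 3`, every value LPT-REV can return is within the factor `4/3 - 1/(3(m-1))`
    (∀ (n m : ℕ) (p : Fin n → ℝ), 3 ≤ m → (∀ j, 0 ≤ p j) →
      ∀ z : ℝ, LPTRev.IsOutput m p z →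
        z ≤ (4 / 3 - 1 / (3 * ((m : ℝ) - 1))) * LPTRev.optMakespan m p) ∧
    -- which is better than Graham's bound
    (∀ m : ℕ, 3 ≤ m →
      (4 / 3 - 1 / (3 * ((m : ℝ) - 1)) : ℝ) < 4 / 3 - 1 / (3 * (m : ℝ))) := by
  refine ⟨?_, fun n m p hm hp z hz => LPTRev.le_of_isOutput hm hp hz, fun m hm => ?_⟩
  · obtain ⟨C, hC⟩ := LPTRev.exists_le_mul_log
    refine ⟨LPTRev.program, C, fun n m p hn hm hp => ?_⟩
    obtain ⟨t, ht, he⟩ := LPTRev.haltsWith_lptRev m (List.ofFn p)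
    rw [List.length_ofFn] at ht
    exact ⟨_, t, he, LPTRev.isOutput_lptRev p hn hm hp,
      fun h2 => (Nat.cast_le.2 ht).trans (hC n h2)⟩
  · have hm' : (3 : ℝ) ≤ m := by exact_mod_cast hm
    have h1 : (1 : ℝ) / (3 * m) < 1 / (3 * (m - 1)) :=
      one_div_lt_one_div_of_lt (by linarith) (by linarith)
    linarith
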